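/- **Leakage functions.** A leakage function on $\tau$ bits is a (sampleable) distribution $L$ on pairs $(S,c)$ with $S\subseteq\{1,\dots,\tau\}$ and $c\in\{0,1\}$, where $c=0$ signals detection. For a class $\mathcal L$ of leakage functions consider the game in which $\Gamma\in\{0,1\}^\tau$ is uniform, an unbounded adversary picks $L\in\mathcal L$, $(S,c)$ is drawn from $L$, the adversary loses if $c=0$, and otherwise sees $\{(i,\Gamma_i)\}_{i\in S}$ and wins if it guesses all $\Gamma_i$ with $i\notin S$. Let $\mathrm{success}_{\mathcal L}$ be the optimal winning probability and $\mathrm{leak}_{\mathcal L}=\log_2(\mathrm{success}_{\mathcal L})+\tau$. The class is $\kappa$-secure if $\tau-\mathrm{leak}_{\mathcal L}\ge\kappa$. **Boxes.** The box $\mathrm{WaBit}^{\mathcal L}(\ell,\tau)$ samples a uniform global key $\Gamma_A\in\{0,1\}^\tau$, uniform bits $x_i$ and local keys $K'_i\in\{0,1\}^\tau$ for $i=1,\dots,\ell$, and gives $(x_i,M'_i)_i$ with $M'_i=K'_i\oplus x_i\Gamma_A$ to $A$ and $(\Gamma_A,(K'_i)_i)$ to $B$. If $A$ is corrupted, then $A$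 may first choose some $L\in\mathcal L$: the box samples $(S,c)$ from $L$; if $c=0$ it outputs $\mathtt{fail}$ to $B$ and terminates, and if $c=1$ it gives $\{(i,(\Gamma_A)_i)\}_{i\in S}$ to $A$. Afterwards $A$ chooses the $x_i$ and $M'_i$, and $K'_i=M'_i\oplus x_i\Gamma_A$. If $B$ is corrupted, then $B$ chooses $\Gamma_A$ and the $K'_i$. The adversary may at any time input a string $\Gamma$ and is told whether $\Gamma=\Gamma_A$. The box $\mathrm{aBit}(\ell,\psi)$ is $\mathrm{WaBit}^{\mathcal L_0}(\ell,\psi)$, where $\mathcal L_0$ is the class of all leakage functions that never leak a bit (they may be detected). **Protocol.** The parties call $\mathrm{WaBit}^{\mathcal L}(\ell,\tau)$; $B$ samples a uniformly random binary matrix $\mathbf A\in\{0,1\}^{\psi\times\tau}$ and sends it to $A$; $A$ outputs $(x_i,\mathbf A M'_i)_i$; $B$ outputs $\Delta_A=\mathbf A\Gamma_A$ and $(\mathbf A K'_i)_i$. If the box outputs $\mathtt{fail}$ to $B$, then $B$ outputs $\mathtt{fail}$. **Theorem.** There are absolute constants such that the following holds for all $\psi,\ell,\tau$ with $\tau=\frac{22}{3}\psi$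 and every class $\mathcal L$ of leakage functions on $\tau$ bits that is $\left(\frac34\tau\right)$-secure. 1. The protocol securely implements $\mathrm{aBit}(\ell,\psi)$ in the $\mathrm{WaBit}^{\mathcal L}(\ell,\tau)$-hybrid model (universal composability, static active corruption of at most one party) with security parameter $\psi$: for each choice of the corrupted party (none, $A$ or $B$) there is a simulator, given by Boolean circuits of size polynomial in $\psi+\ell$ with polynomially many random bits and memory cells (and, for each leakage function $L$ input by the adversary, one sample of $L$), such that every computationally unbounded environment distinguishes the protocol from the ideal box with the simulator with advantage at most $2^{2-\psi}$. 2. The communication of the protocol is $O(\psi^2)$ bits, and for $\ell\ge1$ its work, measured in bit operations, coin tosses and bits sent or received, is $O(\psi^2\ell)$. 3. For every $L\in\mathcal L$ used by a corrupted $A$, the key $\Delta_A$ is uniform to $A$ except with probability $2^{2-\psi}$: with $\Gamma_A$, $(S,c)\leftarrow L$ and $\mathbf A$ sampled independently, there is an event $F$ with $\Pr[F]\le2^{2-\psi}$ such that, when $F$ does not occur and the attack is not detected ($c=1$), $\Delta_A$ is uniformly distributed on $\{0,1\}^\psi$ and independent of the view of $A$, which consists of $\{(i,(\Gamma_A)_i)\}_{i\in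 S}$ and $\mathbf A$. -/

import Mathlib

open scoped ENNReal

noncomputable section

namespace UC

/-- Bits; `⊕` is addition and the conjunction of two bits is multiplication. -/
abbrev Bit : Type := ZMod 2

/-! ### Leakage functions -/

/-- A leakage function on `n` bits: a distribution on pairs `(S, c)`, where `S` is the set of
positions to be leaked and `c = false` signals that the attack is detected. -/
abbrev Leakage (n : ℕ) : Type := PMF (Finset (Fin n) × Bool)

/-- The data `{(i, Γ i)}` for `i ∈ S`. -/
def reveal {n : ℕ} (S : Finset (Fin n)) (Γ : Fin n → Bit) : Fin n → Option Bit :=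
  fun i => if i ∈ S then some (Γ i) else none

/-- The guessing game for `L` and an unbounded guesser `g`, which sees the leaked bits: a uniform
secret `Γ` and `(S, c)` from `L` are drawn, and `g` wins if `c = 1` and it guesses the secret
correctly outside `S`. -/
def guessGame {n : ℕ} (L : Leakage n) (g : (Fin n → Option Bit) → PMF (Fin n → Bit)) : PMF Prop :=
  (PMF.uniformOfFintype (Fin n → Bit)).bind fun Γ =>
    L.bind fun p =>
      (g (reveal p.1 Γ)).map fun v => p.2 = true ∧ ∀ i, i ∉ p.1 → v i = Γ i

/-- The success probability of an optimal adversary in the guessing game for the class `𝓛`. -/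
def success {n : ℕ} (𝓛 : Set (Leakage n)) : ℝ≥0∞ :=
  ⨆ L ∈ 𝓛, ⨆ g : (Fin n → Option Bit) → PMF (Fin n → Bit), guessGame L g True

/-- The number of bits leaked by `𝓛`: `log₂ (success 𝓛) + n`, with `log₂ 0 = -∞`. -/
def leak {n : ℕ} (𝓛 : Set (Leakage n)) : EReal :=
  ENNReal.log (success 𝓛) / ((Real.log 2 : ℝ) : EReal) + ((n : ℝ) : EReal)

/-- `𝓛` is `κ`-secure on `n` bits. -/
def IsSecure {n : ℕ} (𝓛 : Set (Leakage n)) (κ : ℝ) : Prop :=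
  (κ : EReal) ≤ ((n : ℝ) : EReal) - leak 𝓛

/-- The class of leakage functions that never leak (but may be detected). -/
def neverLeak (n : ℕ) : Set (Leakage n) :=
  {L | ∀ p ∈ L.support, p.2 = true → p.1 = ∅}

/-- The leakage function that leaks nothing and is detected exactly if `c = false`. -/
def noLeak (n : ℕ) (c : Bool) : neverLeak n :=
  ⟨PMF.pure (∅, c), by
    intro p hp _
    rw [PMF.support_pure, Set.mem_singleton_iff] at hp
    rw [hp]⟩

/-! ### Boolean circuits -/

/-- A gate reads inputs of the circuit (`Sum.inl i`) or results of earlier gates (`Sum.inr k`). -/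
inductive Gate (ι : Type) : Type
  | one : Gate ι
  | xor (a b : ι ⊕ ℕ) : Gate ι
  | and (a b : ι ⊕ ℕ) : Gate ι

/-- The value on a wire; a gate that has not been evaluated counts as `0`. -/
def wireVal {ι : Type} (x : ι → Bit) (vals : List Bit) : ι ⊕ ℕ → Bit
  | Sum.inl i => x i
  | Sum.inr k => vals.getD k 0

def Gate.eval {ι : Type} (x : ι → Bit) (vals : List Bit) : Gate ι → Bit
  | Gate.one => 1
  | Gate.xor a b => wireVal x vals a + wireVal x vals b
  | Gate.and a b => wireVal x vals a * wireVal x vals b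

/-- A Boolean circuit with inputs indexed by `ι` and outputs indexed by `κ`. -/
structure Circuit (ι κ : Type) : Type where
  gates : List (Gate ι)
  out : κ → ι ⊕ ℕ

/-- The number of bit operations. -/
def Circuit.size {ι κ : Type} (C : Circuit ι κ) : ℕ := C.gates.length

def Circuit.run {ι κ : Type} (C : Circuit ι κ) (x : ι → Bit) : κ → Bit :=
  fun k => wireVal x (C.gates.foldl (fun vals g => vals ++ [g.eval x vals]) []) (C.out k)

/-! ### Systems and environments -/

/-- A reactive probabilistic system. -/
structure System (I O : Type) : Type 1 where
  State : Type
  init : PMF State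
  step : State → I → PMF (State × O)

/-- A computationally unbounded probabilistic environment. It makes `rounds` activations, each
depending on the transcript so far (oldest entry first), and then outputs a bit. -/
structure Env (I O : Type) : Type where
  rounds : ℕ
  ask : List (I × O) → PMF I
  guess : List (I × O) → PMF Bool

def Env.play {I O : Type} (E : Env I O) (S : System I O) :
    ℕ → List (I × O) → S.State → PMF Bool
  | 0, h, _ => E.guess h
  | n + 1, h, s =>
    (E.ask h).bind fun i => (S.step s i).bind fun r => E.play S n (h ++ [(i, r.2)]) r.1

/-- The probability that the environment outputs `1` when it interacts with `S`. -/
def Env.prob {I O : Type} (E : Env I O) (S : System I O) : ℝ :=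
  ((S.init.bind fun s => E.play S E.rounds [] s) true).toReal

/-! ### The box for bit authentication with weak global key -/

/-- The statically corrupted party, if any. -/
inductive Corr : Type
  | none | alice | bob
  deriving DecidableEq

/-- Positions of the output of `A`: the bits `x i` and the `n`-bit MACs `M i`. -/
inductive AWire (ℓ n : ℕ) : Type
  | bit (i : Fin ℓ) : AWire ℓ n
  | mac (i : Fin ℓ) (j : Fin n) : AWire ℓ n

/-- Positions of the output of `B`: the global key and the local keys `K i`. -/
inductive BWire (ℓ n : ℕ) : Type
  | glob (j : Fin n) : BWire ℓ n
  | loc (i : Fin ℓ) (j : Fin n) : BWire ℓ n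

abbrev AShare (ℓ n : ℕ) : Type := AWire ℓ n → Bit

abbrev BShare (ℓ n : ℕ) : Type := BWire ℓ n → Bit

/-- From bits `x` and the keys of `B`: the share `(x i, M i)` of `A` with `M i = K i ⊕ x i Γ`. -/
def toAShare {ℓ n : ℕ} (x : Fin ℓ → Bit) (b : BShare ℓ n) : AShare ℓ n
  | AWire.bit i => x i
  | AWire.mac i j => b (BWire.loc i j) + x i * b (BWire.glob j)

/-- From a global key `Γ` and a share of `A`: the share of `B` with `K i = M i ⊕ x i Γ`. -/
def toBShare {ℓ n : ℕ} (Γ : Fin n → Bit) (a : AShare ℓ n) : BShare ℓ n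
  | BWire.glob j => Γ j
  | BWire.loc i j => a (AWire.mac i j) + a (AWire.bit i) * Γ j

/-- What honest `B` can obtain: a failure signal or keys. -/
inductive BOut (ℓ n : ℕ) : Type
  | fail : BOut ℓ n
  | share (b : BShare ℓ n) : BOut ℓ n

/-- Commands at the adversarial port of the box; `Λ` is the type of inputs of the leakage command.
`releaseA` and `releaseB` tell the box to hand its output to the respective honest party. -/
inductive BoxCmd (Λ : Type) (ℓ n : ℕ) : Type
  | query (Γ : Fin n → Bit) : BoxCmd Λ ℓ n
  | leak (L : Λ) : BoxCmd Λ ℓ n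
  | chooseA (a : AShare ℓ n) : BoxCmd Λ ℓ n
  | chooseB (b : BShare ℓ n) : BoxCmd Λ ℓ n
  | releaseA : BoxCmd Λ ℓ n
  | releaseB : BoxCmd Λ ℓ n

/-- Responses at the adversarial port: nothing, the answer to a global key query, leaked bits. -/
inductive Resp (n : ℕ) : Type
  | none : Resp n
  | answer (b : Bool) : Resp n
  | leaked (v : Fin n → Option Bit) : Resp n

/-- The result of a command: a response to the adversary and outputs to honest parties. -/
structure BoxOut (ℓ n : ℕ) : Type where
  resp : Resp n := Resp.none
  toA : Option (AShare ℓ n) := none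
  toB : Option (BOut ℓ n) := none

structure WaState (ℓ n : ℕ) : Type where
  /-- the global key, once it is determined -/
  key : Option (Fin n → Bit) := none
  shareA : Option (AShare ℓ n) := none
  shareB : Option (BShare ℓ n) := none
  leakUsed : Bool := false
  failed : Bool := false
  releasedA : Bool := false
  releasedB : Bool := false

/-- If nobody is corrupted, then the box samples the global key, the bits and the local keys. If `A`
is corrupted it samples only the global key. If `B` is corrupted, then the bits of `A` are sampled
when `B` has chosen the keys. -/
def waInit (ℓ n : ℕ) : Corr → PMF (WaState ℓ n)
  | Corr.none =>
    (PMF.uniformOfFintype (Fin n → Bit)).bind fun Γ =>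
    (PMF.uniformOfFintype (Fin ℓ → Bit)).bind fun x =>
    (PMF.uniformOfFintype (Fin ℓ → Fin n → Bit)).map fun K =>
      let b : BShare ℓ n := fun w =>
        match w with
        | BWire.glob j => Γ j
        | BWire.loc i j => K i j
      { key := some Γ, shareA := some (toAShare x b), shareB := some b }
  | Corr.alice =>
    (PMF.uniformOfFintype (Fin n → Bit)).map fun Γ => { key := some Γ }
  | Corr.bob => PMF.pure {}

open Classical in
/-- One command to the box with leakage class `𝓛`. Commands that are not allowed are ignored. -/
def waStep {ℓ n : ℕ} (𝓛 : Set (Leakage n)) (c : Corr) (s : WaState ℓ n) (q : BoxCmd 𝓛 ℓ n) :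
    PMF (WaState ℓ n × BoxOut ℓ n) :=
  if s.failed = true then PMF.pure (s, {}) else
  match q with
  | BoxCmd.query Γ =>
    match s.key with
    | some Γ₀ => PMF.pure (s, { resp := Resp.answer (decide (Γ = Γ₀)) })
    | none => PMF.pure (s, {})
  | BoxCmd.leak L =>
    match s.key with
    | some Γ₀ =>
      if c = Corr.alice ∧ s.leakUsed = false ∧ s.shareB = none then
        L.1.map fun p =>
          if p.2 = true then
            ({ s with leakUsed := true }, { resp := Resp.leaked (reveal p.1 Γ₀) })
          else
            ({ s with leakUsed := true, failed := true }, { toB := some BOut.fail })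
      else PMF.pure (s, {})
    | none => PMF.pure (s, {})
  | BoxCmd.chooseA a =>
    match s.key with
    | some Γ₀ =>
      if c = Corr.alice ∧ s.shareB = none then
        PMF.pure ({ s with shareA := some a, shareB := some (toBShare Γ₀ a) }, {})
      else PMF.pure (s, {})
    | none => PMF.pure (s, {})
  | BoxCmd.chooseB b =>
    if c = Corr.bob ∧ s.shareB = none then
      (PMF.uniformOfFintype (Fin ℓ → Bit)).map fun x =>
        ({ s with
            key := some fun j => b (BWire.glob j)
            shareA := some (toAShare x b)
            shareB := some b }, {})
    else PMF.pure (s, {})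
  | BoxCmd.releaseA =>
    match s.shareA with
    | some a =>
      if c ≠ Corr.alice ∧ s.releasedA = false then
        PMF.pure ({ s with releasedA := true }, { toA := some a })
      else PMF.pure (s, {})
    | none => PMF.pure (s, {})
  | BoxCmd.releaseB =>
    match s.shareB with
    | some b =>
      if c ≠ Corr.bob ∧ s.releasedB = false then
        PMF.pure ({ s with releasedB := true }, { toB := some (BOut.share b) })
      else PMF.pure (s, {})
    | none => PMF.pure (s, {})

/-! ### Protocols that use one call to the box and one message from `B` to `A` -/

/-- `B` tosses coins and computes a message for `A` and its output from the coins and its output of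
the box. `A` computes its output from its output of the box and the message. -/
structure Protocol (ℓ τ ψ : ℕ) : Type 1 where
  Coins : Type
  Msg : Type
  [fintypeCoins : Fintype Coins]
  [decEqCoins : DecidableEq Coins]
  [fintypeMsg : Fintype Msg]
  message : (Coins → Bit) → BShare ℓ τ → Msg → Bit
  outA : AShare ℓ τ → (Msg → Bit) → AShare ℓ ψ
  outB : (Coins → Bit) → BShare ℓ τ → BShare ℓ ψ

attribute [instance] Protocol.fintypeCoins Protocol.decEqCoins Protocol.fintypeMsg

/-- The number of bits sent by the parties. -/
def Protocol.communication {ℓ τ ψ : ℕ} (π : Protocol ℓ τ ψ) : ℕ := Fintype.card π.Msg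

/-- The parties can carry out the protocol with work at most `w`: bit operations of both parties,
coin tosses, and bits sent or received. -/
def Protocol.WorkAtMost {ℓ τ ψ : ℕ} (π : Protocol ℓ τ ψ) (w : ℕ) : Prop :=
  ∃ (CA : Circuit (AWire ℓ τ ⊕ π.Msg) (AWire ℓ ψ))
    (CB : Circuit (π.Coins ⊕ BWire ℓ τ) (π.Msg ⊕ BWire ℓ ψ)),
    (∀ a m, CA.run (Sum.elim a m) = π.outA a m) ∧
    (∀ r b, CB.run (Sum.elim r b) = Sum.elim (π.message r b) (π.outB r b)) ∧
    CA.size + CB.size + Fintype.card π.Coins + 2 * Fintype.card π.Msg ≤ w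

/-- The matrix whose entries are transmitted in a message. -/
def asMatrix {ψ τ : ℕ} (m : Fin ψ × Fin τ → Bit) : Matrix (Fin ψ) (Fin τ) Bit :=
  Matrix.of fun i j => m (i, j)

/-- Compression of the keys: `B` samples a uniformly random matrix `𝐀` with `ψ` rows and `τ` columns
and sends it to `A`. Then `A` replaces its MACs by `𝐀 M i`, and `B` replaces the global key and the
local keys by `𝐀 Γ` and `𝐀 K i`. -/
def compress (ℓ τ ψ : ℕ) : Protocol ℓ τ ψ where
  Coins := Fin ψ × Fin τ
  Msg := Fin ψ × Fin τ
  message r _ := r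
  outA a m w :=
    match w with
    | AWire.bit i => a (AWire.bit i)
    | AWire.mac i j => (asMatrix m).mulVec (fun k => a (AWire.mac i k)) j
  outB r b w :=
    match w with
    | BWire.glob j => (asMatrix r).mulVec (fun k => b (BWire.glob k)) j
    | BWire.loc i j => (asMatrix r).mulVec (fun k => b (BWire.loc i k)) j

/-! ### The protocol in the hybrid model -/

/-- Commands of the environment (which includes the adversary) in the hybrid model: commands to
the box, activation of an honest party, delivery of the message of honest `B` to honest `A`, and
sending a message in the name of corrupted `B`. -/
inductive AdvCmd (Λ Msg : Type) (ℓ τ : ℕ) : Type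
  | box (q : BoxCmd Λ ℓ τ) : AdvCmd Λ Msg ℓ τ
  | wakeA : AdvCmd Λ Msg ℓ τ
  | wakeB : AdvCmd Λ Msg ℓ τ
  | deliver : AdvCmd Λ Msg ℓ τ
  | send (m : Msg → Bit) : AdvCmd Λ Msg ℓ τ

/-- What the environment sees after a command: the response of the box, a message that honest `B`
has just sent, and the outputs of the honest parties. -/
structure Obs (Msg : Type) (ℓ τ ψ : ℕ) : Type where
  resp : Resp τ := Resp.none
  sent : Option (Msg → Bit) := none
  outA : Option (AShare ℓ ψ) := none
  outB : Option (BOut ℓ ψ) := none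

structure HybridState {ℓ τ ψ : ℕ} (π : Protocol ℓ τ ψ) : Type where
  box : WaState ℓ τ
  /-- the coins and the output of the box held by honest `B` -/
  bob : Option ((π.Coins → Bit) × BShare ℓ τ) := none
  /-- the message of honest `B`, while it is in transit -/
  channel : Option (π.Msg → Bit) := none
  /-- the output of the box held by honest `A` -/
  alice : Option (AShare ℓ τ) := none
  /-- the message received by honest `A` -/
  received : Option (π.Msg → Bit) := none
  doneA : Bool := false
  doneB : Bool := false

/-- One activation in the hybrid model. When the box hands keys to honest `B`, then `B` tosses its
coins and sends its message, and it outputs when it is next activated. If the box hands it `fail`,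
then it outputs `fail`. Honest `A` outputs when it is activated and has obtained both its output of
the box and the message. -/
def hybridStep {ℓ τ ψ : ℕ} (π : Protocol ℓ τ ψ) (𝓛 : Set (Leakage τ)) (c : Corr)
    (s : HybridState π) (q : AdvCmd 𝓛 π.Msg ℓ τ) : PMF (HybridState π × Obs π.Msg ℓ τ ψ) :=
  match q with
  | AdvCmd.box q =>
    (waStep 𝓛 c s.box q).bind fun r =>
      let s' : HybridState π := { s with box := r.1, alice := r.2.toA.or s.alice }
      match r.2.toB with
      | none => PMF.pure (s', { resp := r.2.resp })
      | some BOut.fail => PMF.pure (s', { resp := r.2.resp, outB := some BOut.fail })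
      | some (BOut.share b) =>
        (PMF.uniformOfFintype (π.Coins → Bit)).map fun coins =>
          ({ s' with bob := some (coins, b), channel := some (π.message coins b) },
            { resp := r.2.resp, sent := some (π.message coins b) })
  | AdvCmd.wakeA =>
    match s.alice, s.received, s.doneA with
    | some a, some m, false => PMF.pure ({ s with doneA := true }, { outA := some (π.outA a m) })
    | _, _, _ => PMF.pure (s, {})
  | AdvCmd.wakeB =>
    match s.bob, s.doneB with
    | some (coins, b), false =>
      PMF.pure ({ s with doneB := true }, { outB := some (BOut.share (π.outB coins b)) })
    | _, _ => PMF.pure (s, {})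
  | AdvCmd.deliver =>
    match c, s.channel with
    | Corr.none, some m => PMF.pure ({ s with channel := none, received := some m }, {})
    | _, _ => PMF.pure (s, {})
  | AdvCmd.send m =>
    match c, s.received with
    | Corr.bob, none => PMF.pure ({ s with received := some m }, {})
    | _, _ => PMF.pure (s, {})

/-- The protocol in the hybrid model, with corruption `c`. -/
def hybrid {ℓ τ ψ : ℕ} (π : Protocol ℓ τ ψ) (𝓛 : Set (Leakage τ)) (c : Corr) :
    System (AdvCmd 𝓛 π.Msg ℓ τ) (Obs π.Msg ℓ τ ψ) where
  State := HybridState π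
  init := (waInit ℓ τ c).map fun s => { box := s }
  step := hybridStep π 𝓛 c

/-! ### Simulators and the ideal world

A simulator is a Boolean circuit with a random tape and a memory. It talks to the environment and to
the ideal box in a fixed binary format. -/

inductive BoxKind : Type
  | query | leak | chooseA | chooseB | releaseA | releaseB

/-- Wires that carry a command to a box: one indicator for each kind of command and a field for each
kind of argument. -/
inductive BoxWire (ℓ n : ℕ) : Type
  | is (k : BoxKind) : BoxWire ℓ n
  | key (j : Fin n) : BoxWire ℓ n
  | leakSet (j : Fin n) : BoxWire ℓ n
  | undetected : BoxWire ℓ n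
  | shareA (w : AWire ℓ n) : BoxWire ℓ n
  | shareB (w : BWire ℓ n) : BoxWire ℓ n

/-- The bit of a Boolean. -/
def toBit (b : Bool) : Bit := if b then 1 else 0

/-- Encoding of a command, where a leakage function is represented by a sample `(S, c)`. Fields that
are not used are `0`. -/
def encodeBox {ℓ n : ℕ} : BoxCmd (Finset (Fin n) × Bool) ℓ n → BoxWire ℓ n → Bit
  | BoxCmd.query _, BoxWire.is BoxKind.query => 1
  | BoxCmd.query Γ, BoxWire.key j => Γ j
  | BoxCmd.leak _, BoxWire.is BoxKind.leak => 1
  | BoxCmd.leak p, BoxWire.leakSet j => toBit (decide (j ∈ p.1))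
  | BoxCmd.leak p, BoxWire.undetected => toBit p.2
  | BoxCmd.chooseA _, BoxWire.is BoxKind.chooseA => 1
  | BoxCmd.chooseA a, BoxWire.shareA w => a w
  | BoxCmd.chooseB _, BoxWire.is BoxKind.chooseB => 1
  | BoxCmd.chooseB b, BoxWire.shareB w => b w
  | BoxCmd.releaseA, BoxWire.is BoxKind.releaseA => 1
  | BoxCmd.releaseB, BoxWire.is BoxKind.releaseB => 1
  | _, _ => 0

/-- Decoding of a command to the box with the class of leakage functions that never leak; `none`
means that the box is not called. -/
def decodeBox {ℓ n : ℕ} (y : BoxWire ℓ n → Bit) : Option (BoxCmd (neverLeak n) ℓ n) :=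
  if y (BoxWire.is BoxKind.query) = 1 then some (BoxCmd.query fun j => y (BoxWire.key j))
  else if y (BoxWire.is BoxKind.leak) = 1 then
    some (BoxCmd.leak (noLeak n (decide (y BoxWire.undetected = 1))))
  else if y (BoxWire.is BoxKind.chooseA) = 1 then
    some (BoxCmd.chooseA fun w => y (BoxWire.shareA w))
  else if y (BoxWire.is BoxKind.chooseB) = 1 then
    some (BoxCmd.chooseB fun w => y (BoxWire.shareB w))
  else if y (BoxWire.is BoxKind.releaseA) = 1 then some BoxCmd.releaseA
  else if y (BoxWire.is BoxKind.releaseB) = 1 then some BoxCmd.releaseB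
  else none

/-- Wires that carry a command of the environment. -/
inductive AdvWire (Msg : Type) (ℓ τ : ℕ) : Type
  | box (w : BoxWire ℓ τ) : AdvWire Msg ℓ τ
  | isWakeA : AdvWire Msg ℓ τ
  | isWakeB : AdvWire Msg ℓ τ
  | isDeliver : AdvWire Msg ℓ τ
  | isSend : AdvWire Msg ℓ τ
  | msg (m : Msg) : AdvWire Msg ℓ τ

def encodeAdv {Msg : Type} {ℓ τ : ℕ} :
    AdvCmd (Finset (Fin τ) × Bool) Msg ℓ τ → AdvWire Msg ℓ τ → Bit
  | AdvCmd.box q, AdvWire.box w => encodeBox q w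
  | AdvCmd.wakeA, AdvWire.isWakeA => 1
  | AdvCmd.wakeB, AdvWire.isWakeB => 1
  | AdvCmd.deliver, AdvWire.isDeliver => 1
  | AdvCmd.send _, AdvWire.isSend => 1
  | AdvCmd.send m, AdvWire.msg k => m k
  | _, _ => 0

/-- Wires that carry a response. -/
inductive RespWire (n : ℕ) : Type
  | isAnswer : RespWire n
  | answer : RespWire n
  | isLeaked : RespWire n
  | leakSet (j : Fin n) : RespWire n
  | leakBit (j : Fin n) : RespWire n

def encodeResp {n : ℕ} : Resp n → RespWire n → Bit
  | Resp.answer _, RespWire.isAnswer => 1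
  | Resp.answer b, RespWire.answer => toBit b
  | Resp.leaked _, RespWire.isLeaked => 1
  | Resp.leaked v, RespWire.leakSet j => toBit (v j).isSome
  | Resp.leaked v, RespWire.leakBit j => (v j).getD 0
  | _, _ => 0

def decodeResp {n : ℕ} (y : RespWire n → Bit) : Resp n :=
  if y RespWire.isAnswer = 1 then Resp.answer (decide (y RespWire.answer = 1))
  else if y RespWire.isLeaked = 1 then
    Resp.leaked fun j =>
      if y (RespWire.leakSet j) = 1 then some (y (RespWire.leakBit j)) else none
  else Resp.none

/-- Wires that carry the reply of the simulator to the environment: a response of the simulated box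
and possibly a message of `B`. -/
inductive ReplyWire (Msg : Type) (τ : ℕ) : Type
  | resp (w : RespWire τ) : ReplyWire Msg τ
  | isSent : ReplyWire Msg τ
  | sent (m : Msg) : ReplyWire Msg τ

def decodeSent {Msg : Type} {τ : ℕ} (y : ReplyWire Msg τ → Bit) : Option (Msg → Bit) :=
  if y ReplyWire.isSent = 1 then some fun m => y (ReplyWire.sent m) else none

/-- A simulator. In every activation, `pre` is applied to the random tape, the memory and the command
of the environment; it updates the memory and possibly calls the ideal box. Then `post` is applied to
the random tape, the memory and the response of the ideal box; it updates the memory and computes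
the reply to the environment. -/
structure Simulator (Msg : Type) (ℓ τ ψ : ℕ) : Type 1 where
  Tape : Type
  Mem : Type
  [fintypeTape : Fintype Tape]
  [decEqTape : DecidableEq Tape]
  [fintypeMem : Fintype Mem]
  pre : Circuit (Tape ⊕ Mem ⊕ AdvWire Msg ℓ τ) (Mem ⊕ BoxWire ℓ ψ)
  post : Circuit (Tape ⊕ Mem ⊕ RespWire ψ) (Mem ⊕ ReplyWire Msg τ)

attribute [instance] Simulator.fintypeTape Simulator.decEqTape Simulator.fintypeMem

/-- The bit operations of an activation, the random bits and the memory cells of a simulator. -/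
def Simulator.cost {Msg : Type} {ℓ τ ψ : ℕ} (S : Simulator Msg ℓ τ ψ) : ℕ :=
  S.pre.size + S.post.size + Fintype.card S.Tape + Fintype.card S.Mem

/-- The simulator learns of a leakage function only a sample of it. -/
def sampleLeak {τ : ℕ} {𝓛 : Set (Leakage τ)} {Msg : Type} {ℓ : ℕ} :
    AdvCmd 𝓛 Msg ℓ τ → PMF (AdvCmd (Finset (Fin τ) × Bool) Msg ℓ τ)
  | AdvCmd.box (BoxCmd.query Γ) => PMF.pure (AdvCmd.box (BoxCmd.query Γ))
  | AdvCmd.box (BoxCmd.leak L) => L.1.map fun p => AdvCmd.box (BoxCmd.leak p)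
  | AdvCmd.box (BoxCmd.chooseA a) => PMF.pure (AdvCmd.box (BoxCmd.chooseA a))
  | AdvCmd.box (BoxCmd.chooseB b) => PMF.pure (AdvCmd.box (BoxCmd.chooseB b))
  | AdvCmd.box BoxCmd.releaseA => PMF.pure (AdvCmd.box BoxCmd.releaseA)
  | AdvCmd.box BoxCmd.releaseB => PMF.pure (AdvCmd.box BoxCmd.releaseB)
  | AdvCmd.wakeA => PMF.pure AdvCmd.wakeA
  | AdvCmd.wakeB => PMF.pure AdvCmd.wakeB
  | AdvCmd.deliver => PMF.pure AdvCmd.deliver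
  | AdvCmd.send m => PMF.pure (AdvCmd.send m)

structure IdealState {Msg : Type} {ℓ τ ψ : ℕ} (S : Simulator Msg ℓ τ ψ) : Type where
  box : WaState ℓ ψ
  tape : S.Tape → Bit
  mem : S.Mem → Bit

/-- At most one call to the box for bit authentication without leakage. -/
def callIdeal {ℓ ψ : ℕ} (c : Corr) (s : WaState ℓ ψ) :
    Option (BoxCmd (neverLeak ψ) ℓ ψ) → PMF (WaState ℓ ψ × BoxOut ℓ ψ)
  | some q => waStep (neverLeak ψ) c s q
  | none => PMF.pure (s, {})

/-- One activation in the ideal world, where the box is the one for bit authentication with `ψ`-bit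
keys and without leakage. Outputs of the box to honest parties go to the environment. -/
def idealStep {Msg : Type} {ℓ τ ψ : ℕ} (S : Simulator Msg ℓ τ ψ) (𝓛 : Set (Leakage τ)) (c : Corr)
    (s : IdealState S) (q : AdvCmd 𝓛 Msg ℓ τ) : PMF (IdealState S × Obs Msg ℓ τ ψ) :=
  (sampleLeak q).bind fun q' =>
    let y := S.pre.run (Sum.elim s.tape (Sum.elim s.mem (encodeAdv q')))
    (callIdeal c s.box (decodeBox fun w => y (Sum.inr w))).map fun r =>
        let z := S.post.run
          (Sum.elim s.tape (Sum.elim (fun w => y (Sum.inl w)) (encodeResp r.2.resp)))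
        ({ box := r.1, tape := s.tape, mem := fun w => z (Sum.inl w) },
          { resp := decodeResp fun w => z (Sum.inr (ReplyWire.resp w))
            sent := decodeSent fun w => z (Sum.inr w)
            outA := r.2.toA
            outB := r.2.toB })

/-- The ideal world, with corruption `c`. The memory of the simulator is initially `0`. -/
def ideal {Msg : Type} {ℓ τ ψ : ℕ} (S : Simulator Msg ℓ τ ψ) (𝓛 : Set (Leakage τ)) (c : Corr) :
    System (AdvCmd 𝓛 Msg ℓ τ) (Obs Msg ℓ τ ψ) where
  State := IdealState S
  init := (waInit ℓ ψ c).bind fun b =>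
    (PMF.uniformOfFintype (S.Tape → Bit)).map fun t => { box := b, tape := t, mem := fun _ => 0 }
  step := idealStep S 𝓛 c

/-- `π` securely implements bit authentication with `ψ`-bit keys in the hybrid model with the box for
bit authentication with a weak `τ`-bit global key and leakage class `𝓛`: for each static corruption of
at most one party there is a simulator of cost at most `w` such that no environment distinguishes the
protocol from the ideal world with advantage more than `ε`. -/
def SecurelyImplements {ℓ τ ψ : ℕ} (π : Protocol ℓ τ ψ) (𝓛 : Set (Leakage τ)) (ε : ℝ) (w : ℕ) :
    Prop :=
  ∀ c : Corr, ∃ S : Simulator π.Msg ℓ τ ψ, S.cost ≤ w ∧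
    ∀ E : Env (AdvCmd 𝓛 π.Msg ℓ τ) (Obs π.Msg ℓ τ ψ),
      |E.prob (hybrid π 𝓛 c) - E.prob (ideal S 𝓛 c)| ≤ ε

/-! ### The compressed global key in the view of corrupted `A` -/

/-- A run in which corrupted `A` uses the leakage function `L`. -/
structure KeyRun (τ ψ : ℕ) : Type where
  Γ : Fin τ → Bit
  leakSet : Finset (Fin τ)
  undetected : Bool
  matrix : Matrix (Fin ψ) (Fin τ) Bit

def keyGame {τ : ℕ} (ψ : ℕ) (L : Leakage τ) : PMF (KeyRun τ ψ) :=
  (PMF.uniformOfFintype (Fin τ → Bit)).bind fun Γ =>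
    L.bind fun p =>
      (PMF.uniformOfFintype (Fin ψ × Fin τ → Bit)).map fun m =>
        { Γ := Γ, leakSet := p.1, undetected := p.2, matrix := asMatrix m }

/-- The compressed global key. -/
def KeyRun.Δ {τ ψ : ℕ} (r : KeyRun τ ψ) : Fin ψ → Bit := r.matrix.mulVec r.Γ

/-- The view of `A`: the leaked bits and the matrix. If the attack is detected then the box fails
and nothing is sent. -/
def KeyRun.view {τ ψ : ℕ} (r : KeyRun τ ψ) :
    Option ((Fin τ → Option Bit) × Matrix (Fin ψ) (Fin τ) Bit) :=
  if r.undetected then some (reveal r.leakSet r.Γ, r.matrix) else none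

/-- Except with probability `ε`, the compressed global key is uniform to `A`: there is a failure event
`F` of probability at most `ε` such that, when `F` does not occur, the compressed key is uniformly
random and independent of the view of `A`. -/
def UniformExcept {τ : ℕ} (ψ : ℕ) (L : Leakage τ) (ε : ℝ≥0∞) : Prop :=
  ∃ F : Set (KeyRun τ ψ), (keyGame ψ L).toOuterMeasure F ≤ ε ∧
    ∀ v δ, (keyGame ψ L).toOuterMeasure {r | r ∉ F ∧ r.view = some v ∧ r.Δ = δ} =
      (2 ^ ψ : ℝ≥0∞)⁻¹ * (keyGame ψ L).toOuterMeasure {r | r ∉ F ∧ r.view = some v}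

end UC

end

open UC

/-!
Let `𝐀` be a uniformly random `ψ × τ` matrix. Its rows, restricted to the columns outside `S`, are
dependent with probability at most `2 ^ ψ * 2 ^ |S| / 2 ^ τ`, by a union bound over the nonzero
combinations of rows (`card_not_good_mul_le`, `badProb_le`). An adversary that guesses `0` for every
bit that is not leaked wins with probability `E[c * 2 ^ |S| / 2 ^ τ]`, so security of the class of
leakage functions bounds this expectation (`tsum_le_success`, `success_le`). As `3 / 4 * τ ≥ 2 * ψ`,
a sample `(S, c)` of a leakage function is undetected and spoils the matrix with probability at most
`2 ^ (-ψ)` (`leakLoss_le_of_isSecure`). Without leakage the matrix is bad with probability at most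
`2 ^ (-ψ)`, too (`badProb_empty_le`).

If the rows of `𝐀` are independent outside `S`, then `𝐀` has a right inverse that is supported
outside `S` (`rightInv`). Translating the global key by its columns changes the compressed key at
will and does not touch the leaked bits, so the compressed key is uniform given the view of a
corrupted `A` (`toOuterMeasure_press`, `uniformExcept_leakLoss`).

For honest and for corrupted `A`, the simulator `keySim` samples `𝐀` and a vector `g` itself and
leaks bits of `g`. A query `G` is forwarded to the ideal box in the compressed form `𝐀 G`. Only if
this is the compressed key, which is then known, the simulator moves `g` by a combination of columns
of the right inverse to a vector that is compressed to this key, and compares the result with `G`.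
The right inverse is computed by rank-one updates without branching (`elimStep`), hence by a circuit
of polynomial size (`Computes.elimResult`).

The protocol and the ideal world with this simulator differ in the treatment of the global key only,
which is separated from the rest as a `KeyBox`. The keys `realKey` of the protocol and `simKey` of
the simulator are both images of `lazyKey`, which samples the compressed key first, the leaked bits
when they leak, and the other bits after a query with the right compression. The kernels
`lazyToReal` and `lazyToSim` commute with all operations as long as the leaked sets are good for
`𝐀`. So no environment distinguishes the two worlds if both stop as soon as a set is not good
(`bind_playStop`), and stopping costs at most the probability that it happens (`playStop_mono`,
`abs_bind_sub_le`). That probability is bounded in the world of the protocol, where nothing that the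
environment sees before the leakage depends on the matrix (`tsum_playStop_none_le`). To have a fixed
matrix from the start, the coins of `B` are tossed in advance (`play_hybrid`). Together this bounds
the advantage by `2 * 2 ^ (-ψ)` (`abs_prob_alice_le`, `abs_prob_none_le`).

For corrupted `B` the simulator `bobSim` compresses the keys with the matrix that `B` sends. As the
compression is linear, it preserves the relation between the shares (`pressA_toAShare`), and the
simulator is perfect (`prob_bob`). The bits of `A` are sampled at different times in the two worlds,
which no environment notices because `A` does not output them before it has received the matrix.
-/

noncomputable section

namespace UC

/-! ### Building circuits -/

/-- The values of the gates `G` of a circuit on the input `x`. -/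
def values {ι : Type} (x : ι → Bit) (G : List (Gate ι)) : List Bit :=
  G.foldl (fun vals g => vals ++ [g.eval x vals]) []

/-- A wire is available after `m` gates if it is an input or one of these gates. -/
def Available {ι : Type} (m : ℕ) : ι ⊕ ℕ → Prop
  | Sum.inl _ => True
  | Sum.inr k => k < m

section values

variable {ι : Type} (x : ι → Bit)

theorem values_concat (G : List (Gate ι)) (g : Gate ι) :
    values x (G ++ [g]) = values x G ++ [g.eval x (values x G)] := by
  simp [values, List.foldl_append]

theorem length_values (G : List (Gate ι)) : (values x G).length = G.length := by
  induction G using List.reverseRecOn with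
  | nil => rfl
  | append_singleton G g ih => simp [values_concat, ih]

theorem Available.mono {m m' : ℕ} (h : m ≤ m') {w : ι ⊕ ℕ} (hw : Available m w) :
    Available m' w := by
  cases w with
  | inl i => trivial
  | inr k => exact lt_of_lt_of_le hw h

theorem wireVal_values_append (G gs : List (Gate ι)) {w : ι ⊕ ℕ} (hw : Available G.length w) :
    wireVal x (values x (G ++ gs)) w = wireVal x (values x G) w := by
  induction gs using List.reverseRecOn with
  | nil => simp
  | append_singleton gs g ih =>
    rw [← ih, ← List.append_assoc, values_concat]
    cases w with
    | inl i => rfl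
    | inr k =>
      have hk : k < (values x (G ++ gs)).length := by
        have : k < G.length := hw
        simp only [length_values, List.length_append]; omega
      simp only [wireVal, List.getD_eq_getElem?_getD]
      rw [List.getElem?_append_left hk]

theorem wireVal_values_concat (G : List (Gate ι)) (g : Gate ι) :
    wireVal x (values x (G ++ [g])) (Sum.inr G.length) = g.eval x (values x G) := by
  simp [wireVal, values_concat, length_values]

end values

/-- `f` can be computed with `n` gates. The circuit is described by what it adds to an arbitrary
list of gates on whose wires the arguments of `f` are available, so that circuits can be composed.
-/
def Computes {ι κ : Type} (f : (ι → Bit) → κ → Bit) (n : ℕ) : Prop :=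
  ∀ (α : Type) (G : List (Gate α)) (src : ι → α ⊕ ℕ), (∀ i, Available G.length (src i)) →
    ∃ (gs : List (Gate α)) (dst : κ → α ⊕ ℕ), gs.length ≤ n ∧
      (∀ k, Available (G ++ gs).length (dst k)) ∧
      ∀ x k, wireVal x (values x (G ++ gs)) (dst k) =
        f (fun i => wireVal x (values x G) (src i)) k

/-- A single bit can be computed with `n` gates. -/
def ComputesBit {ι : Type} (f : (ι → Bit) → Bit) (n : ℕ) : Prop :=
  Computes (fun x (_ : Unit) => f x) n

namespace Computes

variable {ι κ μ : Type}

theorem exists_circuit {f : (ι → Bit) → κ → Bit} {n : ℕ} (h : Computes f n) :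
    ∃ C : Circuit ι κ, C.size ≤ n ∧ ∀ x, C.run x = f x := by
  obtain ⟨gs, dst, h₁, -, h₃⟩ := h ι [] Sum.inl fun _ => trivial
  exact ⟨⟨gs, dst⟩, h₁, fun x => funext fun k => h₃ x k⟩

theorem mono {f : (ι → Bit) → κ → Bit} {n m : ℕ} (h : Computes f n) (hnm : n ≤ m) :
    Computes f m := by
  intro α G src hs
  obtain ⟨gs, dst, h₁, h₂⟩ := h α G src hs
  exact ⟨gs, dst, h₁.trans hnm, h₂⟩

theorem wires (g : κ → ι) : Computes (fun x k => x (g k)) 0 := by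
  intro α G src hs
  refine ⟨[], fun k => src (g k), le_rfl, fun k => ?_, fun x k => ?_⟩
  · simpa using hs (g k)
  · simp

theorem comp {f : (ι → Bit) → κ → Bit} {g : (κ → Bit) → μ → Bit} {n m : ℕ}
    (hf : Computes f n) (hg : Computes g m) : Computes (fun x => g (f x)) (n + m) := by
  intro α G src hs
  obtain ⟨gs, dst, h₁, h₂, h₃⟩ := hf α G src hs
  obtain ⟨gs', dst', h₁', h₂', h₃'⟩ := hg α (G ++ gs) dst h₂
  refine ⟨gs ++ gs', dst', ?_, ?_, ?_⟩
  · rw [List.length_append]; omega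
  · simpa using h₂'
  · intro x k
    rw [← List.append_assoc, h₃']
    simp only [h₃]

theorem reindex {f : (ι → Bit) → κ → Bit} {n : ℕ} (hf : Computes f n) (g : μ → κ) :
    Computes (fun x k => f x (g k)) n :=
  hf.comp (wires g)

theorem comap {f : (ι → Bit) → κ → Bit} {n : ℕ} (hf : Computes f n) (g : ι → μ) :
    Computes (fun x => f fun i => x (g i)) n := by
  simpa using (wires g).comp hf

theorem elim {f : (ι → Bit) → κ → Bit} {g : (ι → Bit) → μ → Bit} {n m : ℕ}
    (hf : Computes f n) (hg : Computes g m) :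
    Computes (fun x => Sum.elim (f x) (g x)) (n + m) := by
  intro α G src hs
  obtain ⟨gs, dst, h₁, h₂, h₃⟩ := hf α G src hs
  obtain ⟨gs', dst', h₁', h₂', h₃'⟩ := hg α (G ++ gs) src
    fun i => (hs i).mono (by simp)
  refine ⟨gs ++ gs', Sum.elim dst dst', ?_, ?_, ?_⟩
  · rw [List.length_append]; omega
  · rintro (k | k)
    · exact (h₂ k).mono (by simp)
    · simpa using h₂' k
  · rintro x (k | k)
    · rw [← List.append_assoc]
      exact (wireVal_values_append x _ _ (h₂ k)).trans (h₃ x k)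
    · rw [← List.append_assoc]
      refine (h₃' x k).trans ?_
      simp only [wireVal_values_append x _ _ (hs _)]
      rfl

/-- Sequential composition along a list; the parameters `p` remain available. -/
theorem foldl {σ : Type} {β : Type*} {step : β → (ι → Bit) → (σ → Bit) → σ → Bit} {n : ℕ}
    (h : ∀ b, Computes (fun x : ι ⊕ σ → Bit =>
      step b (fun i => x (Sum.inl i)) fun s => x (Sum.inr s)) n)
    (l : List β) :
    Computes (fun x : ι ⊕ σ → Bit =>
      l.foldl (fun q b => step b (fun i => x (Sum.inl i)) q) fun s => x (Sum.inr s))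
      (l.length * n) := by
  induction l with
  | nil => simpa using wires (Sum.inr : σ → ι ⊕ σ)
  | cons b l ih =>
    have h₁ := ((wires (Sum.inl : ι → ι ⊕ σ)).elim (h b)).comp ih
    refine h₁.mono (le_of_eq ?_)
    rw [List.length_cons]; ring

/-- Several bits can be computed one after another. -/
theorem of_bits_list {f : (ι → Bit) → κ → Bit} {n : κ → ℕ} [DecidableEq κ]
    (h : ∀ k, ComputesBit (fun x => f x k) (n k)) (l : List κ) :
    Computes (fun x (k : {k // k ∈ l}) => f x k) (l.map n).sum := by
  induction l with
  | nil =>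
    intro α G src hs
    exact ⟨[], fun k => absurd k.2 (by simp), by simp, fun k => absurd k.2 (by simp),
      fun x k => absurd k.2 (by simp)⟩
  | cons b l ih =>
    have h₁ := ((h b).elim ih).reindex (μ := {k // k ∈ b :: l}) fun k =>
      if hk : k.1 = b then Sum.inl () else
        Sum.inr ⟨k.1, (List.mem_cons.1 k.2).resolve_left hk⟩
    rw [List.map_cons, List.sum_cons]
    convert h₁ using 2 with x
    funext k
    by_cases hk : k.1 = b
    · simp [hk]
    · simp [hk]

theorem of_bits {f : (ι → Bit) → κ → Bit} {n : κ → ℕ} [Fintype κ]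
    (h : ∀ k, ComputesBit (fun x => f x k) (n k)) : Computes f (∑ k, n k) := by
  classical
  have h₁ := (of_bits_list h Finset.univ.toList).reindex (μ := κ) fun k => ⟨k, by simp⟩
  simpa [Finset.sum_map_toList] using h₁

theorem of_bits_const {f : (ι → Bit) → κ → Bit} {n : ℕ} [Fintype κ]
    (h : ∀ k, ComputesBit (fun x => f x k) n) : Computes f (Fintype.card κ * n) := by
  simpa using of_bits h

end Computes

namespace ComputesBit

variable {ι κ : Type}

theorem mono {f : (ι → Bit) → Bit} {n m : ℕ} (h : ComputesBit f n) (hnm : n ≤ m) :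
    ComputesBit f m :=
  Computes.mono h hnm

theorem input (i : ι) : ComputesBit (fun x => x i) 0 :=
  Computes.wires fun _ => i

theorem one : ComputesBit (fun _ : ι → Bit => 1) 1 := by
  intro α G src hs
  refine ⟨[Gate.one], fun _ => Sum.inr G.length, le_rfl, fun k => ?_, fun x k => ?_⟩
  · simp [Available]
  · rw [wireVal_values_concat]; rfl

/-- A wire plus itself is `0`. -/
theorem zero : ComputesBit (fun _ : ι → Bit => 0) 1 := by
  intro α G src hs
  refine ⟨[Gate.xor (Sum.inr 0) (Sum.inr 0)], fun _ => Sum.inr G.length, le_rfl,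
    fun k => ?_, fun x k => ?_⟩
  · simp [Available]
  · rw [wireVal_values_concat]; exact CharTwo.add_self_eq_zero _

theorem add {f g : (ι → Bit) → Bit} {n m : ℕ} (hf : ComputesBit f n) (hg : ComputesBit g m) :
    ComputesBit (fun x => f x + g x) (n + m + 1) := by
  have h : Computes (fun (x : Unit ⊕ Unit → Bit) (_ : Unit) =>
      x (Sum.inl ()) + x (Sum.inr ())) 1 := by
    intro α G src hs
    refine ⟨[Gate.xor (src (Sum.inl ())) (src (Sum.inr ()))], fun _ => Sum.inr G.length, le_rfl,
      fun k => ?_, fun x k => ?_⟩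
    · simp [Available]
    · rw [wireVal_values_concat]; rfl
  exact (Computes.elim hf hg).comp h

theorem mul {f g : (ι → Bit) → Bit} {n m : ℕ} (hf : ComputesBit f n) (hg : ComputesBit g m) :
    ComputesBit (fun x => f x * g x) (n + m + 1) := by
  have h : Computes (fun (x : Unit ⊕ Unit → Bit) (_ : Unit) =>
      x (Sum.inl ()) * x (Sum.inr ())) 1 := by
    intro α G src hs
    refine ⟨[Gate.and (src (Sum.inl ())) (src (Sum.inr ()))], fun _ => Sum.inr G.length, le_rfl,
      fun k => ?_, fun x k => ?_⟩
    · simp [Available]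
    · rw [wireVal_values_concat]; rfl
  exact (Computes.elim hf hg).comp h

theorem finset_sum {f : κ → (ι → Bit) → Bit} {n : ℕ} (h : ∀ k, ComputesBit (f k) n)
    (s : Finset κ) : ComputesBit (fun x => ∑ k ∈ s, f k x) (s.card * (n + 1) + 1) := by
  classical
  induction s using Finset.induction_on with
  | empty => simpa using zero
  | insert a s ha ih =>
    simp only [Finset.sum_insert ha, Finset.card_insert_of_notMem ha]
    exact ((h a).add ih).mono (by ring_nf; rfl)

theorem finset_prod {f : κ → (ι → Bit) → Bit} {n : ℕ} (h : ∀ k, ComputesBit (f k) n)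
    (s : Finset κ) : ComputesBit (fun x => ∏ k ∈ s, f k x) (s.card * (n + 1) + 1) := by
  classical
  induction s using Finset.induction_on with
  | empty => simpa using one
  | insert a s ha ih =>
    simp only [Finset.prod_insert ha, Finset.card_insert_of_notMem ha]
    exact ((h a).mul ih).mono (by ring_nf; rfl)

theorem sum {f : κ → (ι → Bit) → Bit} {n : ℕ} [Fintype κ] (h : ∀ k, ComputesBit (f k) n) :
    ComputesBit (fun x => ∑ k, f k x) (Fintype.card κ * (n + 1) + 1) :=
  finset_sum h _

theorem prod {f : κ → (ι → Bit) → Bit} {n : ℕ} [Fintype κ] (h : ∀ k, ComputesBit (f k) n) :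
    ComputesBit (fun x => ∏ k, f k x) (Fintype.card κ * (n + 1) + 1) :=
  finset_prod h _

end ComputesBit

/-! ### Right inverses by oblivious elimination -/

theorem bit_add_self (b : Bit) : b + b = 0 := CharTwo.add_self_eq_zero b

theorem vec_add_self {n : Type*} (v : n → Bit) : v + v = 0 := funext fun k => bit_add_self (v k)

/-- The unit vector at the first position where `v` is `1`. -/
def firstOne {n : ℕ} (v : Fin n → Bit) (k : Fin n) : Bit :=
  v k * ∏ k' ∈ Finset.Iio k, (1 + v k')

theorem bit_eq_one_of_ne_zero {b : Bit} (h : b ≠ 0) : b = 1 := by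
  revert b; decide

theorem dotProduct_firstOne {n : ℕ} {v : Fin n → Bit} (hv : v ≠ 0) :
    v ⬝ᵥ firstOne v = 1 := by
  classical
  have hne : (Finset.univ.filter fun k => v k ≠ 0).Nonempty := by
    obtain ⟨k, hk⟩ := Function.ne_iff.1 hv
    exact ⟨k, by simpa using hk⟩
  set k₀ := (Finset.univ.filter fun k => v k ≠ 0).min' hne with hk₀
  have h₀ : v k₀ = 1 := bit_eq_one_of_ne_zero (Finset.mem_filter.1 (Finset.min'_mem _ hne)).2
  have hlt : ∀ k, k < k₀ → v k = 0 := by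
    intro k hk
    by_contra h
    exact absurd (Finset.min'_le _ k (by simpa using h)) (not_le.2 hk)
  rw [dotProduct, Finset.sum_eq_single k₀]
  · have : ∀ k ∈ Finset.Iio k₀, 1 + v k = 1 := fun k hk => by
      rw [hlt k (Finset.mem_Iio.1 hk), add_zero]
    simp [firstOne, h₀, Finset.prod_congr rfl this]
  · intro k _ hk
    rcases lt_or_gt_of_ne hk with h | h
    · simp [hlt k h]
    · have : ∏ k' ∈ Finset.Iio k, (1 + v k') = 0 :=
        Finset.prod_eq_zero (Finset.mem_Iio.2 h) (by rw [h₀]; decide)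
      simp [firstOne, this]
  · simp

/-- The cells of the elimination: a `τ × τ` matrix `N` and a `τ × ψ` matrix `E`. -/
abbrev ElimCell (τ ψ : ℕ) : Type := (Fin τ × Fin τ) ⊕ (Fin τ × Fin ψ)

/-- The matrix `N`, whose range consists of solutions of the homogeneous equations processed so
far. -/
def kernelPart {τ ψ : ℕ} (q : ElimCell τ ψ → Bit) : Matrix (Fin τ) (Fin τ) Bit :=
  Matrix.of fun j k => q (Sum.inl (j, k))

/-- The matrix `E`, a right inverse of the rows processed so far. -/
def inversePart {τ ψ : ℕ} (q : ElimCell τ ψ → Bit) : Matrix (Fin τ) (Fin ψ) Bit :=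
  Matrix.of fun j k => q (Sum.inr (j, k))

open Matrix in
/-- Processing of the row `a` with number `i` of a matrix by rank-one updates. With `v = a N` and a
vector `d = N p` such that `a d = 1`, add `d (e i + a E)` to `E` and `d v` to `N`. -/
def elimStep {τ ψ : ℕ} (A : Fin ψ × Fin τ → Bit) (i : Fin ψ) (q : ElimCell τ ψ → Bit) :
    ElimCell τ ψ → Bit :=
  let v : Fin τ → Bit := (asMatrix A i) ᵥ* kernelPart q
  let d : Fin τ → Bit := kernelPart q *ᵥ firstOne v
  Sum.elim (fun w => kernelPart q w.1 w.2 + d w.1 * v w.2)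
    (fun w => inversePart q w.1 w.2 +
      d w.1 * (Pi.single (M := fun _ => Bit) i 1 w.2 + (asMatrix A i ᵥ* inversePart q) w.2))

/-- At the start `N` is the projection to the coordinates outside `s`, and `E` is `0`. -/
def elimStart {τ : ℕ} (ψ : ℕ) (s : Fin τ → Bit) : ElimCell τ ψ → Bit :=
  Sum.elim (fun w => if w.1 = w.2 then 1 + s w.1 else 0) fun _ => 0

/-- The result of the elimination on all rows. -/
def elimResult {τ ψ : ℕ} (A : Fin ψ × Fin τ → Bit) (s : Fin τ → Bit) : ElimCell τ ψ → Bit :=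
  (List.finRange ψ).foldl (fun q i => elimStep A i q) (elimStart ψ s)

/-- The indicator of a set of positions. -/
def indicator {τ : ℕ} (S : Finset (Fin τ)) (j : Fin τ) : Bit := toBit (decide (j ∈ S))

/-- A right inverse of the matrix `A` that is supported outside `S`, if there is one. -/
def rightInv {τ ψ : ℕ} (A : Fin ψ × Fin τ → Bit) (S : Finset (Fin τ)) :
    Matrix (Fin τ) (Fin ψ) Bit :=
  inversePart (elimResult A (indicator S))

/-- The rows of `A` are linearly independent outside `S`, expressed by the success of the
elimination. -/
def Good {τ ψ : ℕ} (A : Fin ψ × Fin τ → Bit) (S : Finset (Fin τ)) : Prop :=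
  asMatrix A * rightInv A S = 1

section elimination

open Matrix

variable {τ ψ : ℕ} {A : Fin ψ × Fin τ → Bit} {S : Finset (Fin τ)}

theorem kernelPart_elimStep (i : Fin ψ) (q : ElimCell τ ψ → Bit) :
    kernelPart (elimStep A i q) = kernelPart q +
      vecMulVec (kernelPart q *ᵥ firstOne (asMatrix A i ᵥ* kernelPart q))
        (asMatrix A i ᵥ* kernelPart q) := rfl

theorem inversePart_elimStep (i : Fin ψ) (q : ElimCell τ ψ → Bit) :
    inversePart (elimStep A i q) = inversePart q +
      vecMulVec (kernelPart q *ᵥ firstOne (asMatrix A i ᵥ* kernelPart q))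
        (Pi.single i 1 + asMatrix A i ᵥ* inversePart q) := rfl

/-- Both matrices vanish on the rows in `S`. -/
theorem elimStep_support {q : ElimCell τ ψ → Bit}
    (h : ∀ j ∈ S, kernelPart q j = 0 ∧ inversePart q j = 0) (i : Fin ψ) :
    ∀ j ∈ S, kernelPart (elimStep A i q) j = 0 ∧ inversePart (elimStep A i q) j = 0 := by
  intro j hj
  have hd : (kernelPart q *ᵥ firstOne (asMatrix A i ᵥ* kernelPart q)) j = 0 := by
    rw [mulVec, (h j hj).1, zero_dotProduct]
  constructor
  · rw [kernelPart_elimStep]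
    funext k
    simp only [Matrix.add_apply, vecMulVec_apply, hd, (h j hj).1]; simp
  · rw [inversePart_elimStep]
    funext k
    simp only [Matrix.add_apply, vecMulVec_apply, hd, (h j hj).2]; simp

/-- The updates only add combinations of columns of `N`, which vanishes on the rows in `S` from the
start. -/
theorem rightInv_support (j : Fin τ) (hj : j ∈ S) : rightInv A S j = 0 := by
  suffices H : ∀ (l : List (Fin ψ)) (q : ElimCell τ ψ → Bit),
      (∀ j ∈ S, kernelPart q j = 0 ∧ inversePart q j = 0) →
      ∀ j ∈ S, kernelPart (l.foldl (fun q i => elimStep A i q) q) j = 0 ∧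
        inversePart (l.foldl (fun q i => elimStep A i q) q) j = 0 from
    (H _ (elimStart ψ (indicator S)) (fun j hj => ⟨by
      funext k
      by_cases hjk : j = k
      · subst hjk
        simpa [kernelPart, elimStart, indicator, hj, toBit] using bit_add_self 1
      · simp [kernelPart, elimStart, hjk], rfl⟩) j hj).2
  intro l
  induction l with
  | nil => exact fun q h => h
  | cons i l ih => exact fun q h => ih _ (elimStep_support h i)

/-- The invariant of the elimination after the rows in `R` have been processed. -/
structure ElimInv (A : Fin ψ × Fin τ → Bit) (S : Finset (Fin τ)) (R : Set (Fin ψ))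
    (q : ElimCell τ ψ → Bit) : Prop where
  kernel : ∀ i ∈ R, asMatrix A i ᵥ* kernelPart q = 0
  inverse : ∀ i ∈ R, asMatrix A i ᵥ* inversePart q = Pi.single i 1
  span : ∀ w : Fin τ → Bit, w ᵥ* kernelPart q = 0 →
    ∃ c : Fin ψ → Bit, (∀ i ∉ R, c i = 0) ∧ ∀ j ∉ S, w j = (c ᵥ* asMatrix A) j

/-- If the rows of `A` are independent outside `S`, then the vector `v = a N` of an unprocessed row
`a` is not `0`, and the invariant is preserved. -/
theorem ElimInv.step (hA : ∀ c : Fin ψ → Bit, (∀ j ∉ S, (c ᵥ* asMatrix A) j = 0) → c = 0)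
    {R : Set (Fin ψ)} {q : ElimCell τ ψ → Bit} (h : ElimInv A S R q) {i : Fin ψ} (hi : i ∉ R) :
    ElimInv A S (insert i R) (elimStep A i q) := by
  set N := kernelPart q with hN
  set v := asMatrix A i ᵥ* N with hv
  -- Otherwise the row would agree outside `S` with a combination of processed rows.
  have hv0 : v ≠ 0 := by
    intro h0
    obtain ⟨c, hc, hc'⟩ := h.span _ h0
    have := hA (c + Pi.single i 1) fun j hj => by
      rw [add_vecMul, Pi.add_apply, ← hc' j hj, single_one_vecMul]
      exact bit_add_self _
    have := congrFun this i
    simp [hc i hi] at this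
  set d := N *ᵥ firstOne v with hd
  have hdot : ∀ w : Fin τ → Bit, w ⬝ᵥ d = (w ᵥ* N) ⬝ᵥ firstOne v := fun w =>
    dotProduct_mulVec _ _ _
  have hdi : asMatrix A i ⬝ᵥ d = 1 := by rw [hdot, ← hv, dotProduct_firstOne hv0]
  have hdR : ∀ k ∈ R, asMatrix A k ⬝ᵥ d = 0 := fun k hk => by
    rw [hdot, h.kernel k hk, zero_dotProduct]
  have hN' : ∀ w : Fin τ → Bit, w ᵥ* kernelPart (elimStep A i q) = w ᵥ* N + (w ⬝ᵥ d) • v := by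
    intro w
    rw [kernelPart_elimStep, vecMul_add, vecMul_vecMulVec]
  have hE' : ∀ w : Fin τ → Bit, w ᵥ* inversePart (elimStep A i q) =
      w ᵥ* inversePart q + (w ⬝ᵥ d) • (Pi.single i 1 + asMatrix A i ᵥ* inversePart q) := by
    intro w
    rw [inversePart_elimStep, vecMul_add, vecMul_vecMulVec]
  refine ⟨?_, ?_, ?_⟩
  · rintro k (rfl | hk)
    · rw [hN', hdi, one_smul, ← hv, vec_add_self]
    · rw [hN', hdR k hk, h.kernel k hk]; simp
  · rintro k (rfl | hk)
    · rw [hE', hdi, one_smul, add_left_comm, vec_add_self, add_zero]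
    · rw [hE', hdR k hk, h.inverse k hk]; simp
  · intro w hw
    rw [hN', hv, ← smul_vecMul, ← add_vecMul] at hw
    obtain ⟨c, hc, hc'⟩ := h.span _ hw
    refine ⟨c + (w ⬝ᵥ d) • Pi.single i 1, ?_, ?_⟩
    · intro k hk
      have hki : k ≠ i := fun h => hk (Or.inl h)
      have hkR : k ∉ R := fun h => hk (Or.inr h)
      simp [hc k hkR, hki]
    · intro j hj
      have := hc' j hj
      rw [add_vecMul, smul_vecMul, single_one_vecMul, Pi.add_apply, ← this, Pi.add_apply,
        add_assoc]
      exact (congrArg (w j + ·) (bit_add_self (((w ⬝ᵥ d) • asMatrix A i) j))).trans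
        (add_zero _) |>.symm

/-- The elimination succeeds if the rows of `A` are linearly independent outside `S`. -/
theorem good_of_independent
    (hA : ∀ c : Fin ψ → Bit, (∀ j ∉ S, (c ᵥ* asMatrix A) j = 0) → c = 0) : Good A S := by
  have h₀ : ElimInv A S ∅ (elimStart ψ (indicator S)) := by
    refine ⟨fun i hi => absurd hi (by simp), fun i hi => absurd hi (by simp), fun w hw =>
      ⟨0, fun _ _ => rfl, fun j hj => ?_⟩⟩
    have := congrFun hw j
    simp only [vecMul, dotProduct, kernelPart, elimStart, of_apply, Sum.elim_inl, indicator,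
      mul_ite, mul_zero, Finset.sum_ite_eq', Finset.mem_univ, if_true, hj, toBit] at this
    simpa using this
  have H : ∀ (l : List (Fin ψ)) (R : Set (Fin ψ)) (q : ElimCell τ ψ → Bit), l.Nodup →
      (∀ i ∈ l, i ∉ R) → ElimInv A S R q →
      ElimInv A S (R ∪ {i | i ∈ l}) (l.foldl (fun q i => elimStep A i q) q) := by
    intro l
    induction l with
    | nil => intro R q _ _ h; simpa using h
    | cons i l ih =>
      intro R q hl hR h
      rw [List.nodup_cons] at hl
      have := ih (insert i R) _ hl.2 (fun k hk => by
        rintro (rfl | h)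
        · exact hl.1 hk
        · exact hR k (List.mem_cons_of_mem _ hk) h) (h.step hA (hR i (by simp)))
      have hset : (R ∪ {k | k ∈ i :: l} : Set (Fin ψ)) = insert i R ∪ {k | k ∈ l} := by
        ext k
        simp only [Set.mem_union, Set.mem_ofPred_eq, List.mem_cons, Set.mem_insert_iff]
        tauto
      rw [hset]
      exact this
  have h := H (List.finRange ψ) ∅ _ (List.nodup_finRange ψ) (by simp) h₀
  refine Matrix.ext fun i k => ?_
  have := congrFun (h.inverse i (by simp)) k
  rw [show (asMatrix A * rightInv A S) i k = (asMatrix A i ᵥ* rightInv A S) k from rfl]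
  rw [rightInv, elimResult, this, one_apply, Pi.single_apply]
  simp [eq_comm]

open Classical in
/-- Few matrices do not have independent rows outside `S`: a union bound over the linear
combinations of rows that vanish outside `S`. -/
theorem card_not_good_mul_le (S : Finset (Fin τ)) :
    (Finset.univ.filter fun A : Fin ψ × Fin τ → Bit => ¬ Good A S).card * 2 ^ (τ - S.card) ≤
      2 ^ ψ * Fintype.card (Fin ψ × Fin τ → Bit) := by
  have hc : ∀ c : Fin ψ → Bit, c ≠ 0 →
      (Finset.univ.filter fun A : Fin ψ × Fin τ → Bit =>
        ∀ j ∉ S, (c ᵥ* asMatrix A) j = 0).card * 2 ^ (τ - S.card) ≤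
        Fintype.card (Fin ψ × Fin τ → Bit) := by
    intro c hc
    obtain ⟨i₀, hi₀⟩ := Function.ne_iff.1 hc
    replace hi₀ : c i₀ = 1 := bit_eq_one_of_ne_zero hi₀
    have hcard : Fintype.card ({j // j ∉ S} → Bit) = 2 ^ (τ - S.card) := by
      rw [Fintype.card_fun, ZMod.card, Fintype.card_subtype_compl]
      simp
    rw [← Fintype.card_subtype, ← hcard, ← Fintype.card_prod]
    -- Adding an arbitrary vector to a row that occurs in the combination changes the combination
    -- by that vector.
    let φ : {A : Fin ψ × Fin τ → Bit // ∀ j ∉ S, (c ᵥ* asMatrix A) j = 0} ×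
        ({j // j ∉ S} → Bit) → Fin ψ × Fin τ → Bit := fun p w =>
      p.1.1 w + if hw : w.1 = i₀ ∧ w.2 ∉ S then p.2 ⟨w.2, hw.2⟩ else 0
    have key : ∀ p j (hj : j ∉ S), (c ᵥ* asMatrix (φ p)) j = p.2 ⟨j, hj⟩ := by
      rintro ⟨⟨A, hA⟩, t⟩ j hj
      have h1 : (c ᵥ* asMatrix (φ (⟨A, hA⟩, t))) j = (c ᵥ* asMatrix A) j +
          ∑ i, c i * (if i = i₀ then t ⟨j, hj⟩ else 0) := by
        simp only [vecMul, dotProduct, ← Finset.sum_add_distrib]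
        refine Finset.sum_congr rfl fun i _ => ?_
        by_cases hi : i = i₀ <;> simp [φ, asMatrix, hi, hj, mul_add]
      rw [h1, hA j hj]
      simp [hi₀]
    refine Fintype.card_le_of_injective φ ?_
    rintro ⟨⟨A, hA⟩, t⟩ ⟨⟨A', hA'⟩, t'⟩ h
    have ht : t = t' := by
      funext ⟨j, hj⟩
      have h1 := key (⟨A, hA⟩, t) j hj
      have h2 := key (⟨A', hA'⟩, t') j hj
      rw [h] at h1
      exact h1.symm.trans h2
    subst ht
    have hAA : A = A' := by
      funext w
      exact add_right_cancel (congrFun h w)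
    subst hAA
    rfl
  have hsub : (Finset.univ.filter fun A : Fin ψ × Fin τ → Bit => ¬ Good A S) ⊆
      (Finset.univ.filter fun c : Fin ψ → Bit => c ≠ 0).biUnion fun c =>
        Finset.univ.filter fun A : Fin ψ × Fin τ → Bit => ∀ j ∉ S, (c ᵥ* asMatrix A) j = 0 := by
    intro A hA
    simp only [Finset.mem_filter, Finset.mem_univ, true_and] at hA
    by_contra hcon
    refine hA (good_of_independent fun c hc => ?_)
    by_contra hne
    exact hcon (Finset.mem_biUnion.2 ⟨c, by simpa using hne, by simpa using hc⟩)
  calc _ ≤ (∑ c ∈ Finset.univ.filter fun c : Fin ψ → Bit => c ≠ 0,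
        (Finset.univ.filter fun A : Fin ψ × Fin τ → Bit =>
          ∀ j ∉ S, (c ᵥ* asMatrix A) j = 0).card) * 2 ^ (τ - S.card) :=
        Nat.mul_le_mul_right _ ((Finset.card_le_card hsub).trans Finset.card_biUnion_le)
    _ = ∑ c ∈ Finset.univ.filter fun c : Fin ψ → Bit => c ≠ 0,
        (Finset.univ.filter fun A : Fin ψ × Fin τ → Bit =>
          ∀ j ∉ S, (c ᵥ* asMatrix A) j = 0).card * 2 ^ (τ - S.card) := Finset.sum_mul _ _ _
    _ ≤ ∑ c ∈ Finset.univ.filter fun c : Fin ψ → Bit => c ≠ 0,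
        Fintype.card (Fin ψ × Fin τ → Bit) :=
        Finset.sum_le_sum fun c hc' => hc c (Finset.mem_filter.1 hc').2
    _ ≤ 2 ^ ψ * Fintype.card (Fin ψ × Fin τ → Bit) := by
        rw [Finset.sum_const, smul_eq_mul]
        refine Nat.mul_le_mul_right _ ((Finset.card_filter_le _ _).trans (le_of_eq ?_))
        simp [ZMod.card]

end elimination

/-! ### Circuits for the elimination -/

section circuits

open Matrix

variable {ι : Type} {τ ψ : ℕ}

theorem ComputesBit.dotProduct {n : ℕ} {f g : (ι → Bit) → Fin n → Bit} {a b : ℕ}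
    (hf : ∀ k, ComputesBit (fun x => f x k) a) (hg : ∀ k, ComputesBit (fun x => g x k) b) :
    ComputesBit (fun x => f x ⬝ᵥ g x) (n * (a + b + 2) + 1) := by
  simpa [_root_.dotProduct] using ComputesBit.sum fun k => (hf k).mul (hg k)

theorem ComputesBit.firstOne {n : ℕ} {f : (ι → Bit) → Fin n → Bit} {a : ℕ}
    (hf : ∀ k, ComputesBit (fun x => f x k) a) (k : Fin n) :
    ComputesBit (fun x => UC.firstOne (f x) k) (a + (n * (a + 3) + 1) + 1) := by
  refine (hf k).mul ((ComputesBit.finset_prod (fun k' => ComputesBit.one.add (hf k')) _).mono ?_)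
  rw [Fin.card_Iio]
  have := k.2.le
  have : k.1 * (1 + a + 1 + 1) ≤ n * (a + 3) := Nat.mul_le_mul this (by omega)
  omega

/-- A step of the elimination has a circuit of polynomial size. The inputs are the matrix `A` and
the set of positions, which the step does not use, and the cells. -/
theorem Computes.elimStep (i : Fin ψ) {n : ℕ} (hn : τ + ψ + 1 ≤ n) :
    Computes (fun x : (Fin ψ × Fin τ ⊕ Fin τ) ⊕ ElimCell τ ψ → Bit =>
      UC.elimStep (fun w => x (Sum.inl (Sum.inl w))) i fun s => x (Sum.inr s)) (20 * n ^ 5) := by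
  have hv : ∀ k, ComputesBit (fun x : (Fin ψ × Fin τ ⊕ Fin τ) ⊕ ElimCell τ ψ → Bit =>
      ((asMatrix fun w => x (Sum.inl (Sum.inl w))) i ᵥ* kernelPart fun s => x (Sum.inr s)) k)
      (2 * n) := fun k =>
    (ComputesBit.dotProduct (fun j => ComputesBit.input (Sum.inl (Sum.inl (i, j))))
      (fun j => ComputesBit.input (Sum.inr (Sum.inl (j, k))))).mono (by omega)
  have hd : ∀ j, ComputesBit (fun x : (Fin ψ × Fin τ ⊕ Fin τ) ⊕ ElimCell τ ψ → Bit =>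
      ((kernelPart fun s => x (Sum.inr s)) *ᵥ UC.firstOne ((asMatrix fun w =>
        x (Sum.inl (Sum.inl w))) i ᵥ* kernelPart fun s => x (Sum.inr s))) j)
      (τ * (0 + (2 * n + (τ * (2 * n + 3) + 1) + 1) + 2) + 1) := fun j =>
    ComputesBit.dotProduct (fun k => ComputesBit.input (Sum.inr (Sum.inl (j, k))))
      (ComputesBit.firstOne hv)
  have hE : ∀ k, ComputesBit (fun x : (Fin ψ × Fin τ ⊕ Fin τ) ⊕ ElimCell τ ψ → Bit =>
      Pi.single (M := fun _ => Bit) i 1 k +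
        ((asMatrix fun w => x (Sum.inl (Sum.inl w))) i ᵥ* inversePart fun s => x (Sum.inr s)) k)
      (2 * n + 2) := fun k => by
    refine ComputesBit.mono (ComputesBit.add (n := 1) ?_ (ComputesBit.dotProduct
      (fun j => ComputesBit.input (Sum.inl (Sum.inl (i, j))))
      (fun j => ComputesBit.input (Sum.inr (Sum.inr (j, k)))))) (by omega : _ ≤ _)
    by_cases h : k = i
    · subst h; simpa using ComputesBit.one
    · simpa [h] using ComputesBit.zero
  have hn1 : 1 ≤ n := by omega
  have hτ : τ ≤ n := by omega
  set c := τ * (0 + (2 * n + (τ * (2 * n + 3) + 1) + 1) + 2) + 1 with hc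
  have hcn : c ≤ 14 * n ^ 3 := by
    have h1 : τ * (2 * n + 3) ≤ n * (2 * n + 3) := Nat.mul_le_mul_right _ hτ
    have h2 : c ≤ n * (0 + (2 * n + (n * (2 * n + 3) + 1) + 1) + 2) + 1 := by
      rw [hc]; gcongr
    nlinarith [Nat.pow_le_pow_right hn1 (show 1 ≤ 3 by norm_num),
      Nat.pow_le_pow_right hn1 (show 2 ≤ 3 by norm_num), Nat.one_le_pow 3 n hn1]
  have h5 : ∀ w, ComputesBit (fun x : (Fin ψ × Fin τ ⊕ Fin τ) ⊕ ElimCell τ ψ → Bit =>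
      UC.elimStep (fun w => x (Sum.inl (Sum.inl w))) i (fun s => x (Sum.inr s)) w)
      (20 * n ^ 3) := by
    have h3 : n ≤ n ^ 3 := Nat.le_self_pow (by norm_num) n
    rintro (⟨j, k⟩ | ⟨j, k⟩)
    · exact ((ComputesBit.input (Sum.inr (Sum.inl (j, k)))).add ((hd j).mul (hv k))).mono
        (by omega)
    · exact ((ComputesBit.input (Sum.inr (Sum.inr (j, k)))).add ((hd j).mul (hE k))).mono
        (by omega)
  refine (Computes.of_bits_const h5).mono ?_
  have hcard : Fintype.card (ElimCell τ ψ) ≤ n ^ 2 := by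
    simp only [ElimCell, Fintype.card_sum, Fintype.card_prod, Fintype.card_fin]
    nlinarith
  calc _ ≤ n ^ 2 * (20 * n ^ 3) := Nat.mul_le_mul_right _ hcard
    _ = _ := by ring

theorem Computes.elimResult {n : ℕ} (hn : τ + ψ + 1 ≤ n) :
    Computes (fun x : Fin ψ × Fin τ ⊕ Fin τ → Bit =>
      UC.elimResult (fun w => x (Sum.inl w)) fun j => x (Sum.inr j)) (22 * n ^ 6) := by
  have hstart : Computes (fun x : Fin ψ × Fin τ ⊕ Fin τ → Bit =>
      elimStart ψ fun j => x (Sum.inr j)) (n ^ 2 * 2) := by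
    refine (Computes.of_bits_const (n := 2) ?_).mono (Nat.mul_le_mul_right _ ?_)
    · rintro (⟨j, k⟩ | ⟨j, k⟩)
      · by_cases h : j = k
        · simpa [elimStart, h] using ComputesBit.one.add (ComputesBit.input (Sum.inr k))
        · simpa [elimStart, h] using ComputesBit.zero.mono (by norm_num)
      · exact ComputesBit.zero.mono (by norm_num)
    · simp only [ElimCell, Fintype.card_sum, Fintype.card_prod, Fintype.card_fin]
      nlinarith
  have h := ((Computes.wires (id : Fin ψ × Fin τ ⊕ Fin τ → _)).elim hstart).comp
    (Computes.foldl (step := fun i p q => UC.elimStep (fun w => p (Sum.inl w)) i q)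
      (fun i : Fin ψ => Computes.elimStep i hn) (List.finRange ψ))
  refine h.mono ?_
  rw [List.length_finRange]
  have h1 : ψ * (20 * n ^ 5) ≤ n * (20 * n ^ 5) := Nat.mul_le_mul_right _ (by omega)
  have h2 : n ^ 2 ≤ n ^ 6 := Nat.pow_le_pow_right (by omega) (by norm_num)
  nlinarith

end circuits

/-! ### Systems that may stop -/

section stopping

variable {I O St C : Type}

/-- The output bit of the environment in an interaction with a system that may stop, which is
described by its transition function; `none` means that the system has stopped. -/
def playStop (E : Env I O) (step : St → I → PMF (Option (St × O))) :
    ℕ → List (I × O) → St → PMF (Option Bool)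
  | 0, h, _ => (E.guess h).map some
  | n + 1, h, s => (E.ask h).bind fun i => (step s i).bind fun r =>
      r.elim (PMF.pure none) fun r => playStop E step n (h ++ [(i, r.2)]) r.1

/-- The effect of a kernel between states on the results of transitions. -/
def liftKernel (κ : C → PMF St) (r : Option (C × O)) : PMF (Option (St × O)) :=
  r.elim (PMF.pure none) fun r => (κ r.1).map fun s => some (s, r.2)

/-- If a kernel between the states of two systems commutes with all transitions, then no environment
distinguishes the systems. -/
theorem bind_playStop (E : Env I O) {step : St → I → PMF (Option (St × O))}
    {step' : C → I → PMF (Option (C × O))} {κ : C → PMF St}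
    (hκ : ∀ c i, ((κ c).bind fun s => step s i) = (step' c i).bind (liftKernel κ))
    (n : ℕ) (h : List (I × O)) (c : C) :
    (κ c).bind (playStop E step n h) = playStop E step' n h c := by
  induction n generalizing h c with
  | zero => exact PMF.bind_const _ _
  | succ n ih =>
    simp only [playStop]
    rw [PMF.bind_comm]
    congr 1
    funext i
    rw [← PMF.bind_bind, hκ, PMF.bind_bind]
    congr 1
    funext r
    cases r with
    | none => simp [liftKernel]
    | some r =>
      simp only [liftKernel, Option.elim_some, PMF.bind_map, Function.comp_def]
      exact ih _ _

/-- A system regarded as one that never stops. -/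
def System.stepStop (S : System I O) (s : S.State) (i : I) : PMF (Option (S.State × O)) :=
  (S.step s i).map some

theorem playStop_stepStop (E : Env I O) (S : System I O) (n : ℕ) (h : List (I × O))
    (s : S.State) : playStop E S.stepStop n h s = (E.play S n h s).map some := by
  induction n generalizing h s with
  | zero => rfl
  | succ n ih =>
    simp only [playStop, Env.play, System.stepStop, PMF.bind_map, PMF.map_bind, Function.comp_def,
      Option.elim_some, ih]

/-- The deterministic case of `bind_playStop`. -/
theorem play_embed (E : Env I O) (S : System I O) {step : C → I → PMF (Option (C × O))}
    (e : C → S.State)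
    (he : ∀ c i, (S.step (e c) i).map some =
      (step c i).map (Option.map fun r => (e r.1, r.2)))
    (n : ℕ) (h : List (I × O)) (c : C) :
    (E.play S n h (e c)).map some = playStop E step n h c := by
  rw [← playStop_stepStop, ← bind_playStop E (κ := fun c => PMF.pure (e c)) (step := S.stepStop)
    (fun c i => ?_) n h c, PMF.pure_bind]
  rw [PMF.pure_bind, System.stepStop, he, ← PMF.bind_pure_comp]
  congr 1
  funext r
  cases r <;> simp [liftKernel, PMF.pure_map]

/-- A system that stops more often reaches each output with smaller probability. -/
theorem playStop_mono (E : Env I O) {step step' : St → I → PMF (Option (St × O))}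
    (hs : ∀ s i r, step s i (some r) ≤ step' s i (some r)) (n : ℕ) (h : List (I × O)) (s : St)
    (b : Bool) : playStop E step n h s (some b) ≤ playStop E step' n h s (some b) := by
  induction n generalizing h s with
  | zero => exact le_rfl
  | succ n ih =>
    simp only [playStop, PMF.bind_apply]
    refine ENNReal.tsum_le_tsum fun i => mul_le_mul_right (ENNReal.tsum_le_tsum fun r => ?_) _
    cases r with
    | none => simp
    | some r => exact mul_le_mul' (hs _ _ _) (ih _ _)

/-- Two bits that are both at least as likely to take each value as the output of an interaction
that may stop differ at most by the probability of stopping. -/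
theorem abs_sub_le_of_le {p q : PMF Bool} {m : PMF (Option Bool)}
    (hp : ∀ b, m (some b) ≤ p b) (hq : ∀ b, m (some b) ≤ q b) :
    |(p true).toReal - (q true).toReal| ≤ (m none).toReal := by
  have hsum : ∀ p : PMF Bool, (p true).toReal + (p false).toReal = 1 := fun p => by
    rw [← ENNReal.toReal_add (p.apply_ne_top _) (p.apply_ne_top _),
      ← Fintype.sum_bool (fun b => p b), ← tsum_fintype (L := .unconditional _), p.tsum_coe,
      ENNReal.toReal_one]
  have hm : (m none).toReal + ((m (some true)).toReal + (m (some false)).toReal) = 1 := by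
    rw [← ENNReal.toReal_add (m.apply_ne_top _) (m.apply_ne_top _),
      ← ENNReal.toReal_add (m.apply_ne_top _) (by simp [m.apply_ne_top]),
      ← Fintype.sum_bool (fun b => m (some b)), ← Fintype.sum_option (fun b => m b),
      ← tsum_fintype (L := .unconditional _), m.tsum_coe, ENNReal.toReal_one]
  have h : ∀ p : PMF Bool, (∀ b, m (some b) ≤ p b) → ∀ b, (m (some b)).toReal ≤ (p b).toReal :=
    fun p hp b => ENNReal.toReal_mono (p.apply_ne_top _) (hp b)
  have := hsum p
  have := hsum q
  have := h p hp true
  have := h p hp false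
  have := h q hq true
  have := h q hq false
  rw [abs_le]
  constructor <;> linarith

end stopping

/-! ### Representations of the global key -/

section uniform

theorem bind_uniform_comp {α β : Type*} [Fintype α] [Nonempty α] {σ : α → α}
    (hσ : Function.Bijective σ) (f : α → PMF β) :
    ((PMF.uniformOfFintype α).bind fun a => f (σ a)) = (PMF.uniformOfFintype α).bind f := by
  ext b
  simp only [PMF.bind_apply, PMF.uniformOfFintype_apply]
  exact (Equiv.ofBijective σ hσ).tsum_eq fun a => (Fintype.card α : ℝ≥0∞)⁻¹ * f a b

theorem bijective_of_involutive {α : Type*} {σ : α → α} (h : ∀ a, σ (σ a) = a) :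
    Function.Bijective σ :=
  Function.Involutive.bijective h

end uniform

/-- A random experiment that determines a global key: it answers queries for the key and leaks bits
of it once, and it yields a compressed key. Queries have the set of leaked positions as an
argument. -/
structure KeyBox (τ ψ : ℕ) : Type 1 where
  State : Type
  init : PMF State
  query : Finset (Fin τ) → State → (Fin τ → Bit) → PMF (State × Bool)
  leak : Finset (Fin τ) → State → PMF (State × (Fin τ → Option Bit))
  short : State → Fin ψ → Bit

/-- A kernel between the states of two key boxes that commutes with all operations as long as the
leaked sets are good. It may depend on the set of positions leaked so far. -/
structure KeyBox.Hom {τ ψ : ℕ} (good : Finset (Fin τ) → Prop) (K K' : KeyBox τ ψ) : Type where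
  kernel : Finset (Fin τ) → K.State → PMF K'.State
  init : K.init.bind (kernel ∅) = K'.init
  query : ∀ S, good S → ∀ k G, ((kernel S k).bind fun k' => K'.query S k' G) =
    (K.query S k G).bind fun r => (kernel S r.1).map fun k' => (k', r.2)
  leak : ∀ S, good ∅ → good S → ∀ k, (kernel ∅ k).bind (K'.leak S) =
    (K.leak S k).bind fun r => (kernel S r.1).map fun k' => (k', r.2)
  short : ∀ S, good S → ∀ k, (kernel S k).map (fun k' => (k', K'.short k')) =
    (kernel S k).map fun k' => (k', K.short k)

section keys

open Matrix

variable {τ ψ : ℕ} (A : Fin ψ × Fin τ → Bit)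

/-- The compression of a vector by the matrix `A`. -/
abbrev press (v : Fin τ → Bit) : Fin ψ → Bit := asMatrix A *ᵥ v

/-- A modification of `z` outside `S` that is compressed to `Δ`. -/
def fit (S : Finset (Fin τ)) (Δ : Fin ψ → Bit) (z : Fin τ → Bit) : Fin τ → Bit :=
  z + rightInv A S *ᵥ (Δ + press A z)

/-- The vector that agrees with `g` on `S` and with `r` elsewhere. -/
def mix (S : Finset (Fin τ)) (g r : Fin τ → Bit) : Fin τ → Bit :=
  fun j => if j ∈ S then g j else r j

/-- The global key of the box in the protocol. -/
def realKey : KeyBox τ ψ where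
  State := Fin τ → Bit
  init := PMF.uniformOfFintype _
  query _ Γ G := PMF.pure (Γ, decide (G = Γ))
  leak S Γ := PMF.pure (Γ, reveal S Γ)
  short := press A

/-- The key of the simulator. The state consists of the compressed key, which is known to the ideal
box only, a random vector `g`, and an offset `u`. The simulator leaks bits of `g + u`. When a query
is compressed to the right value, the simulator changes the offset such that `g + u` is a solution,
too, and compares the query with `g + u`. -/
def simKey : KeyBox τ ψ where
  State := (Fin ψ → Bit) × (Fin τ → Bit) × (Fin τ → Bit)
  init := (PMF.uniformOfFintype (Fin ψ → Bit)).bind fun Δ =>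
    (PMF.uniformOfFintype (Fin τ → Bit)).map fun g => (Δ, g, 0)
  query S k G :=
    if press A G = k.1 then
      let u := k.2.2 + rightInv A S *ᵥ (press A G + press A (k.2.1 + k.2.2))
      PMF.pure ((k.1, k.2.1, u), decide (G = k.2.1 + u))
    else PMF.pure (k, false)
  leak S k := PMF.pure (k, reveal S (k.2.1 + k.2.2))
  short k := k.1

/-- The state of a key that is sampled as late as possible: either only the compressed key and the
leaked bits, which are those of a vector `g`, are determined, or the key is determined as `g + u`.
-/
inductive LazyState (τ ψ : ℕ) : Type
  | undetermined (Δ : Fin ψ → Bit) (g : Fin τ → Bit) : LazyState τ ψ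
  | determined (g u : Fin τ → Bit) : LazyState τ ψ

/-- The key that is sampled as late as possible: first the compressed key, then the leaked bits, and
the remaining bits when a query is compressed to the right value. -/
def lazyKey : KeyBox τ ψ where
  State := LazyState τ ψ
  init := (PMF.uniformOfFintype (Fin ψ → Bit)).map fun Δ => LazyState.undetermined Δ 0
  query S k G :=
    match k with
    | LazyState.undetermined Δ g =>
      if press A G = Δ then
        (PMF.uniformOfFintype (Fin τ → Bit)).map fun r =>
          let z := mix S g r
          let u := rightInv A S *ᵥ (Δ + press A z)
          (LazyState.determined z u, decide (G = z + u))
      else PMF.pure (k, false)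
    | LazyState.determined g u => PMF.pure (k, decide (G = g + u))
  leak S k :=
    match k with
    | LazyState.undetermined Δ _ =>
      (PMF.uniformOfFintype (Fin τ → Bit)).map fun r =>
        (LazyState.undetermined Δ r, reveal S r)
    | LazyState.determined g u => PMF.pure (k, reveal S (g + u))
  short k :=
    match k with
    | LazyState.undetermined Δ _ => Δ
    | LazyState.determined g u => press A (g + u)

variable {A} {S : Finset (Fin τ)}

theorem press_add (v w : Fin τ → Bit) : press A (v + w) = press A v + press A w :=
  Matrix.mulVec_add _ _ _

theorem press_rightInv (hS : Good A S) (y : Fin ψ → Bit) : press A (rightInv A S *ᵥ y) = y := by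
  rw [press, Matrix.mulVec_mulVec, hS, Matrix.one_mulVec]

theorem vec_add_add_cancel {n : Type*} (v w : n → Bit) : v + (w + v) = w := by
  rw [add_left_comm, vec_add_self, add_zero]

theorem press_fit (hS : Good A S) (Δ : Fin ψ → Bit) (z : Fin τ → Bit) :
    press A (fit A S Δ z) = Δ := by
  rw [fit, press_add, press_rightInv hS, vec_add_add_cancel]

theorem reveal_congr {Γ Γ' : Fin τ → Bit} (h : ∀ j ∈ S, Γ j = Γ' j) :
    reveal S Γ = reveal S Γ' := by
  funext j
  by_cases hj : j ∈ S <;> simp [reveal, hj, h]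

theorem rightInv_mulVec_apply {j : Fin τ} (hj : j ∈ S) (y : Fin ψ → Bit) :
    (rightInv A S *ᵥ y) j = 0 := by
  rw [Matrix.mulVec, rightInv_support j hj, zero_dotProduct]

theorem reveal_fit (Δ : Fin ψ → Bit) (z : Fin τ → Bit) :
    reveal S (fit A S Δ z) = reveal S z :=
  reveal_congr fun j hj => by simp [fit, rightInv_mulVec_apply hj]

theorem reveal_mix (g r : Fin τ → Bit) : reveal S (mix S g r) = reveal S g :=
  reveal_congr fun j hj => by simp [mix, hj]

theorem mix_empty (g r : Fin τ → Bit) : mix ∅ g r = r := by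
  funext j; simp [mix]

/-- Mixing two uniform vectors yields a uniform vector. -/
theorem bind_mix {β : Type*} (S : Finset (Fin τ)) (f : (Fin τ → Bit) → PMF β) :
    ((PMF.uniformOfFintype (Fin τ → Bit)).bind fun g =>
      (PMF.uniformOfFintype (Fin τ → Bit)).bind fun r => f (mix S g r)) =
    (PMF.uniformOfFintype (Fin τ → Bit)).bind f := by
  -- Exchanging the two vectors outside `S` is a bijection between pairs.
  ext b
  simp only [PMF.bind_apply, PMF.uniformOfFintype_apply, ENNReal.tsum_mul_left]
  have hσ : Function.Bijective fun p : (Fin τ → Bit) × (Fin τ → Bit) =>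
      (mix S p.1 p.2, mix S p.2 p.1) := bijective_of_involutive fun p => by
    refine Prod.ext ?_ ?_ <;> funext j <;> by_cases hj : j ∈ S <;> simp [mix, hj]
  have h := (Equiv.ofBijective _ hσ).tsum_eq fun p => f p.1 b
  simp only [Equiv.ofBijective_apply] at h
  rw [← ENNReal.tsum_prod (f := fun g r => f (mix S g r) b), h,
    ENNReal.tsum_prod (f := fun g _ => f g b)]
  simp only [tsum_fintype, Finset.sum_const, Finset.card_univ, nsmul_eq_mul, ← Finset.mul_sum]
  congr 1
  rw [← mul_assoc, ENNReal.inv_mul_cancel (by simp) (by simp), one_mul]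

/-- The fitted vector of a uniform vector does not depend on the choice of the right inverse. -/
theorem bind_fit {β : Type*} {T : Finset (Fin τ)} (hS : Good A S) (hT : Good A T)
    (Δ : Fin ψ → Bit) (f : (Fin τ → Bit) → PMF β) :
    ((PMF.uniformOfFintype (Fin τ → Bit)).bind fun r => f (fit A S Δ r)) =
      (PMF.uniformOfFintype (Fin τ → Bit)).bind fun r => f (fit A T Δ r) := by
  let σ : (Fin τ → Bit) → Fin τ → Bit := fun r =>
    r + (rightInv A S *ᵥ (Δ + press A r) + rightInv A T *ᵥ (Δ + press A r))
  have hpress : ∀ r, press A (σ r) = press A r := fun r => by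
    simp only [σ]
    rw [press_add, press_add, press_rightInv hS, press_rightInv hT, vec_add_self, add_zero]
  have hσ : Function.Bijective σ := bijective_of_involutive fun r => by
    show σ r + (rightInv A S *ᵥ (Δ + press A (σ r)) + rightInv A T *ᵥ (Δ + press A (σ r))) = r
    rw [hpress]
    simp only [σ]
    rw [add_assoc, vec_add_self, add_zero]
  have hfit : ∀ r, fit A S Δ (σ r) = fit A T Δ r := fun r => by
    rw [fit, hpress]
    simp only [σ, fit]
    rw [add_assoc, add_comm (rightInv A S *ᵥ _) (rightInv A T *ᵥ _), add_assoc, vec_add_self,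
      add_zero]
  rw [← bind_uniform_comp hσ]
  simp only [hfit]

/-- A uniform vector that is fitted to a uniform compressed key is uniform. -/
theorem bind_bind_fit {β : Type*} (A : Fin ψ × Fin τ → Bit) (S : Finset (Fin τ))
    (f : (Fin τ → Bit) → PMF β) :
    ((PMF.uniformOfFintype (Fin ψ → Bit)).bind fun Δ =>
      (PMF.uniformOfFintype (Fin τ → Bit)).bind fun r => f (fit A S Δ r)) =
      (PMF.uniformOfFintype (Fin τ → Bit)).bind f := by
  rw [PMF.bind_comm]
  have h1 : ∀ r : Fin τ → Bit, ((PMF.uniformOfFintype (Fin ψ → Bit)).bind fun Δ =>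
      f (fit A S Δ r)) = (PMF.uniformOfFintype (Fin ψ → Bit)).bind fun Δ =>
        f (r + rightInv A S *ᵥ Δ) := fun r =>
    bind_uniform_comp (σ := fun Δ => Δ + press A r)
      (bijective_of_involutive fun Δ => by rw [add_assoc, vec_add_self, add_zero]) fun Δ =>
        f (r + rightInv A S *ᵥ Δ)
  simp only [h1]
  rw [PMF.bind_comm]
  have h2 : ∀ Δ : Fin ψ → Bit, ((PMF.uniformOfFintype (Fin τ → Bit)).bind fun r =>
      f (r + rightInv A S *ᵥ Δ)) = (PMF.uniformOfFintype (Fin τ → Bit)).bind f := fun Δ =>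
    bind_uniform_comp (σ := fun r => r + rightInv A S *ᵥ Δ)
      (bijective_of_involutive fun r => by rw [add_assoc, vec_add_self, add_zero]) f
  simp only [h2, PMF.bind_const]

/-- The key of the protocol can be sampled late. -/
def lazyToReal (A : Fin ψ × Fin τ → Bit) : KeyBox.Hom (Good A) (lazyKey A) (realKey A) where
  kernel S k :=
    match k with
    | LazyState.undetermined Δ g =>
      (PMF.uniformOfFintype (Fin τ → Bit)).map fun r => fit A S Δ (mix S g r)
    | LazyState.determined g u => PMF.pure (g + u)
  init := by
    have h := bind_bind_fit A ∅ PMF.pure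
    rw [PMF.bind_pure] at h
    simpa only [lazyKey, realKey, PMF.bind_bind, PMF.pure_bind, Function.comp_def, mix_empty,
      ← PMF.bind_pure_comp] using h
  query S hS k G := by
    cases k with
    | determined g u => simp [lazyKey, realKey, PMF.pure_map]
    | undetermined Δ g =>
      simp only [lazyKey, realKey, PMF.bind_map, Function.comp_def]
      split_ifs with hG
      · rw [PMF.bind_map]
        simp only [Function.comp_def, PMF.pure_map]
        rfl
      · have hne : ∀ r, G ≠ fit A S Δ (mix S g r) := by
          rintro r rfl
          exact hG (press_fit hS _ _)
        simp only [hne, decide_false, PMF.pure_bind, PMF.map_comp]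
        rfl
  leak S h₀ hS k := by
    cases k with
    | determined g u => simp [lazyKey, realKey, PMF.pure_map]
    | undetermined Δ g =>
      simp only [lazyKey, realKey, PMF.bind_bind, PMF.pure_bind, Function.comp_def, mix_empty,
        ← PMF.bind_pure_comp]
      rw [bind_fit h₀ hS Δ fun Γ => PMF.pure (Γ, reveal S Γ),
        ← bind_mix S fun r => PMF.pure (fit A S Δ r, reveal S (fit A S Δ r))]
      simp only [reveal_fit, reveal_mix]
  short S hS k := by
    cases k with
    | determined g u => simp [lazyKey, realKey, PMF.pure_map]
    | undetermined Δ g =>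
      simp only [lazyKey, realKey, PMF.map_comp, Function.comp_def, press_fit hS]

/-- The key of the simulator can be sampled late, too. -/
def lazyToSim (A : Fin ψ × Fin τ → Bit) : KeyBox.Hom (Good A) (lazyKey A) (simKey A) where
  kernel S k :=
    match k with
    | LazyState.undetermined Δ g =>
      (PMF.uniformOfFintype (Fin τ → Bit)).map fun r => (Δ, mix S g r, 0)
    | LazyState.determined g u => PMF.pure (press A (g + u), g, u)
  init := by
    simp only [lazyKey, simKey, PMF.bind_map, Function.comp_def, mix_empty]
  query S hS k G := by
    cases k with
    | determined g u =>
      simp only [lazyKey, simKey, PMF.pure_bind, PMF.pure_map]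
      split_ifs with hG
      · rw [hG, vec_add_self, Matrix.mulVec_zero, add_zero]
      · have hne : G ≠ g + u := by rintro rfl; exact hG rfl
        simp [hne]
    | undetermined Δ g =>
      simp only [lazyKey, simKey, PMF.bind_map, Function.comp_def]
      split_ifs with hG
      · rw [PMF.bind_map]
        subst hG
        congr 1
        funext r
        have h := press_fit hS (press A G) (mix S g r)
        simp only [fit] at h
        simp [PMF.pure_map, h]
      · simp [Function.comp_def, ← PMF.bind_pure_comp]
  leak S h₀ hS k := by
    cases k with
    | determined g u => simp [lazyKey, simKey, PMF.pure_map]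
    | undetermined Δ g =>
      simp only [lazyKey, simKey, PMF.bind_bind, PMF.pure_bind, Function.comp_def, mix_empty,
        ← PMF.bind_pure_comp, add_zero]
      rw [← bind_mix S fun r => PMF.pure ((Δ, r, (0 : Fin τ → Bit)), reveal S r)]
      simp only [reveal_mix]
  short S hS k := by
    cases k with
    | determined g u => simp [lazyKey, simKey, PMF.pure_map]
    | undetermined Δ g =>
      simp only [lazyKey, simKey, PMF.map_comp, Function.comp_def]

end keys

/-! ### The protocol on top of a key box -/

section clients

variable {ℓ τ ψ : ℕ}

/-- The share of `B` with the global key `Δ` and the local keys `k`. -/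
def bShare {n : ℕ} (Δ : Fin n → Bit) (k : Fin ℓ → Fin n → Bit) : BShare ℓ n
  | BWire.glob j => Δ j
  | BWire.loc i j => k i j

/-- The share of `A` after compression. -/
def pressA (A : Fin ψ × Fin τ → Bit) (a : AShare ℓ τ) : AShare ℓ ψ :=
  (compress ℓ τ ψ).outA a A

/-- The share of `B` after compression. -/
def pressB (A : Fin ψ × Fin τ → Bit) (b : BShare ℓ τ) : BShare ℓ ψ :=
  (compress ℓ τ ψ).outB A b

/-- The relation between the shares is linear in the keys and hence preserved by the compression. -/
theorem pressA_toAShare (A : Fin ψ × Fin τ → Bit) (x : Fin ℓ → Bit) (b : BShare ℓ τ) :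
    pressA A (toAShare x b) = toAShare x (pressB A b) := by
  funext w
  cases w with
  | bit i => rfl
  | mac i j =>
    show (asMatrix A).mulVec (fun k => b (BWire.loc i k) + x i * b (BWire.glob k)) j = _
    rw [show (fun k => b (BWire.loc i k) + x i * b (BWire.glob k)) =
      (fun k => b (BWire.loc i k)) + x i • (fun k => b (BWire.glob k)) from rfl,
      Matrix.mulVec_add, Matrix.mulVec_smul]
    rfl

theorem pressB_toBShare (A : Fin ψ × Fin τ → Bit) (Γ : Fin τ → Bit) (a : AShare ℓ τ) :
    pressB A (toBShare Γ a) = toBShare (press A Γ) (pressA A a) := by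
  funext w
  cases w with
  | glob j => rfl
  | loc i j =>
    show (asMatrix A).mulVec (fun k => a (AWire.mac i k) + a (AWire.bit i) * Γ k) j = _
    rw [show (fun k => a (AWire.mac i k) + a (AWire.bit i) * Γ k) =
      (fun k => a (AWire.mac i k)) + a (AWire.bit i) • Γ from rfl,
      Matrix.mulVec_add, Matrix.mulVec_smul]
    rfl

theorem pressB_bShare (A : Fin ψ × Fin τ → Bit) (Γ : Fin τ → Bit) (k : Fin ℓ → Fin τ → Bit) :
    pressB A (bShare Γ k) = bShare (press A Γ) fun i => press A (k i) := by
  funext w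
  cases w <;> rfl

/-- The progress of a run with corrupted `A`: the box waits for the choice of `A`, it has failed, or
`A` has chosen a share and honest `B` may have sent its message and produced its output. -/
inductive AlicePhase (ℓ τ : ℕ) : Type
  | waiting : AlicePhase ℓ τ
  | failed : AlicePhase ℓ τ
  | chosen (a : AShare ℓ τ) (sent done : Bool) : AlicePhase ℓ τ

/-- The state of a run with corrupted `A`: the positions leaked by an undetected use of a leakage
function, the progress, and the state of the key box. -/
structure AliceState (ℓ τ : ℕ) (K : Type) : Type where
  leaked : Option (Finset (Fin τ))
  phase : AlicePhase ℓ τ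
  key : K

/-- The positions leaked so far. -/
def AliceState.leakSet {K : Type} (s : AliceState ℓ τ K) : Finset (Fin τ) := s.leaked.getD ∅

open Classical in
/-- An activation of the protocol with corrupted `A` and matrix `A` on top of a key box. It stops if
the set of positions that are leaked is not good. -/
def aliceRun (𝓛 : Set (Leakage τ)) (A : Fin ψ × Fin τ → Bit) (good : Finset (Fin τ) → Prop)
    (K : KeyBox τ ψ) (s : AliceState ℓ τ K.State) (q : AdvCmd 𝓛 (Fin ψ × Fin τ) ℓ τ) :
    PMF (Option (AliceState ℓ τ K.State × Obs (Fin ψ × Fin τ) ℓ τ ψ)) :=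
  match q with
  | AdvCmd.box (BoxCmd.query G) =>
    match s.phase with
    | AlicePhase.failed => PMF.pure (some (s, {}))
    | _ => (K.query s.leakSet s.key G).map fun r =>
        some ({ s with key := r.1 }, { resp := Resp.answer r.2 })
  | AdvCmd.box (BoxCmd.leak L) =>
    match s.phase, s.leaked with
    | AlicePhase.waiting, none => L.1.bind fun p =>
        if p.2 = true then
          if good p.1 then
            (K.leak p.1 s.key).map fun r =>
              some ({ s with leaked := some p.1, key := r.1 }, { resp := Resp.leaked r.2 })
          else PMF.pure none
        else PMF.pure (some ({ s with phase := AlicePhase.failed }, { outB := some BOut.fail }))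
    | _, _ => PMF.pure (some (s, {}))
  | AdvCmd.box (BoxCmd.chooseA a) =>
    match s.phase with
    | AlicePhase.waiting =>
      PMF.pure (some ({ s with phase := AlicePhase.chosen a false false }, {}))
    | _ => PMF.pure (some (s, {}))
  | AdvCmd.box BoxCmd.releaseB =>
    match s.phase with
    | AlicePhase.chosen a false d =>
      PMF.pure (some ({ s with phase := AlicePhase.chosen a true d }, { sent := some A }))
    | _ => PMF.pure (some (s, {}))
  | AdvCmd.wakeB =>
    match s.phase with
    | AlicePhase.chosen a true false =>
      PMF.pure (some ({ s with phase := AlicePhase.chosen a true true },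
        { outB := some (BOut.share (toBShare (K.short s.key) (pressA A a))) }))
    | _ => PMF.pure (some (s, {}))
  | _ => PMF.pure (some (s, {}))

open Classical in
/-- The protocol with corrupted `A` and matrix `A` on top of a key box. It stops as soon as the set
of positions leaked so far is not good. -/
def aliceStep (𝓛 : Set (Leakage τ)) (A : Fin ψ × Fin τ → Bit) (good : Finset (Fin τ) → Prop)
    (K : KeyBox τ ψ) (s : AliceState ℓ τ K.State) (q : AdvCmd 𝓛 (Fin ψ × Fin τ) ℓ τ) :
    PMF (Option (AliceState ℓ τ K.State × Obs (Fin ψ × Fin τ) ℓ τ ψ)) :=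
  if good s.leakSet then aliceRun 𝓛 A good K s q else PMF.pure none

/-- The kernel between states of runs that is induced by a kernel between key boxes. -/
def aliceKernel {good : Finset (Fin τ) → Prop} {K K' : KeyBox τ ψ} (H : K.Hom good K')
    (s : AliceState ℓ τ K.State) : PMF (AliceState ℓ τ K'.State) :=
  (H.kernel s.leakSet s.key).map fun k => { s with key := k }

/-- A kernel between key boxes turns runs on top of one box into runs on top of the other, as the
protocol uses the key only through the operations of the box. This is the hypothesis of
`bind_playStop`. -/
theorem bind_aliceStep {𝓛 : Set (Leakage τ)} {A : Fin ψ × Fin τ → Bit}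
    {good : Finset (Fin τ) → Prop} {K K' : KeyBox τ ψ} (H : K.Hom good K')
    (s : AliceState ℓ τ K.State) (q : AdvCmd 𝓛 (Fin ψ × Fin τ) ℓ τ) :
    ((aliceKernel H s).bind fun s' => aliceStep 𝓛 A good K' s' q) =
      (aliceStep 𝓛 A good K s q).bind (liftKernel (aliceKernel H)) := by
  obtain ⟨lk, ph, k⟩ := s
  rw [aliceKernel, PMF.bind_map]
  by_cases hg : good (lk.getD ∅)
  swap
  · simp [aliceStep, AliceState.leakSet, hg, Function.comp_def, liftKernel]
  simp only [aliceStep, AliceState.leakSet, hg, if_true, Function.comp_def]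
  have trivial_case : ((H.kernel (lk.getD ∅) k).bind fun k' =>
      PMF.pure (some ((⟨lk, ph, k'⟩ : AliceState ℓ τ K'.State),
        ({} : Obs (Fin ψ × Fin τ) ℓ τ ψ)))) =
      (PMF.pure (some ((⟨lk, ph, k⟩ : AliceState ℓ τ K.State),
        ({} : Obs (Fin ψ × Fin τ) ℓ τ ψ)))).bind (liftKernel (aliceKernel H)) := by
    simp [liftKernel, aliceKernel, AliceState.leakSet, Function.comp_def,
      ← PMF.bind_pure_comp]
  have move : ∀ (ph' : AlicePhase ℓ τ) (o : Obs (Fin ψ × Fin τ) ℓ τ ψ),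
      ((H.kernel (lk.getD ∅) k).bind fun k' =>
      PMF.pure (some ((⟨lk, ph', k'⟩ : AliceState ℓ τ K'.State), o))) =
      (PMF.pure (some ((⟨lk, ph', k⟩ : AliceState ℓ τ K.State), o))).bind
        (liftKernel (aliceKernel H)) := by
    intro ph' o
    simp [liftKernel, aliceKernel, AliceState.leakSet, Function.comp_def,
      ← PMF.bind_pure_comp]
  have query : ∀ G, ((H.kernel (lk.getD ∅) k).bind fun k' =>
      (K'.query (lk.getD ∅) k' G).map fun r =>
        some ((⟨lk, ph, r.1⟩ : AliceState ℓ τ K'.State),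
          ({ resp := Resp.answer r.2 } : Obs (Fin ψ × Fin τ) ℓ τ ψ))) =
      ((K.query (lk.getD ∅) k G).map fun r =>
        some ((⟨lk, ph, r.1⟩ : AliceState ℓ τ K.State),
          ({ resp := Resp.answer r.2 } : Obs (Fin ψ × Fin τ) ℓ τ ψ))).bind
        (liftKernel (aliceKernel H)) := by
    intro G
    rw [← PMF.map_bind, H.query _ hg]
    simp [liftKernel, aliceKernel, AliceState.leakSet, Function.comp_def,
      ← PMF.bind_pure_comp]
  cases q with
  | box q =>
    cases q with
    | query G =>
      cases ph
      · exact query G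
      · exact trivial_case
      · exact query G
    | leak L =>
      cases ph with
      | waiting =>
        cases lk with
        | some S => exact trivial_case
        | none =>
          replace hg : good ∅ := hg
          simp only [aliceRun, Option.getD_none]
          rw [PMF.bind_comm, PMF.bind_bind]
          congr 1
          funext p
          by_cases hp : p.2 = true
          · by_cases hgp : good p.1
            · simp only [hp, hgp, if_true]
              rw [← PMF.map_bind, H.leak p.1 hg hgp k]
              simp [liftKernel, aliceKernel, AliceState.leakSet, Function.comp_def,
                ← PMF.bind_pure_comp]
            · simp [hp, hgp, liftKernel]
          · simp only [hp]
            exact move AlicePhase.failed _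
      | failed => exact trivial_case
      | chosen => exact trivial_case
    | chooseA a =>
      cases ph
      · exact move (AlicePhase.chosen a false false) _
      · exact trivial_case
      · exact trivial_case
    | chooseB b => exact trivial_case
    | releaseA => exact trivial_case
    | releaseB =>
      rcases ph with _ | _ | ⟨a, _ | _, d⟩
      · exact trivial_case
      · exact trivial_case
      · exact move (AlicePhase.chosen a true d) _
      · exact trivial_case
  | wakeA => exact trivial_case
  | wakeB =>
    rcases ph with _ | _ | ⟨a, _ | _, _ | _⟩
    · exact trivial_case
    · exact trivial_case
    · exact trivial_case
    · exact trivial_case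
    · have h := congrArg (PMF.map fun r : K'.State × (Fin ψ → Bit) =>
        some ((⟨lk, AlicePhase.chosen a true true, r.1⟩ : AliceState ℓ τ K'.State),
          ({ outB := some (BOut.share (toBShare r.2 (pressA A a))) } :
            Obs (Fin ψ × Fin τ) ℓ τ ψ))) (H.short _ hg k)
      simp only [PMF.map_comp, Function.comp_def] at h
      refine Eq.trans (PMF.bind_pure_comp _ _) (h.trans ?_)
      simp [aliceRun, liftKernel, aliceKernel, AliceState.leakSet, PMF.map_comp, Function.comp_def]
    · exact trivial_case
  | deliver => exact trivial_case
  | send m => exact trivial_case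

/-- The progress of the message of `B` if nobody is corrupted. -/
inductive MsgStatus : Type
  | unsent | transit | delivered

/-- The state of a run without corruption: which parties have obtained the output of the box (for
`B` this is the case when the message has been sent) or have produced their output. -/
structure HonestState (K : Type) : Type where
  gotA : Bool
  msg : MsgStatus
  doneA : Bool
  doneB : Bool
  key : K

/-- The protocol without corruption on top of a key box. The matrix is `A`, and the bits of `A` and
the compressed local keys are `x` and `k`. -/
def honestStep (𝓛 : Set (Leakage τ)) (A : Fin ψ × Fin τ → Bit) (x : Fin ℓ → Bit)
    (k : Fin ℓ → Fin ψ → Bit) (K : KeyBox τ ψ) (s : HonestState K.State)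
    (q : AdvCmd 𝓛 (Fin ψ × Fin τ) ℓ τ) :
    PMF (Option (HonestState K.State × Obs (Fin ψ × Fin τ) ℓ τ ψ)) :=
  match q with
  | AdvCmd.box (BoxCmd.query G) => (K.query ∅ s.key G).map fun r =>
      some ({ s with key := r.1 }, { resp := Resp.answer r.2 })
  | AdvCmd.box BoxCmd.releaseA => PMF.pure (some ({ s with gotA := true }, {}))
  | AdvCmd.box BoxCmd.releaseB =>
    match s.msg with
    | MsgStatus.unsent => PMF.pure (some ({ s with msg := MsgStatus.transit }, { sent := some A }))
    | _ => PMF.pure (some (s, {}))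
  | AdvCmd.wakeA =>
    match s.gotA, s.msg, s.doneA with
    | true, MsgStatus.delivered, false =>
      PMF.pure (some ({ s with doneA := true },
        { outA := some (toAShare x (bShare (K.short s.key) k)) }))
    | _, _, _ => PMF.pure (some (s, {}))
  | AdvCmd.wakeB =>
    match s.msg, s.doneB with
    | MsgStatus.unsent, _ => PMF.pure (some (s, {}))
    | _, true => PMF.pure (some (s, {}))
    | _, false => PMF.pure (some ({ s with doneB := true },
        { outB := some (BOut.share (bShare (K.short s.key) k)) }))
  | AdvCmd.deliver =>
    match s.msg with
    | MsgStatus.transit => PMF.pure (some ({ s with msg := MsgStatus.delivered }, {}))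
    | _ => PMF.pure (some (s, {}))
  | _ => PMF.pure (some (s, {}))

/-- The kernel between states of runs that is induced by a kernel between key boxes. -/
def honestKernel {good : Finset (Fin τ) → Prop} {K K' : KeyBox τ ψ} (H : K.Hom good K')
    (s : HonestState K.State) : PMF (HonestState K'.State) :=
  (H.kernel ∅ s.key).map fun k => { s with key := k }

/-- The analogue of `bind_aliceStep` without corruption, where nothing is leaked. -/
theorem bind_honestStep {𝓛 : Set (Leakage τ)} {A : Fin ψ × Fin τ → Bit} {x : Fin ℓ → Bit}
    {k : Fin ℓ → Fin ψ → Bit} {good : Finset (Fin τ) → Prop} {K K' : KeyBox τ ψ}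
    (H : K.Hom good K') (hg : good ∅) (s : HonestState K.State)
    (q : AdvCmd 𝓛 (Fin ψ × Fin τ) ℓ τ) :
    ((honestKernel H s).bind fun s' => honestStep 𝓛 A x k K' s' q) =
      (honestStep 𝓛 A x k K s q).bind (liftKernel (honestKernel H)) := by
  obtain ⟨gA, m, dA, dB, κ⟩ := s
  rw [honestKernel, PMF.bind_map]
  simp only [Function.comp_def]
  have move : ∀ (gA' : Bool) (m' : MsgStatus) (dA' dB' : Bool) (o : Obs (Fin ψ × Fin τ) ℓ τ ψ),
      ((H.kernel ∅ κ).bind fun k' =>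
      PMF.pure (some ((⟨gA', m', dA', dB', k'⟩ : HonestState K'.State), o))) =
      (PMF.pure (some ((⟨gA', m', dA', dB', κ⟩ : HonestState K.State), o))).bind
        (liftKernel (honestKernel H)) := by
    intro gA' m' dA' dB' o
    simp [liftKernel, honestKernel, Function.comp_def, ← PMF.bind_pure_comp]
  have out : ∀ (dA' dB' : Bool) (o : (Fin ψ → Bit) → Obs (Fin ψ × Fin τ) ℓ τ ψ),
      ((H.kernel ∅ κ).bind fun k' =>
      PMF.pure (some ((⟨gA, m, dA', dB', k'⟩ : HonestState K'.State), o (K'.short k')))) =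
      (PMF.pure (some ((⟨gA, m, dA', dB', κ⟩ : HonestState K.State), o (K.short κ)))).bind
        (liftKernel (honestKernel H)) := by
    intro dA' dB' o
    have h := congrArg (PMF.map fun r : K'.State × (Fin ψ → Bit) =>
      some ((⟨gA, m, dA', dB', r.1⟩ : HonestState K'.State), o r.2)) (H.short _ hg κ)
    simp only [PMF.map_comp, Function.comp_def] at h
    refine Eq.trans (PMF.bind_pure_comp _ _) (h.trans ?_)
    simp [liftKernel, honestKernel, PMF.map_comp, Function.comp_def]
  cases q with
  | box q =>
    cases q with
    | query G =>
      simp only [honestStep]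
      rw [← PMF.map_bind, H.query _ hg]
      simp [liftKernel, honestKernel, Function.comp_def, ← PMF.bind_pure_comp]
    | leak L => exact move _ _ _ _ _
    | chooseA a => exact move _ _ _ _ _
    | chooseB b => exact move _ _ _ _ _
    | releaseA => exact move _ _ _ _ _
    | releaseB => cases m <;> exact move _ _ _ _ _
  | wakeA =>
    cases gA <;> cases m <;> cases dA <;>
      first
      | exact move _ _ _ _ _
      | exact out true dB fun Δ => { outA := some (toAShare x (bShare Δ k)) }
  | wakeB =>
    cases m <;> cases dB <;>
      first
      | exact move _ _ _ _ _
      | exact out dA true fun Δ => { outB := some (BOut.share (bShare Δ k)) }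
  | deliver => cases m <;> exact move _ _ _ _ _
  | send m => exact move _ _ _ _ _

end clients

/-! ### Tossing the coins in advance -/

section coins

variable {ℓ τ ψ : ℕ}

theorem bind_congr_support {α β : Type*} {p : PMF α} {f g : α → PMF β}
    (h : ∀ a ∈ p.support, f a = g a) : p.bind f = p.bind g := by
  ext b
  simp only [PMF.bind_apply]
  refine tsum_congr fun a => ?_
  by_cases ha : p a = 0
  · simp [ha]
  · rw [h a ((PMF.mem_support_iff _ _).2 ha)]

/-- The box hands keys to `B` at most once. -/
theorem waStep_share {n : ℕ} {𝓛 : Set (Leakage n)} {c : Corr} {s : WaState ℓ n}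
    {q : BoxCmd 𝓛 ℓ n} {r : WaState ℓ n × BoxOut ℓ n} (hr : r ∈ (waStep 𝓛 c s q).support) :
    (∃ b, r.2.toB = some (BOut.share b) ∧ s.releasedB = false ∧ r.1.releasedB = true) ∨
      ((∀ b, r.2.toB ≠ some (BOut.share b)) ∧ r.1.releasedB = s.releasedB) := by
  unfold waStep at hr
  split at hr
  · simp only [PMF.support_pure, Set.mem_singleton_iff] at hr; subst hr; simp
  cases q with
  | leak L =>
    simp only at hr
    split at hr
    · split_ifs at hr
      · simp only [PMF.support_map, Set.mem_image] at hr
        obtain ⟨p, -, rfl⟩ := hr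
        split_ifs <;> simp
      · simp only [PMF.support_pure, Set.mem_singleton_iff] at hr; subst hr; simp
    · simp only [PMF.support_pure, Set.mem_singleton_iff] at hr; subst hr; simp
  | chooseB b =>
    simp only at hr
    split_ifs at hr
    · simp only [PMF.support_map, Set.mem_image] at hr
      obtain ⟨p, -, rfl⟩ := hr
      simp
    · simp only [PMF.support_pure, Set.mem_singleton_iff] at hr; subst hr; simp
  | query Γ =>
    simp only at hr
    split at hr <;>
      · simp only [PMF.support_pure, Set.mem_singleton_iff] at hr; subst hr; simp
  | chooseA a =>
    simp only at hr
    split at hr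
    · split_ifs at hr <;>
        · simp only [PMF.support_pure, Set.mem_singleton_iff] at hr; subst hr; simp
    · simp only [PMF.support_pure, Set.mem_singleton_iff] at hr; subst hr; simp
  | releaseA =>
    simp only at hr
    split at hr
    · split_ifs at hr <;>
        · simp only [PMF.support_pure, Set.mem_singleton_iff] at hr; subst hr; simp
    · simp only [PMF.support_pure, Set.mem_singleton_iff] at hr; subst hr; simp
  | releaseB =>
    simp only at hr
    split at hr
    · split_ifs at hr with h
      · simp only [PMF.support_pure, Set.mem_singleton_iff] at hr; subst hr; simp [h.2]
      · simp only [PMF.support_pure, Set.mem_singleton_iff] at hr; subst hr; simp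
    · simp only [PMF.support_pure, Set.mem_singleton_iff] at hr; subst hr; simp

/-- An activation in the hybrid model where `B` uses the coins `r`. -/
def fixedStep (π : Protocol ℓ τ ψ) (𝓛 : Set (Leakage τ)) (c : Corr) (r : π.Coins → Bit)
    (s : HybridState π) (q : AdvCmd 𝓛 π.Msg ℓ τ) : PMF (HybridState π × Obs π.Msg ℓ τ ψ) :=
  match q with
  | AdvCmd.box q =>
    (waStep 𝓛 c s.box q).bind fun o =>
      let s' : HybridState π := { s with box := o.1, alice := o.2.toA.or s.alice }
      match o.2.toB with
      | none => PMF.pure (s', { resp := o.2.resp })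
      | some BOut.fail => PMF.pure (s', { resp := o.2.resp, outB := some BOut.fail })
      | some (BOut.share b) =>
        PMF.pure ({ s' with bob := some (r, b), channel := some (π.message r b) },
          { resp := o.2.resp, sent := some (π.message r b) })
  | q => hybridStep π 𝓛 c s q

/-- The protocol in the hybrid model where `B` uses the coins `r`. -/
def fixedHybrid (π : Protocol ℓ τ ψ) (𝓛 : Set (Leakage τ)) (c : Corr) (r : π.Coins → Bit) :
    System (AdvCmd 𝓛 π.Msg ℓ τ) (Obs π.Msg ℓ τ ψ) where
  State := HybridState π
  init := (waInit ℓ τ c).map fun s => { box := s }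
  step := fixedStep π 𝓛 c r

/-- The coins of `B`: uniformly random as long as `B` has not obtained its output of the box. -/
def coinsOf {π : Protocol ℓ τ ψ} (s : HybridState π) : PMF (π.Coins → Bit) :=
  if s.box.releasedB = true then PMF.pure (s.bob.elim 0 fun p => p.1)
  else PMF.uniformOfFintype _

/-- Tossing the coins after an activation has the same effect as tossing them before, because `B`
uses them only when it obtains its output of the box. -/
theorem bind_coinsOf {π : Protocol ℓ τ ψ} {𝓛 : Set (Leakage τ)} {c : Corr} {β : Type*}
    (s : HybridState π) (q : AdvCmd 𝓛 π.Msg ℓ τ)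
    (F : (π.Coins → Bit) → HybridState π × Obs π.Msg ℓ τ ψ → PMF β) :
    ((hybridStep π 𝓛 c s q).bind fun o => (coinsOf o.1).bind fun r => F r o) =
      (coinsOf s).bind fun r => (fixedStep π 𝓛 c r s q).bind (F r) := by
  -- In all activations but one the distribution of the coins does not change.
  have key : ∀ (s' : HybridState π) (o : Obs π.Msg ℓ τ ψ), coinsOf s' = coinsOf s →
      ((PMF.pure (s', o)).bind fun o => (coinsOf o.1).bind fun r => F r o) =
      (coinsOf s).bind fun r => (PMF.pure (s', o)).bind (F r) := by
    intro s' o h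
    simp [h]
  cases q with
  | box q =>
    simp only [hybridStep, fixedStep, PMF.bind_bind]
    rw [PMF.bind_comm]
    refine bind_congr_support fun o ho => ?_
    rcases waStep_share ho with ⟨b, hb, h₁, h₂⟩ | ⟨hb, h⟩
    · simp only [hb, PMF.bind_map, Function.comp_def, PMF.pure_bind]
      simp only [coinsOf, h₁, h₂, if_true, Option.elim_some, PMF.pure_bind]
      rfl
    · have hc : ∀ s' : HybridState π, s'.box = o.1 → s'.bob = s.bob → coinsOf s' = coinsOf s := by
        intro s' h₁ h₂
        simp only [coinsOf, h₁, h₂, h]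
      rcases hb' : o.2.toB with _ | _ | b
      · simp only
        refine key _ _ (hc _ ?_ ?_) <;> rfl
      · simp only
        refine key _ _ (hc _ ?_ ?_) <;> rfl
      · exact absurd hb' (hb b)
  | wakeA =>
    simp only [hybridStep, fixedStep]
    split <;> exact key _ _ rfl
  | wakeB =>
    simp only [hybridStep, fixedStep]
    split <;> exact key _ _ rfl
  | deliver =>
    simp only [hybridStep, fixedStep]
    split <;> exact key _ _ rfl
  | send m =>
    simp only [hybridStep, fixedStep]
    split <;> exact key _ _ rfl

/-- The coins of `B` can be tossed before the interaction. -/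
theorem play_hybrid {π : Protocol ℓ τ ψ} {𝓛 : Set (Leakage τ)} {c : Corr}
    (E : Env (AdvCmd 𝓛 π.Msg ℓ τ) (Obs π.Msg ℓ τ ψ)) (n : ℕ)
    (h : List (AdvCmd 𝓛 π.Msg ℓ τ × Obs π.Msg ℓ τ ψ)) (s : HybridState π) :
    E.play (hybrid π 𝓛 c) n h s =
      (coinsOf s).bind fun r => E.play (fixedHybrid π 𝓛 c r) n h s := by
  induction n generalizing h s with
  | zero => exact (PMF.bind_const _ _).symm
  | succ n ih =>
    show ((E.ask h).bind fun i => (hybridStep π 𝓛 c s i).bind fun o =>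
        E.play (hybrid π 𝓛 c) n (h ++ [(i, o.2)]) o.1) =
      (coinsOf s).bind fun r => (E.ask h).bind fun i => (fixedStep π 𝓛 c r s i).bind fun o =>
        E.play (fixedHybrid π 𝓛 c r) n (h ++ [(i, o.2)]) o.1
    rw [PMF.bind_comm]
    congr 1
    funext i
    simp only [ih]
    exact bind_coinsOf s i fun r o => E.play (fixedHybrid π 𝓛 c r) n (h ++ [(i, o.2)]) o.1

/-! ### The hybrid model as a run on top of a key box -/

/-- The share of `A` that is chosen. -/
def AlicePhase.share : AlicePhase ℓ τ → Option (AShare ℓ τ)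
  | AlicePhase.chosen a _ _ => some a
  | _ => none

/-- The state of the hybrid model that is represented by a run with corrupted `A`. -/
def AliceState.toHybrid (A : Fin ψ × Fin τ → Bit) (s : AliceState ℓ τ (Fin τ → Bit)) :
    HybridState (compress ℓ τ ψ) where
  box :=
    { key := some s.key
      shareA := s.phase.share
      shareB := s.phase.share.map (toBShare s.key)
      leakUsed := match s.phase with
        | AlicePhase.failed => true
        | _ => s.leaked.isSome
      failed := match s.phase with
        | AlicePhase.failed => true
        | _ => false
      releasedB := match s.phase with
        | AlicePhase.chosen _ sent _ => sent
        | _ => false }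
  bob := match s.phase with
    | AlicePhase.chosen a true _ => some (A, toBShare s.key a)
    | _ => none
  channel := match s.phase with
    | AlicePhase.chosen _ true _ => some A
    | _ => none
  doneB := match s.phase with
    | AlicePhase.chosen _ _ d => d
    | _ => false

/-- The protocol with corrupted `A` and fixed matrix is a run on top of `realKey` that never stops.
-/
theorem fixedStep_toHybrid {𝓛 : Set (Leakage τ)} (A : Fin ψ × Fin τ → Bit)
    (s : AliceState ℓ τ (Fin τ → Bit)) (q : AdvCmd 𝓛 (Fin ψ × Fin τ) ℓ τ) :
    (fixedStep (compress ℓ τ ψ) 𝓛 Corr.alice A (s.toHybrid A) q).map some =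
      (aliceStep 𝓛 A (fun _ => True) (realKey A) s q).map
        (Option.map fun r => (AliceState.toHybrid A r.1, r.2)) := by
  obtain ⟨lk, ph, Γ⟩ := s
  cases q with
  | box q =>
    cases q with
    | query G =>
      rcases ph with _ | _ | ⟨a, _ | _, d⟩ <;>
        simp [fixedStep, waStep, aliceStep, aliceRun, AliceState.toHybrid, realKey,
          PMF.pure_map] <;> rfl
    | leak L =>
      rcases ph with _ | _ | ⟨a, _ | _, d⟩ <;> rcases lk with _ | S
      · simp only [fixedStep, waStep, aliceStep, aliceRun, AliceState.toHybrid, realKey,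
          PMF.map_bind, AlicePhase.share]
        simp only [Option.isSome_none, Bool.false_eq_true, if_false, Option.map_none, and_self,
          if_true, PMF.bind_map, PMF.map_bind]
        congr 1
        funext p
        by_cases hp : p.2 = true <;> simp [hp, PMF.pure_map] <;> rfl
      all_goals
        simp [fixedStep, waStep, aliceStep, aliceRun, AliceState.toHybrid, PMF.pure_map,
          AlicePhase.share]
        rfl
    | chooseA a =>
      rcases ph with _ | _ | ⟨a, _ | _, d⟩ <;>
        simp [fixedStep, waStep, aliceStep, aliceRun, AliceState.toHybrid, PMF.pure_map,
          AlicePhase.share] <;> rfl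
    | chooseB b =>
      rcases ph with _ | _ | ⟨a, _ | _, d⟩ <;>
        simp [fixedStep, waStep, aliceStep, aliceRun, AliceState.toHybrid, PMF.pure_map,
          AlicePhase.share] <;> rfl
    | releaseA =>
      rcases ph with _ | _ | ⟨a, _ | _, d⟩ <;>
        simp [fixedStep, waStep, aliceStep, aliceRun, AliceState.toHybrid, PMF.pure_map,
          AlicePhase.share] <;> rfl
    | releaseB =>
      rcases ph with _ | _ | ⟨a, _ | _, d⟩ <;>
        simp [fixedStep, waStep, aliceStep, aliceRun, AliceState.toHybrid, PMF.pure_map,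
          AlicePhase.share] <;> rfl
  | wakeA =>
    simp [fixedStep, hybridStep, aliceStep, aliceRun, AliceState.toHybrid, PMF.pure_map]
    rfl
  | wakeB =>
    rcases ph with _ | _ | ⟨a, _ | _, _ | _⟩
    case chosen.true.false =>
      have h : (compress ℓ τ ψ).outB A (toBShare Γ a) = _ := pressB_toBShare A Γ a
      simp only [fixedStep, hybridStep, AliceState.toHybrid, h]
      simp [aliceStep, aliceRun, PMF.pure_map, realKey]
      rfl
    all_goals
      simp [fixedStep, hybridStep, aliceStep, aliceRun, AliceState.toHybrid, PMF.pure_map]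
      rfl
  | deliver =>
    simp [fixedStep, hybridStep, aliceStep, aliceRun, AliceState.toHybrid, PMF.pure_map]
    rfl
  | send m =>
    simp [fixedStep, hybridStep, aliceStep, aliceRun, AliceState.toHybrid, PMF.pure_map]
    rfl

/-- The state of the hybrid model that is represented by a run without corruption in which the box
has chosen the bits `x` and the local keys `k`. -/
def HonestState.toHybrid (A : Fin ψ × Fin τ → Bit) (x : Fin ℓ → Bit) (k : Fin ℓ → Fin τ → Bit)
    (s : HonestState (Fin τ → Bit)) : HybridState (compress ℓ τ ψ) where
  box :=
    { key := some s.key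
      shareA := some (toAShare x (bShare s.key k))
      shareB := some (bShare s.key k)
      releasedA := s.gotA
      releasedB := match s.msg with
        | MsgStatus.unsent => false
        | _ => true }
  bob := match s.msg with
    | MsgStatus.unsent => none
    | _ => some (A, bShare s.key k)
  channel := match s.msg with
    | MsgStatus.transit => some A
    | _ => none
  alice := if s.gotA = true then some (toAShare x (bShare s.key k)) else none
  received := match s.msg with
    | MsgStatus.delivered => some A
    | _ => none
  doneA := s.doneA
  doneB := s.doneB

/-- The protocol without corruption and with fixed matrix is a run on top of `realKey`. -/
theorem fixedStep_honest {𝓛 : Set (Leakage τ)} (A : Fin ψ × Fin τ → Bit) (x : Fin ℓ → Bit)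
    (k : Fin ℓ → Fin τ → Bit) (s : HonestState (Fin τ → Bit))
    (q : AdvCmd 𝓛 (Fin ψ × Fin τ) ℓ τ) :
    (fixedStep (compress ℓ τ ψ) 𝓛 Corr.none A (s.toHybrid A x k) q).map some =
      (honestStep 𝓛 A x (fun i => press A (k i)) (realKey A) s q).map
        (Option.map fun r => (HonestState.toHybrid A x k r.1, r.2)) := by
  obtain ⟨gA, m, dA, dB, Γ⟩ := s
  cases q with
  | box q =>
    cases q with
    | query G =>
      simp [fixedStep, waStep, honestStep, HonestState.toHybrid, realKey, PMF.pure_map]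
      rfl
    | leak L =>
      simp [fixedStep, waStep, honestStep, HonestState.toHybrid, PMF.pure_map]
      rfl
    | chooseA a =>
      simp [fixedStep, waStep, honestStep, HonestState.toHybrid, PMF.pure_map]
      rfl
    | chooseB b =>
      simp [fixedStep, waStep, honestStep, HonestState.toHybrid, PMF.pure_map]
      rfl
    | releaseA =>
      cases gA <;>
        simp [fixedStep, waStep, honestStep, HonestState.toHybrid, PMF.pure_map] <;> rfl
    | releaseB =>
      cases m <;>
        simp [fixedStep, waStep, honestStep, HonestState.toHybrid, PMF.pure_map] <;> rfl
  | wakeA =>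
    have h : (compress ℓ τ ψ).outA (toAShare x (bShare Γ k)) A =
        toAShare x (bShare (press A Γ) fun i => press A (k i)) :=
      (pressA_toAShare A x (bShare Γ k)).trans (by rw [pressB_bShare])
    cases gA <;> cases m <;> cases dA <;>
      simp [fixedStep, hybridStep, honestStep, HonestState.toHybrid, PMF.pure_map, h, realKey]
        <;> rfl
  | wakeB =>
    have h : (compress ℓ τ ψ).outB A (bShare Γ k) =
      bShare (press A Γ) fun i => press A (k i) := pressB_bShare A Γ k
    cases m <;> cases dB <;>
      simp [fixedStep, hybridStep, honestStep, HonestState.toHybrid, PMF.pure_map, h, realKey]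
        <;> rfl
  | deliver =>
    cases m <;>
      simp [fixedStep, hybridStep, honestStep, HonestState.toHybrid, PMF.pure_map] <;> rfl
  | send m' =>
    simp [fixedStep, hybridStep, honestStep, HonestState.toHybrid, PMF.pure_map]
    rfl

end coins

/-! ### The probability that elimination fails -/

section loss

variable {ℓ τ ψ : ℕ}

open Classical in
/-- The probability that a uniform matrix does not have independent rows outside `S`. -/
def badProb (ψ : ℕ) (S : Finset (Fin τ)) : ℝ≥0∞ :=
  ∑' A : Fin ψ × Fin τ → Bit, PMF.uniformOfFintype _ A * if Good A S then 0 else 1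

/-- The probability that an undetected sample of the leakage function spoils the matrix. -/
def leakLoss (ψ : ℕ) (L : Leakage τ) : ℝ≥0∞ :=
  ∑' p, L p * if p.2 = true then badProb ψ p.1 else 0

/-- The protocol with corrupted `A` and the key of the box. -/
def realAlice (𝓛 : Set (Leakage τ)) (A : Fin ψ × Fin τ → Bit) (good : Finset (Fin τ) → Prop) :
    AliceState ℓ τ (Fin τ → Bit) → AdvCmd 𝓛 (Fin ψ × Fin τ) ℓ τ →
      PMF (Option (AliceState ℓ τ (Fin τ → Bit) × Obs (Fin ψ × Fin τ) ℓ τ ψ)) :=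
  aliceStep 𝓛 A good (realKey A)

open Classical in
theorem realAlice_leak {𝓛 : Set (Leakage τ)} {A : Fin ψ × Fin τ → Bit} (hA : Good A ∅)
    (Γ : Fin τ → Bit) (L : 𝓛) :
    realAlice (ℓ := ℓ) 𝓛 A (Good A) ⟨none, AlicePhase.waiting, Γ⟩ (AdvCmd.box (BoxCmd.leak L)) =
      L.1.bind fun p =>
        if p.2 = true then
          if Good A p.1 then
            PMF.pure (some (⟨some p.1, AlicePhase.waiting, Γ⟩,
              { resp := Resp.leaked (reveal p.1 Γ) }))
          else PMF.pure none
        else PMF.pure (some (⟨none, AlicePhase.failed, Γ⟩, { outB := some BOut.fail })) := by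
  refine Eq.trans (if_pos hA) ?_
  simp only [aliceRun, realKey, PMF.pure_map]

/-- A run in which no leakage function can be used any more. -/
def AliceState.Settled (s : AliceState ℓ τ (Fin τ → Bit)) : Prop :=
  s.phase = AlicePhase.waiting → s.leaked ≠ none

/-- A settled run proceeds deterministically, does not stop, and stays settled with the same leaked
set. -/
theorem aliceStep_settled {𝓛 : Set (Leakage τ)} {A : Fin ψ × Fin τ → Bit}
    {s : AliceState ℓ τ (Fin τ → Bit)} (hs : s.Settled) (hA : Good A s.leakSet)
    (q : AdvCmd 𝓛 (Fin ψ × Fin τ) ℓ τ) :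
    ∃ (s' : AliceState ℓ τ (Fin τ → Bit)) (o : _),
      realAlice 𝓛 A (Good A) s q = PMF.pure (some (s', o)) ∧
      s'.Settled ∧ s'.leakSet = s.leakSet := by
  obtain ⟨lk, ph, Γ⟩ := s
  rw [show realAlice 𝓛 A (Good A) ⟨lk, ph, Γ⟩ q =
      aliceRun 𝓛 A (Good A) (realKey A) ⟨lk, ph, Γ⟩ q from if_pos hA]
  have stay : ∀ (ph' : AlicePhase ℓ τ) (o : Obs (Fin ψ × Fin τ) ℓ τ ψ),
      (ph' = AlicePhase.waiting → lk ≠ none) →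
      ∃ (s' : AliceState ℓ τ (Fin τ → Bit)) (o' : _),
        (PMF.pure (some ((⟨lk, ph', Γ⟩ : AliceState ℓ τ (Fin τ → Bit)), o)) : PMF _) =
          PMF.pure (some (s', o')) ∧
        s'.Settled ∧ s'.leakSet = lk.getD ∅ :=
    fun ph' o h => ⟨_, _, rfl, h, rfl⟩
  have query : ∀ G, ∃ (s' : AliceState ℓ τ (Fin τ → Bit)) (o' : Obs (Fin ψ × Fin τ) ℓ τ ψ),
      (((realKey A).query (lk.getD ∅) Γ G).map fun r =>
        some ((⟨lk, ph, r.1⟩ : AliceState ℓ τ (Fin τ → Bit)),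
          ({ resp := Resp.answer r.2 } : Obs (Fin ψ × Fin τ) ℓ τ ψ))) =
          PMF.pure (some (s', o')) ∧
        s'.Settled ∧ s'.leakSet = lk.getD ∅ :=
    fun G => ⟨_, _, PMF.pure_map _ _, hs, rfl⟩
  cases q with
  | box q =>
    cases q with
    | query G =>
      cases ph
      · exact query G
      · exact stay _ _ hs
      · exact query G
    | leak L =>
      cases ph <;> cases lk <;> first | exact absurd rfl (hs rfl) | exact stay _ _ hs
    | chooseA a =>
      cases ph
      · exact stay (AlicePhase.chosen a false false) _ (fun h => by simp at h)
      · exact stay _ _ hs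
      · exact stay _ _ hs
    | chooseB b => exact stay _ _ hs
    | releaseA => exact stay _ _ hs
    | releaseB =>
      rcases ph with _ | _ | ⟨a, _ | _, d⟩
      · exact stay _ _ hs
      · exact stay _ _ hs
      · exact stay (AlicePhase.chosen a true d) _ (fun h => by simp at h)
      · exact stay _ _ hs
  | wakeA => exact stay _ _ hs
  | wakeB =>
    rcases ph with _ | _ | ⟨a, _ | _, _ | _⟩
    case chosen.true.false => exact stay (AlicePhase.chosen a true true) _ (fun h => by simp at h)
    all_goals exact stay _ _ hs
  | deliver => exact stay _ _ hs
  | send m => exact stay _ _ hs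

theorem playStop_settled {𝓛 : Set (Leakage τ)} {A : Fin ψ × Fin τ → Bit}
    (E : Env (AdvCmd 𝓛 (Fin ψ × Fin τ) ℓ τ) (Obs (Fin ψ × Fin τ) ℓ τ ψ)) (n : ℕ)
    (h : List (AdvCmd 𝓛 (Fin ψ × Fin τ) ℓ τ × Obs (Fin ψ × Fin τ) ℓ τ ψ))
    {s : AliceState ℓ τ (Fin τ → Bit)} (hs : s.Settled) (hA : Good A s.leakSet) :
    playStop E (realAlice 𝓛 A (Good A)) n h s none = 0 := by
  induction n generalizing h s with
  | zero => simp [playStop, PMF.map_apply]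
  | succ n ih =>
    simp only [playStop, PMF.bind_apply _ _ none]
    refine ENNReal.tsum_eq_zero.2 fun i => ?_
    obtain ⟨s', o, h₁, h₂, h₃⟩ := aliceStep_settled hs hA i
    have : ((realAlice 𝓛 A (Good A) s i).bind fun r =>
        r.elim (PMF.pure none) fun r =>
          playStop E (realAlice 𝓛 A (Good A)) n (h ++ [(i, r.2)]) r.1) none = 0 := by
      rw [h₁, PMF.pure_bind]
      exact ih _ h₂ (h₃ ▸ hA)
    rw [← PMF.bind_apply, this, mul_zero]

open Classical in
/-- Before the leakage, nothing in the protocol with corrupted `A` depends on the matrix. So the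
leaked set is independent of the matrix. -/
theorem tsum_playStop_none_le {𝓛 : Set (Leakage τ)} {ε : ℝ≥0∞}
    (hε : ∀ L ∈ 𝓛, leakLoss ψ L ≤ ε)
    (E : Env (AdvCmd 𝓛 (Fin ψ × Fin τ) ℓ τ) (Obs (Fin ψ × Fin τ) ℓ τ ψ)) (n : ℕ)
    (h : List (AdvCmd 𝓛 (Fin ψ × Fin τ) ℓ τ × Obs (Fin ψ × Fin τ) ℓ τ ψ)) (Γ : Fin τ → Bit) :
    ∑' A : Fin ψ × Fin τ → Bit, PMF.uniformOfFintype _ A *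
      (if Good A ∅ then playStop E (realAlice 𝓛 A (Good A)) n h
        (⟨none, AlicePhase.waiting, Γ⟩ : AliceState ℓ τ (Fin τ → Bit)) none else 0) ≤ ε := by
  induction n generalizing h with
  | zero => simp [playStop, PMF.map_apply]
  | succ n ih =>
    set s : AliceState ℓ τ (Fin τ → Bit) := ⟨none, AlicePhase.waiting, Γ⟩ with hs
    set F : (Fin ψ × Fin τ → Bit) → AdvCmd 𝓛 (Fin ψ × Fin τ) ℓ τ → ℝ≥0∞ := fun A i =>
      ((realAlice 𝓛 A (Good A) s i).bind fun r => r.elim (PMF.pure none) fun r =>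
          playStop E (realAlice 𝓛 A (Good A)) n (h ++ [(i, r.2)]) r.1) none with hF
    suffices H : ∀ i, ∑' A : Fin ψ × Fin τ → Bit, PMF.uniformOfFintype _ A *
        (if Good A ∅ then F A i else 0) ≤ ε by
      calc _ = ∑' A : Fin ψ × Fin τ → Bit, ∑' i, E.ask h i * (PMF.uniformOfFintype _ A *
            (if Good A ∅ then F A i else 0)) := by
            refine tsum_congr fun A => ?_
            split_ifs
            · simp only [playStop]
              rw [PMF.bind_apply, ← ENNReal.tsum_mul_left]
              exact tsum_congr fun i => mul_left_comm _ _ _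
            · simp
        _ = ∑' i, E.ask h i * ∑' A : Fin ψ × Fin τ → Bit, (PMF.uniformOfFintype _ A *
            (if Good A ∅ then F A i else 0)) := by
            rw [ENNReal.tsum_comm]
            simp only [ENNReal.tsum_mul_left]
        _ ≤ ∑' i, E.ask h i * ε := ENNReal.tsum_le_tsum fun i => mul_le_mul_right (H i) _
        _ = ε := by rw [ENNReal.tsum_mul_right, PMF.tsum_coe, one_mul]
    intro i
    -- A command that has no effect and whose observation does not depend on the matrix.
    have stay : ∀ o : Obs (Fin ψ × Fin τ) ℓ τ ψ,
        (∀ A, Good A ∅ → realAlice 𝓛 A (Good A) s i = PMF.pure (some (s, o))) →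
        ∑' A : Fin ψ × Fin τ → Bit, PMF.uniformOfFintype _ A *
          (if Good A ∅ then F A i else 0) ≤ ε := by
      intro o ho
      refine le_trans (le_of_eq (tsum_congr fun A => ?_)) (ih (h ++ [(i, o)]))
      split_ifs with hA
      · simp only [hF, ho A hA, PMF.pure_bind]
        rfl
      · rfl
    cases i with
    | box q =>
      cases q with
      | query G =>
        exact stay { resp := Resp.answer (decide (G = Γ)) } fun A hA =>
          (if_pos hA).trans (PMF.pure_map _ _)
      | leak L =>
        refine le_trans ?_ (hε L.1 L.2)
        have hFA : ∀ A, (if Good A ∅ then F A (AdvCmd.box (BoxCmd.leak L)) else 0) ≤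
            ∑' p, L.1 p * if p.2 = true then (if Good A p.1 then 0 else 1) else 0 := by
          intro A
          split_ifs with hA
          swap
          · exact zero_le
          simp only [hF, hs, realAlice_leak hA]
          rw [PMF.bind_bind, PMF.bind_apply]
          refine ENNReal.tsum_le_tsum fun p => mul_le_mul_right ?_ _
          obtain ⟨S, _ | _⟩ := p
          · simp only [Bool.false_eq_true, if_false, PMF.pure_bind, Option.elim_some]
            rw [playStop_settled E n _ (s := ⟨none, AlicePhase.failed, Γ⟩)
              (fun h => by simp at h) hA]
          · by_cases hg : Good A S
            · simp only [hg, if_true, PMF.pure_bind, Option.elim_some]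
              rw [playStop_settled E n _ (s := ⟨some S, AlicePhase.waiting, Γ⟩)
                (fun _ => by simp) hg]
            · simp [hg]
        calc _ ≤ ∑' A : Fin ψ × Fin τ → Bit, PMF.uniformOfFintype _ A *
              ∑' p, L.1 p * (if p.2 = true then (if Good A p.1 then 0 else 1) else 0) :=
              ENNReal.tsum_le_tsum fun A => mul_le_mul_right (hFA A) _
          _ = ∑' A : Fin ψ × Fin τ → Bit, ∑' p, L.1 p * (PMF.uniformOfFintype _ A *
              (if p.2 = true then (if Good A p.1 then 0 else 1) else 0)) := by
              refine tsum_congr fun A => ?_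
              rw [← ENNReal.tsum_mul_left]
              exact tsum_congr fun i => mul_left_comm _ _ _
          _ = leakLoss ψ L.1 := by
              rw [ENNReal.tsum_comm]
              refine tsum_congr fun p => ?_
              rw [ENNReal.tsum_mul_left]
              by_cases hp : p.2 = true <;> simp [hp, badProb]
      | chooseA a =>
        -- From now on no leakage function can be used.
        refine le_trans (le_of_eq (ENNReal.tsum_eq_zero.2 fun A => ?_)) zero_le
        split_ifs with hA
        · have hc : realAlice 𝓛 A (Good A) s (AdvCmd.box (BoxCmd.chooseA a)) =
              PMF.pure (some (⟨none, AlicePhase.chosen a false false, Γ⟩, {})) := if_pos hA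
          simp only [hF, hc, PMF.pure_bind, Option.elim_some]
          rw [playStop_settled E n _ (s := ⟨none, AlicePhase.chosen a false false, Γ⟩)
            (fun h => by simp at h) hA, mul_zero]
        · exact mul_zero _
      | chooseB b => exact stay {} fun A hA => if_pos hA
      | releaseA => exact stay {} fun A hA => if_pos hA
      | releaseB => exact stay {} fun A hA => if_pos hA
    | wakeA => exact stay {} fun A hA => if_pos hA
    | wakeB => exact stay {} fun A hA => if_pos hA
    | deliver => exact stay {} fun A hA => if_pos hA
    | send m => exact stay {} fun A hA => if_pos hA

end loss

/-! ### The simulator for honest and for corrupted `A` -/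

/-- The one-bit memory cells of the simulator. The last two are set during an activation only. -/
inductive SimFlag : Type
  | leaked | failed | chosen | sent | got | delivered | leakEvent | sendEvent

/-- The memory of the simulator: flags, the leaked positions, the offset, and a query. -/
inductive SimMem (τ : ℕ) : Type
  | flag (f : SimFlag) : SimMem τ
  | set (j : Fin τ) : SimMem τ
  | off (j : Fin τ) : SimMem τ
  | qry (j : Fin τ) : SimMem τ

/-- The random tape of the simulator: the matrix and a vector. -/
abbrev SimTape (ψ τ : ℕ) : Type := (Fin ψ × Fin τ) ⊕ Fin τ

section sim

open Matrix

variable {ℓ τ ψ : ℕ}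

/-- The memory cells of the simulator as a sum type, which makes them a finite type. -/
def simMemEquiv : SimFlag ⊕ Fin τ ⊕ Fin τ ⊕ Fin τ ≃ SimMem τ where
  toFun := Sum.elim SimMem.flag (Sum.elim SimMem.set (Sum.elim SimMem.off SimMem.qry))
  invFun
    | SimMem.flag f => Sum.inl f
    | SimMem.set j => Sum.inr (Sum.inl j)
    | SimMem.off j => Sum.inr (Sum.inr (Sum.inl j))
    | SimMem.qry j => Sum.inr (Sum.inr (Sum.inr j))
  left_inv := by rintro (_ | _ | _ | _) <;> rfl
  right_inv := by rintro (_ | _ | _ | _) <;> rfl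

instance : Fintype SimFlag :=
  ⟨⟨[SimFlag.leaked, SimFlag.failed, SimFlag.chosen, SimFlag.sent, SimFlag.got, SimFlag.delivered,
    SimFlag.leakEvent, SimFlag.sendEvent], by simp⟩, fun k => by cases k <;> simp⟩

instance : Fintype (SimMem τ) := Fintype.ofEquiv _ simMemEquiv

theorem card_simMem : Fintype.card (SimMem τ) = 8 + 3 * τ := by
  rw [← Fintype.card_congr simMemEquiv]
  simp only [Fintype.card_sum, Fintype.card_fin]
  rw [show Fintype.card SimFlag = 8 from rfl]
  ring

instance : Fintype BoxKind :=
  ⟨⟨[BoxKind.query, BoxKind.leak, BoxKind.chooseA, BoxKind.chooseB, BoxKind.releaseA,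
    BoxKind.releaseB], by simp⟩, fun k => by cases k <;> simp⟩

/-- The wires of a share of `A` as a sum type. -/
def aWireEquiv (ℓ n : ℕ) : Fin ℓ ⊕ Fin ℓ × Fin n ≃ AWire ℓ n where
  toFun := Sum.elim AWire.bit fun p => AWire.mac p.1 p.2
  invFun
    | AWire.bit i => Sum.inl i
    | AWire.mac i j => Sum.inr (i, j)
  left_inv := by rintro (_ | _) <;> rfl
  right_inv := by rintro (_ | _) <;> rfl

/-- The wires of a share of `B` as a sum type. -/
def bWireEquiv (ℓ n : ℕ) : Fin n ⊕ Fin ℓ × Fin n ≃ BWire ℓ n where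
  toFun := Sum.elim BWire.glob fun p => BWire.loc p.1 p.2
  invFun
    | BWire.glob i => Sum.inl i
    | BWire.loc i j => Sum.inr (i, j)
  left_inv := by rintro (_ | _) <;> rfl
  right_inv := by rintro (_ | _) <;> rfl

instance (ℓ n : ℕ) : Fintype (AWire ℓ n) := Fintype.ofEquiv _ (aWireEquiv ℓ n)

instance (ℓ n : ℕ) : Fintype (BWire ℓ n) := Fintype.ofEquiv _ (bWireEquiv ℓ n)

theorem card_bWire (ℓ n : ℕ) : Fintype.card (BWire ℓ n) = n + ℓ * n := by
  rw [← Fintype.card_congr (bWireEquiv ℓ n)]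
  simp

/-- The wires of a call of the box as a sum type. -/
def boxWireEquiv (ℓ n : ℕ) :
    BoxKind ⊕ Fin n ⊕ Fin n ⊕ Unit ⊕ AWire ℓ n ⊕ BWire ℓ n ≃ BoxWire ℓ n where
  toFun := Sum.elim BoxWire.is (Sum.elim BoxWire.key (Sum.elim BoxWire.leakSet
    (Sum.elim (fun _ => BoxWire.undetected) (Sum.elim BoxWire.shareA BoxWire.shareB))))
  invFun
    | BoxWire.is k => Sum.inl k
    | BoxWire.key j => Sum.inr (Sum.inl j)
    | BoxWire.leakSet j => Sum.inr (Sum.inr (Sum.inl j))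
    | BoxWire.undetected => Sum.inr (Sum.inr (Sum.inr (Sum.inl ())))
    | BoxWire.shareA w => Sum.inr (Sum.inr (Sum.inr (Sum.inr (Sum.inl w))))
    | BoxWire.shareB w => Sum.inr (Sum.inr (Sum.inr (Sum.inr (Sum.inr w))))
  left_inv := by rintro (_ | _ | _ | _ | _ | _) <;> rfl
  right_inv := by rintro (_ | _ | _ | _ | _ | _) <;> rfl

instance (ℓ n : ℕ) : Fintype (BoxWire ℓ n) := Fintype.ofEquiv _ (boxWireEquiv ℓ n)

theorem card_boxWire_le {n : ℕ} (hn : ψ + ℓ + 1 ≤ n) :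
    Fintype.card (BoxWire ℓ ψ) ≤ 11 * n ^ 2 := by
  rw [← Fintype.card_congr (boxWireEquiv ℓ ψ)]
  simp only [Fintype.card_sum, Fintype.card_fin, Fintype.card_unit, card_bWire,
    ← Fintype.card_congr (aWireEquiv ℓ ψ), Fintype.card_prod]
  rw [show Fintype.card BoxKind = 6 from rfl]
  have h1 : ℓ * ψ ≤ n * n := Nat.mul_le_mul (by omega) (by omega)
  have h2 : n ≤ n ^ 2 := Nat.le_self_pow (by norm_num) n
  nlinarith

/-- The wires of a reply of the simulator as a sum type. -/
def replyWireEquiv (M : Type) (τ : ℕ) :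
    (Unit ⊕ Unit ⊕ Unit ⊕ Fin τ ⊕ Fin τ) ⊕ Unit ⊕ M ≃ ReplyWire M τ where
  toFun := Sum.elim (ReplyWire.resp ∘ Sum.elim (fun _ => RespWire.isAnswer)
    (Sum.elim (fun _ => RespWire.answer) (Sum.elim (fun _ => RespWire.isLeaked)
      (Sum.elim RespWire.leakSet RespWire.leakBit))))
    (Sum.elim (fun _ => ReplyWire.isSent) ReplyWire.sent)
  invFun
    | ReplyWire.resp RespWire.isAnswer => Sum.inl (Sum.inl ())
    | ReplyWire.resp RespWire.answer => Sum.inl (Sum.inr (Sum.inl ()))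
    | ReplyWire.resp RespWire.isLeaked => Sum.inl (Sum.inr (Sum.inr (Sum.inl ())))
    | ReplyWire.resp (RespWire.leakSet j) => Sum.inl (Sum.inr (Sum.inr (Sum.inr (Sum.inl j))))
    | ReplyWire.resp (RespWire.leakBit j) => Sum.inl (Sum.inr (Sum.inr (Sum.inr (Sum.inr j))))
    | ReplyWire.isSent => Sum.inr (Sum.inl ())
    | ReplyWire.sent m => Sum.inr (Sum.inr m)
  left_inv := by rintro ((_ | _ | _ | _ | _) | _ | _) <;> rfl
  right_inv := by rintro ((_ | _ | _ | _ | _) | _ | _) <;> rfl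

instance (M : Type) [Fintype M] (τ : ℕ) : Fintype (ReplyWire M τ) :=
  Fintype.ofEquiv _ (replyWireEquiv M τ)

theorem card_replyWire_le {n : ℕ} (hn : ψ + τ + 1 ≤ n) :
    Fintype.card (ReplyWire (Fin ψ × Fin τ) τ) ≤ 7 * n ^ 2 := by
  rw [← Fintype.card_congr (replyWireEquiv (Fin ψ × Fin τ) τ)]
  simp only [Fintype.card_sum, Fintype.card_fin, Fintype.card_unit, Fintype.card_prod]
  have h1 : ψ * τ ≤ n * n := Nat.mul_le_mul (by omega) (by omega)
  have h2 : n ≤ n ^ 2 := Nat.le_self_pow (by norm_num) n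
  nlinarith

/-- Whether `A` is corrupted, as a bit. -/
def aliceBit (c : Corr) : Bit := toBit (decide (c = Corr.alice))

/-- Whether a command is an admissible use of a leakage function. -/
def leakAllowed (c : Corr) (m : SimMem τ → Bit) (a : AdvWire (Fin ψ × Fin τ) ℓ τ → Bit) : Bit :=
  aliceBit c * a (AdvWire.box (BoxWire.is BoxKind.leak)) * (1 + m (SimMem.flag SimFlag.leaked)) *
    (1 + m (SimMem.flag SimFlag.failed)) * (1 + m (SimMem.flag SimFlag.chosen))

/-- Whether a command makes `B` send its message. -/
def sendNow (c : Corr) (m : SimMem τ → Bit) (a : AdvWire (Fin ψ × Fin τ) ℓ τ → Bit) : Bit :=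
  a (AdvWire.box (BoxWire.is BoxKind.releaseB)) *
    (m (SimMem.flag SimFlag.chosen) + (1 + aliceBit c)) * (1 + m (SimMem.flag SimFlag.sent))

/-- The memory of the simulator after it has received a command. -/
def preMem (c : Corr) (m : SimMem τ → Bit) (a : AdvWire (Fin ψ × Fin τ) ℓ τ → Bit) :
    SimMem τ → Bit
  | SimMem.flag SimFlag.leaked => m (SimMem.flag SimFlag.leaked) +
      leakAllowed c m a * a (AdvWire.box BoxWire.undetected)
  | SimMem.flag SimFlag.failed => m (SimMem.flag SimFlag.failed) +
      leakAllowed c m a * (1 + a (AdvWire.box BoxWire.undetected))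
  | SimMem.flag SimFlag.chosen => m (SimMem.flag SimFlag.chosen) +
      aliceBit c * a (AdvWire.box (BoxWire.is BoxKind.chooseA)) *
        (1 + m (SimMem.flag SimFlag.chosen)) * (1 + m (SimMem.flag SimFlag.failed))
  | SimMem.flag SimFlag.sent => m (SimMem.flag SimFlag.sent) + sendNow c m a
  | SimMem.flag SimFlag.got => m (SimMem.flag SimFlag.got) +
      (1 + aliceBit c) * a (AdvWire.box (BoxWire.is BoxKind.releaseA)) *
        (1 + m (SimMem.flag SimFlag.got))
  | SimMem.flag SimFlag.delivered => m (SimMem.flag SimFlag.delivered) +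
      (1 + aliceBit c) * a AdvWire.isDeliver * m (SimMem.flag SimFlag.sent) *
        (1 + m (SimMem.flag SimFlag.delivered))
  | SimMem.flag SimFlag.leakEvent => leakAllowed c m a * a (AdvWire.box BoxWire.undetected)
  | SimMem.flag SimFlag.sendEvent => sendNow c m a
  | SimMem.set j => m (SimMem.set j) + leakAllowed c m a * a (AdvWire.box BoxWire.undetected) *
      a (AdvWire.box (BoxWire.leakSet j))
  | SimMem.off j => m (SimMem.off j)
  | SimMem.qry j => a (AdvWire.box (BoxWire.is BoxKind.query)) * a (AdvWire.box (BoxWire.key j))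

/-- The call of the ideal box by the simulator. -/
def preBox (c : Corr) (A : Fin ψ × Fin τ → Bit) (m : SimMem τ → Bit)
    (a : AdvWire (Fin ψ × Fin τ) ℓ τ → Bit) : BoxWire ℓ ψ → Bit
  | BoxWire.is BoxKind.query => a (AdvWire.box (BoxWire.is BoxKind.query))
  | BoxWire.is BoxKind.leak => leakAllowed c m a * (1 + a (AdvWire.box BoxWire.undetected))
  | BoxWire.is BoxKind.chooseA => a (AdvWire.box (BoxWire.is BoxKind.chooseA))
  | BoxWire.is BoxKind.chooseB => 0
  | BoxWire.is BoxKind.releaseA => a AdvWire.isWakeA * m (SimMem.flag SimFlag.got) *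
      m (SimMem.flag SimFlag.delivered)
  | BoxWire.is BoxKind.releaseB => a AdvWire.isWakeB * m (SimMem.flag SimFlag.sent)
  | BoxWire.key i => press A (fun j => a (AdvWire.box (BoxWire.key j))) i
  | BoxWire.shareA (AWire.bit i) => a (AdvWire.box (BoxWire.shareA (AWire.bit i)))
  | BoxWire.shareA (AWire.mac i j) =>
      press A (fun k => a (AdvWire.box (BoxWire.shareA (AWire.mac i k)))) j
  | _ => 0

/-- The offset after a response of the ideal box. -/
def postOff (A : Fin ψ × Fin τ → Bit) (g : Fin τ → Bit) (m : SimMem τ → Bit)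
    (r : RespWire ψ → Bit) (j : Fin τ) : Bit :=
  m (SimMem.off j) + r RespWire.answer *
    (inversePart (elimResult A fun j => m (SimMem.set j)) *ᵥ
      press A (fun j => m (SimMem.qry j) + (g j + m (SimMem.off j)))) j

/-- The memory of the simulator after a response of the ideal box. -/
def postMem (A : Fin ψ × Fin τ → Bit) (g : Fin τ → Bit) (m : SimMem τ → Bit)
    (r : RespWire ψ → Bit) : SimMem τ → Bit
  | SimMem.flag SimFlag.leakEvent => 0
  | SimMem.flag SimFlag.sendEvent => 0
  | SimMem.off j => postOff A g m r j
  | SimMem.qry _ => 0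
  | w => m w

/-- The reply of the simulator to the environment. -/
def postReply (A : Fin ψ × Fin τ → Bit) (g : Fin τ → Bit) (m : SimMem τ → Bit)
    (r : RespWire ψ → Bit) : ReplyWire (Fin ψ × Fin τ) τ → Bit
  | ReplyWire.resp RespWire.isAnswer => r RespWire.isAnswer
  | ReplyWire.resp RespWire.answer => r RespWire.answer *
      ∏ j, (1 + (m (SimMem.qry j) + (g j + postOff A g m r j)))
  | ReplyWire.resp RespWire.isLeaked => m (SimMem.flag SimFlag.leakEvent)
  | ReplyWire.resp (RespWire.leakSet j) => m (SimMem.set j)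
  | ReplyWire.resp (RespWire.leakBit j) => g j + m (SimMem.off j)
  | ReplyWire.isSent => m (SimMem.flag SimFlag.sendEvent)
  | ReplyWire.sent w => A w

theorem ComputesBit.const {ι : Type} (b : Bit) : ComputesBit (fun _ : ι → Bit => b) 1 := by
  by_cases h : b = 0
  · subst h; exact ComputesBit.zero
  · rw [bit_eq_one_of_ne_zero h]; exact ComputesBit.one

/-- The circuit of the simulator for the command of the environment. -/
theorem computes_pre (c : Corr) {n : ℕ} (hn : ψ + τ + ℓ + 1 ≤ n) :
    Computes (fun x : SimTape ψ τ ⊕ SimMem τ ⊕ AdvWire (Fin ψ × Fin τ) ℓ τ → Bit =>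
      Sum.elim
        (preMem c (fun w => x (Sum.inr (Sum.inl w))) fun w => x (Sum.inr (Sum.inr w)))
        (preBox (ℓ := ℓ) c (fun w => x (Sum.inl (Sum.inl w))) (fun w => x (Sum.inr (Sum.inl w)))
          fun w => x (Sum.inr (Sum.inr w)))) (500 * n ^ 3) := by
  have i {ι : Type} (w : ι) := ComputesBit.input w
  have k {ι : Type} (b : Bit) := ComputesBit.const (ι := ι) b
  have hleak : ComputesBit (fun x : SimTape ψ τ ⊕ SimMem τ ⊕ AdvWire (Fin ψ × Fin τ) ℓ τ → Bit =>
      leakAllowed c (fun w => x (Sum.inr (Sum.inl w))) fun w => x (Sum.inr (Sum.inr w))) 11 :=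
    (((((k _).mul (i _)).mul ((k 1).add (i _))).mul ((k 1).add (i _))).mul
      ((k 1).add (i _))).mono (by norm_num)
  have hsend : ComputesBit (fun x : SimTape ψ τ ⊕ SimMem τ ⊕ AdvWire (Fin ψ × Fin τ) ℓ τ → Bit =>
      sendNow c (fun w => x (Sum.inr (Sum.inl w))) fun w => x (Sum.inr (Sum.inr w))) 11 :=
    (((i _).mul ((i _).add ((k 1).add (k _)))).mul ((k 1).add (i _))).mono (by norm_num)
  have hn1 : 1 ≤ n := by omega
  have hm : Computes (fun x : SimTape ψ τ ⊕ SimMem τ ⊕ AdvWire (Fin ψ × Fin τ) ℓ τ → Bit =>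
      preMem c (fun w => x (Sum.inr (Sum.inl w))) fun w => x (Sum.inr (Sum.inr w)))
      (Fintype.card (SimMem τ) * 30) := by
    refine Computes.of_bits_const ?_
    rintro (f | j | j | j)
    · cases f
      · exact ((i _).add (hleak.mul (i _))).mono (by norm_num)
      · exact ((i _).add (hleak.mul ((k 1).add (i _)))).mono (by norm_num)
      · exact ((i _).add ((((k _).mul (i _)).mul ((k 1).add (i _))).mul
          ((k 1).add (i _)))).mono (by norm_num)
      · exact ((i _).add hsend).mono (by norm_num)
      · exact ((i _).add ((((k 1).add (k _)).mul (i _)).mul ((k 1).add (i _)))).mono (by norm_num)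
      · exact ((i _).add (((((k 1).add (k _)).mul (i _)).mul (i _)).mul
          ((k 1).add (i _)))).mono (by norm_num)
      · exact (hleak.mul (i _)).mono (by norm_num)
      · exact hsend.mono (by norm_num)
    · exact ((i _).add ((hleak.mul (i _)).mul (i _))).mono (by norm_num)
    · exact (i _).mono (by norm_num)
    · exact ((i _).mul (i _)).mono (by norm_num)
  have hb : Computes (fun x : SimTape ψ τ ⊕ SimMem τ ⊕ AdvWire (Fin ψ × Fin τ) ℓ τ → Bit =>
      preBox (ℓ := ℓ) c (fun w => x (Sum.inl (Sum.inl w))) (fun w => x (Sum.inr (Sum.inl w)))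
          fun w => x (Sum.inr (Sum.inr w))) (Fintype.card (BoxWire ℓ ψ) * (15 * n)) := by
    have hp : τ * (0 + 0 + 2) + 1 ≤ 15 * n := by omega
    refine Computes.of_bits_const ?_
    rintro (_ | _ | _ | _ | (_ | _) | _)
    · next b =>
      cases b
      · exact (i _).mono (by omega)
      · exact (hleak.mul ((k 1).add (i _))).mono (by omega)
      · exact (i _).mono (by omega)
      · exact (k 0).mono (by omega)
      · exact (((i _).mul (i _)).mul (i _)).mono (by omega)
      · exact ((i _).mul (i _)).mono (by omega)
    · exact (ComputesBit.dotProduct (fun _ => i _) (fun _ => i _)).mono hp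
    · exact (k 0).mono (by omega)
    · exact (k 0).mono (by omega)
    · exact (i _).mono (by omega)
    · exact (ComputesBit.dotProduct (fun _ => i _) (fun _ => i _)).mono hp
    · exact (k 0).mono (by omega)
  refine (hm.elim hb).mono ?_
  rw [card_simMem]
  have h1 := Nat.mul_le_mul_right (15 * n) (card_boxWire_le (ψ := ψ) (ℓ := ℓ) (n := n) (by omega))
  have h2 : n ≤ n ^ 3 := Nat.le_self_pow (by norm_num) n
  have h3 : 11 * n ^ 2 * (15 * n) = 165 * n ^ 3 := by ring
  omega

/-- The circuit of the simulator for the response of the ideal box. -/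
theorem computes_post {n : ℕ} (hn : ψ + τ + ℓ + 1 ≤ n) :
    Computes (fun x : SimTape ψ τ ⊕ SimMem τ ⊕ RespWire ψ → Bit =>
      Sum.elim
        (postMem (fun w => x (Sum.inl (Sum.inl w))) (fun j => x (Sum.inl (Sum.inr j)))
          (fun w => x (Sum.inr (Sum.inl w))) fun w => x (Sum.inr (Sum.inr w)))
        (postReply (fun w => x (Sum.inl (Sum.inl w))) (fun j => x (Sum.inl (Sum.inr j)))
          (fun w => x (Sum.inr (Sum.inl w))) fun w => x (Sum.inr (Sum.inr w))))
      (900 * n ^ 6) := by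
  -- First the elimination is carried out, then everything else is computed from its result.
  let ρ := SimTape ψ τ ⊕ SimMem τ ⊕ RespWire ψ
  have helim : Computes (fun x : ρ → Bit => Sum.elim x
      (elimResult (fun w => x (Sum.inl (Sum.inl w))) fun j => x (Sum.inr (Sum.inl (SimMem.set j)))))
      (0 + 22 * n ^ 6) :=
    (Computes.wires (id : ρ → ρ)).elim
      ((Computes.elimResult (by omega : τ + ψ + 1 ≤ n)).comap (Sum.elim
        (fun w => (Sum.inl (Sum.inl w) : ρ)) fun j => Sum.inr (Sum.inl (SimMem.set j))))
  have i (w : ρ ⊕ ElimCell τ ψ) := ComputesBit.input w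
  have k (b : Bit) := ComputesBit.const (ι := ρ ⊕ ElimCell τ ψ) b
  let off : (ρ ⊕ ElimCell τ ψ → Bit) → Fin τ → Bit := fun x j =>
    x (Sum.inl (Sum.inr (Sum.inl (SimMem.off j)))) +
      x (Sum.inl (Sum.inr (Sum.inr RespWire.answer))) *
      (inversePart (fun w => x (Sum.inr w)) *ᵥ
        press (fun w => x (Sum.inl (Sum.inl (Sum.inl w))))
          (fun j => x (Sum.inl (Sum.inr (Sum.inl (SimMem.qry j)))) +
            (x (Sum.inl (Sum.inl (Sum.inr j))) +
              x (Sum.inl (Sum.inr (Sum.inl (SimMem.off j))))))) j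
  have hoff : ∀ j, ComputesBit (fun x => off x j)
      (0 + (0 + (ψ * (0 + (τ * (0 + (0 + (0 + 0 + 1) + 1) + 2) + 1) + 2) + 1) + 1) + 1) := fun j =>
    (i _).add ((i _).mul (ComputesBit.dotProduct (fun _ => i _) fun _ =>
      ComputesBit.dotProduct (fun _ => i _) fun _ => (i _).add ((i _).add (i _))))
  have hn1 : 1 ≤ n := by omega
  have hc : 0 + (0 + (ψ * (0 + (τ * (0 + (0 + (0 + 0 + 1) + 1) + 2) + 1) + 2) + 1) + 1) + 1
      ≤ 10 * n ^ 2 := by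
    have h1 : ψ * τ ≤ n * n := Nat.mul_le_mul (by omega) (by omega)
    have h2 : n ≤ n ^ 2 := Nat.le_self_pow (by norm_num) n
    nlinarith
  replace hoff := fun j => (hoff j).mono hc
  have hmem : Computes (fun x : ρ ⊕ ElimCell τ ψ → Bit => fun w : SimMem τ =>
      match w with
      | SimMem.flag SimFlag.leakEvent => 0
      | SimMem.flag SimFlag.sendEvent => 0
      | SimMem.off j => off x j
      | SimMem.qry _ => 0
      | w => x (Sum.inl (Sum.inr (Sum.inl w)))) (Fintype.card (SimMem τ) * (10 * n ^ 2)) := by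
    have hpos : 1 ≤ 10 * n ^ 2 := by nlinarith
    refine Computes.of_bits_const ?_
    rintro (f | j | j | j)
    · cases f
      case leakEvent => exact (k 0).mono hpos
      case sendEvent => exact (k 0).mono hpos
      all_goals exact (i _).mono (Nat.zero_le _)
    · exact (i _).mono (Nat.zero_le _)
    · exact hoff j
    · exact (k 0).mono hpos
  have hreply : Computes (fun x : ρ ⊕ ElimCell τ ψ → Bit => fun w : ReplyWire (Fin ψ × Fin τ) τ =>
      match w with
      | ReplyWire.resp RespWire.isAnswer => x (Sum.inl (Sum.inr (Sum.inr RespWire.isAnswer)))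
      | ReplyWire.resp RespWire.answer => x (Sum.inl (Sum.inr (Sum.inr RespWire.answer))) *
          ∏ j, (1 + (x (Sum.inl (Sum.inr (Sum.inl (SimMem.qry j)))) +
            (x (Sum.inl (Sum.inl (Sum.inr j))) + off x j)))
      | ReplyWire.resp RespWire.isLeaked =>
          x (Sum.inl (Sum.inr (Sum.inl (SimMem.flag SimFlag.leakEvent))))
      | ReplyWire.resp (RespWire.leakSet j) => x (Sum.inl (Sum.inr (Sum.inl (SimMem.set j))))
      | ReplyWire.resp (RespWire.leakBit j) => x (Sum.inl (Sum.inl (Sum.inr j))) +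
          x (Sum.inl (Sum.inr (Sum.inl (SimMem.off j))))
      | ReplyWire.isSent => x (Sum.inl (Sum.inr (Sum.inl (SimMem.flag SimFlag.sendEvent))))
      | ReplyWire.sent w => x (Sum.inl (Sum.inl (Sum.inl w))))
      (Fintype.card (ReplyWire (Fin ψ × Fin τ) τ) * (20 * n ^ 3)) := by
    refine Computes.of_bits_const ?_
    rintro ((_ | _ | _ | _ | _) | _ | _)
    case resp.answer =>
      refine ((i _).mul (ComputesBit.prod fun j =>
        (k 1).add ((i _).add ((i _).add (hoff j))))).mono ?_
      rw [Fintype.card_fin]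
      have h1 : τ * (1 + (0 + (0 + 10 * n ^ 2 + 1) + 1) + 1 + 1) ≤
        n * (1 + (0 + (0 + 10 * n ^ 2 + 1) + 1) + 1 + 1) := Nat.mul_le_mul_right _ (by omega)
      have h2 : n ≤ n ^ 3 := Nat.le_self_pow (by norm_num) n
      have h3 : n * (1 + (0 + (0 + 10 * n ^ 2 + 1) + 1) + 1 + 1) = 10 * n ^ 3 + 5 * n := by ring
      omega
    case resp.leakBit => exact ((i _).add (i _)).mono (by have := Nat.one_le_pow 3 n hn1; omega)
    all_goals exact (i _).mono (Nat.zero_le _)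
  have hall := (helim.comp (hmem.elim hreply)).mono (m := 900 * n ^ 6) ?_
  · convert hall using 2 with x
    congr 1
  · rw [card_simMem]
    have h1 := Nat.mul_le_mul_right (20 * n ^ 3)
      (card_replyWire_le (ψ := ψ) (τ := τ) (n := n) (by omega))
    have h2 : (8 + 3 * τ) * (10 * n ^ 2) ≤ (11 * n) * (10 * n ^ 2) :=
      Nat.mul_le_mul_right _ (by omega)
    have h3 : 11 * n * (10 * n ^ 2) = 110 * n ^ 3 := by ring
    have h4 : 7 * n ^ 2 * (20 * n ^ 3) = 140 * n ^ 5 := by ring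
    have h5 : n ^ 3 ≤ n ^ 6 := Nat.pow_le_pow_right hn1 (by norm_num)
    have h6 : n ^ 5 ≤ n ^ 6 := Nat.pow_le_pow_right hn1 (by norm_num)
    omega

end sim

/-! ### Activations of the simulator for honest and for corrupted `A` -/

section simRun

open Matrix

variable {ℓ τ ψ : ℕ}

/-- The simulator for honest and for corrupted `A`. -/
def keySim (c : Corr) (ℓ τ ψ : ℕ) : Simulator (Fin ψ × Fin τ) ℓ τ ψ where
  Tape := SimTape ψ τ
  Mem := SimMem τ
  pre := (computes_pre c (le_refl (ψ + τ + ℓ + 1))).exists_circuit.choose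
  post := (computes_post (le_refl (ψ + τ + ℓ + 1))).exists_circuit.choose

theorem keySim_cost_le (c : Corr) (ℓ τ ψ : ℕ) :
    (keySim c ℓ τ ψ).cost ≤ 1500 * (ψ + τ + ℓ + 1) ^ 6 := by
  have h1 := (computes_pre (ψ := ψ) (τ := τ) (ℓ := ℓ) c le_rfl).exists_circuit.choose_spec.1
  have h2 := (computes_post (ψ := ψ) (τ := τ) (ℓ := ℓ) le_rfl).exists_circuit.choose_spec.1
  have h3 : Fintype.card (keySim c ℓ τ ψ).Tape = ψ * τ + τ :=
    (Fintype.card_sum).trans (by simp)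
  have h4 : Fintype.card (keySim c ℓ τ ψ).Mem = 8 + 3 * τ := card_simMem
  rw [Simulator.cost, h3, h4]
  set n := ψ + τ + ℓ + 1 with hn
  have h5 : (keySim c ℓ τ ψ).pre.size ≤ 500 * n ^ 3 := h1
  have h6 : (keySim c ℓ τ ψ).post.size ≤ 900 * n ^ 6 := h2
  have hn1 : 1 ≤ n := by omega
  have h7 : ψ * τ ≤ n * n := Nat.mul_le_mul (by omega) (by omega)
  have h8 : n ^ 3 ≤ n ^ 6 := Nat.pow_le_pow_right hn1 (by norm_num)
  have h9 : n * n ≤ n ^ 6 := by rw [← sq]; exact Nat.pow_le_pow_right hn1 (by norm_num)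
  have h10 : n ≤ n ^ 6 := Nat.le_self_pow (by norm_num) n
  omega

/-- The memory with given contents. -/
def mkMem (leaked failed chosen sent got delivered leakEvent sendEvent : Bit)
    (S u q : Fin τ → Bit) : SimMem τ → Bit
  | SimMem.flag SimFlag.leaked => leaked
  | SimMem.flag SimFlag.failed => failed
  | SimMem.flag SimFlag.chosen => chosen
  | SimMem.flag SimFlag.sent => sent
  | SimMem.flag SimFlag.got => got
  | SimMem.flag SimFlag.delivered => delivered
  | SimMem.flag SimFlag.leakEvent => leakEvent
  | SimMem.flag SimFlag.sendEvent => sendEvent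
  | SimMem.set j => S j
  | SimMem.off j => u j
  | SimMem.qry j => q j

/-- An activation in the ideal world after the command of the environment has been turned into the
call `y` of the ideal box and the memory `m`. -/
def idealFinish (c : Corr) (A : Fin ψ × Fin τ → Bit) (g : Fin τ → Bit) (b : WaState ℓ ψ)
    (y : Option (BoxCmd (neverLeak ψ) ℓ ψ)) (m : SimMem τ → Bit) :
    PMF (IdealState (keySim c ℓ τ ψ) × Obs (Fin ψ × Fin τ) ℓ τ ψ) :=
  (callIdeal c b y).map fun r =>
    ({ box := r.1, tape := Sum.elim A g, mem := postMem A g m (encodeResp r.2.resp) },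
      { resp := decodeResp fun w => postReply A g m (encodeResp r.2.resp) (ReplyWire.resp w)
        sent := decodeSent (postReply A g m (encodeResp r.2.resp))
        outA := r.2.toA
        outB := r.2.toB })

/-- The circuits of the simulator compute `preMem`, `preBox`, `postMem` and `postReply`. -/
theorem idealStep_keySim {𝓛 : Set (Leakage τ)} (c : Corr) (A : Fin ψ × Fin τ → Bit)
    (g : Fin τ → Bit) (b : WaState ℓ ψ) (m : SimMem τ → Bit)
    (q : AdvCmd 𝓛 (Fin ψ × Fin τ) ℓ τ) :
    idealStep (keySim c ℓ τ ψ) 𝓛 c ⟨b, Sum.elim A g, m⟩ q =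
      (sampleLeak q).bind fun q' => idealFinish c A g b
        (decodeBox (preBox c A m (encodeAdv q'))) (preMem c m (encodeAdv q')) := by
  have h1 : ∀ x, (keySim c ℓ τ ψ).pre.run x = _ :=
    (computes_pre (ψ := ψ) (τ := τ) (ℓ := ℓ) c le_rfl).exists_circuit.choose_spec.2
  have h2 : ∀ x, (keySim c ℓ τ ψ).post.run x = _ :=
    (computes_post (ψ := ψ) (τ := τ) (ℓ := ℓ) le_rfl).exists_circuit.choose_spec.2
  unfold idealStep
  simp only [h1, h2]
  rfl

theorem bit_one_add_one : (1 : Bit) + 1 = 0 := rfl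

section decode

variable (c : Corr) (A : Fin ψ × Fin τ → Bit) (m : SimMem τ → Bit)

theorem decode_query (G : Fin τ → Bit) :
    decodeBox (preBox (ℓ := ℓ) c A m (encodeAdv (AdvCmd.box (BoxCmd.query G)))) =
      some (BoxCmd.query (press A G)) := by
  simp [decodeBox, preBox, encodeAdv, encodeBox]

/-- A leakage function is forwarded as a detected one if it is admissible and detected, and not at
all otherwise. -/
theorem decode_leak (p : Finset (Fin τ) × Bool) :
    decodeBox (preBox (ℓ := ℓ) c A m (encodeAdv (AdvCmd.box (BoxCmd.leak p)))) =
      if leakAllowed (ℓ := ℓ) (ψ := ψ) c m (encodeAdv (AdvCmd.box (BoxCmd.leak p))) *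
        (1 + toBit p.2) = 1 then some (BoxCmd.leak (noLeak ψ false)) else none := by
  simp [decodeBox, preBox, encodeAdv, encodeBox]

theorem decode_chooseA (a : AShare ℓ τ) :
    decodeBox (preBox (ℓ := ℓ) c A m (encodeAdv (AdvCmd.box (BoxCmd.chooseA a)))) =
      some (BoxCmd.chooseA (pressA A a)) := by
  have : (fun w => preBox (ℓ := ℓ) c A m (encodeAdv (AdvCmd.box (BoxCmd.chooseA a)))
      (BoxWire.shareA w)) = pressA A a := by
    funext w; cases w <;> rfl
  simp only [decodeBox, this]
  simp [preBox, encodeAdv, encodeBox, leakAllowed]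

theorem decode_chooseB (b : BShare ℓ τ) :
    decodeBox (preBox (ℓ := ℓ) c A m (encodeAdv (AdvCmd.box (BoxCmd.chooseB b)))) = none := by
  simp [decodeBox, preBox, encodeAdv, encodeBox, leakAllowed]

theorem decode_releaseA :
    decodeBox (preBox (ℓ := ℓ) c A m (encodeAdv (AdvCmd.box BoxCmd.releaseA))) = none := by
  simp [decodeBox, preBox, encodeAdv, encodeBox, leakAllowed]

theorem decode_releaseB :
    decodeBox (preBox (ℓ := ℓ) c A m (encodeAdv (AdvCmd.box BoxCmd.releaseB))) = none := by
  simp [decodeBox, preBox, encodeAdv, encodeBox, leakAllowed]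

theorem decode_wakeA :
    decodeBox (preBox (ℓ := ℓ) c A m (encodeAdv AdvCmd.wakeA)) =
      if m (SimMem.flag SimFlag.got) * m (SimMem.flag SimFlag.delivered) = 1
      then some BoxCmd.releaseA else none := by
  simp [decodeBox, preBox, encodeAdv, leakAllowed]

theorem decode_wakeB :
    decodeBox (preBox (ℓ := ℓ) c A m (encodeAdv AdvCmd.wakeB)) =
      if m (SimMem.flag SimFlag.sent) = 1 then some BoxCmd.releaseB else none := by
  simp [decodeBox, preBox, encodeAdv, leakAllowed]

theorem decode_deliver :
    decodeBox (preBox (ℓ := ℓ) c A m (encodeAdv AdvCmd.deliver)) = none := by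
  simp [decodeBox, preBox, encodeAdv, leakAllowed]

theorem decode_send (m' : Fin ψ × Fin τ → Bit) :
    decodeBox (preBox (ℓ := ℓ) c A m (encodeAdv (AdvCmd.send m'))) = none := by
  simp [decodeBox, preBox, encodeAdv, leakAllowed]

end decode

section memory

variable (c : Corr) (l f ch s g d : Bit) (S u : Fin τ → Bit)

theorem preMem_query (G : Fin τ → Bit) :
    preMem (ℓ := ℓ) (ψ := ψ) c (mkMem l f ch s g d 0 0 S u 0)
      (encodeAdv (AdvCmd.box (BoxCmd.query G))) = mkMem l f ch s g d 0 0 S u G := by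
  funext w
  rcases w with (_ | _ | _ | _ | _ | _ | _ | _) | _ | _ | _ <;>
    simp [preMem, mkMem, leakAllowed, sendNow, encodeAdv, encodeBox]

theorem preMem_leak (p : Finset (Fin τ) × Bool) :
    preMem (ℓ := ℓ) (ψ := ψ) c (mkMem l f ch s g d 0 0 S u 0)
      (encodeAdv (AdvCmd.box (BoxCmd.leak p))) =
      mkMem (l + aliceBit c * (1 + l) * (1 + f) * (1 + ch) * toBit p.2)
        (f + aliceBit c * (1 + l) * (1 + f) * (1 + ch) * (1 + toBit p.2)) ch s g d
        (aliceBit c * (1 + l) * (1 + f) * (1 + ch) * toBit p.2) 0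
        (fun j => S j + aliceBit c * (1 + l) * (1 + f) * (1 + ch) * toBit p.2 * indicator p.1 j)
        u 0 := by
  funext w
  rcases w with (_ | _ | _ | _ | _ | _ | _ | _) | _ | _ | _ <;>
    simp [preMem, mkMem, leakAllowed, sendNow, encodeAdv, encodeBox, indicator]

theorem preMem_chooseA (a : AShare ℓ τ) :
    preMem (ψ := ψ) c (mkMem l f ch s g d 0 0 S u 0)
      (encodeAdv (AdvCmd.box (BoxCmd.chooseA a))) =
      mkMem l f (ch + aliceBit c * (1 + ch) * (1 + f)) s g d 0 0 S u 0 := by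
  funext w
  rcases w with (_ | _ | _ | _ | _ | _ | _ | _) | _ | _ | _ <;>
    simp [preMem, mkMem, leakAllowed, sendNow, encodeAdv, encodeBox]

theorem preMem_chooseB (b : BShare ℓ τ) :
    preMem (ψ := ψ) c (mkMem l f ch s g d 0 0 S u 0)
      (encodeAdv (AdvCmd.box (BoxCmd.chooseB b))) = mkMem l f ch s g d 0 0 S u 0 := by
  funext w
  rcases w with (_ | _ | _ | _ | _ | _ | _ | _) | _ | _ | _ <;>
    simp [preMem, mkMem, leakAllowed, sendNow, encodeAdv, encodeBox]

theorem preMem_releaseA :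
    preMem (ℓ := ℓ) (ψ := ψ) c (mkMem l f ch s g d 0 0 S u 0)
      (encodeAdv (AdvCmd.box BoxCmd.releaseA)) =
      mkMem l f ch s (g + (1 + aliceBit c) * (1 + g)) d 0 0 S u 0 := by
  funext w
  rcases w with (_ | _ | _ | _ | _ | _ | _ | _) | _ | _ | _ <;>
    simp [preMem, mkMem, leakAllowed, sendNow, encodeAdv, encodeBox]

theorem preMem_releaseB :
    preMem (ℓ := ℓ) (ψ := ψ) c (mkMem l f ch s g d 0 0 S u 0)
      (encodeAdv (AdvCmd.box BoxCmd.releaseB)) =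
      mkMem l f ch (s + (ch + (1 + aliceBit c)) * (1 + s)) g d 0
        ((ch + (1 + aliceBit c)) * (1 + s)) S u 0 := by
  funext w
  rcases w with (_ | _ | _ | _ | _ | _ | _ | _) | _ | _ | _ <;>
    simp [preMem, mkMem, leakAllowed, sendNow, encodeAdv, encodeBox]

theorem preMem_wakeA :
    preMem (ℓ := ℓ) (ψ := ψ) c (mkMem l f ch s g d 0 0 S u 0) (encodeAdv AdvCmd.wakeA) =
      mkMem l f ch s g d 0 0 S u 0 := by
  funext w
  rcases w with (_ | _ | _ | _ | _ | _ | _ | _) | _ | _ | _ <;>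
    simp [preMem, mkMem, leakAllowed, sendNow, encodeAdv]

theorem preMem_wakeB :
    preMem (ℓ := ℓ) (ψ := ψ) c (mkMem l f ch s g d 0 0 S u 0) (encodeAdv AdvCmd.wakeB) =
      mkMem l f ch s g d 0 0 S u 0 := by
  funext w
  rcases w with (_ | _ | _ | _ | _ | _ | _ | _) | _ | _ | _ <;>
    simp [preMem, mkMem, leakAllowed, sendNow, encodeAdv]

theorem preMem_deliver :
    preMem (ℓ := ℓ) (ψ := ψ) c (mkMem l f ch s g d 0 0 S u 0) (encodeAdv AdvCmd.deliver) =
      mkMem l f ch s g (d + (1 + aliceBit c) * s * (1 + d)) 0 0 S u 0 := by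
  funext w
  rcases w with (_ | _ | _ | _ | _ | _ | _ | _) | _ | _ | _ <;>
    simp [preMem, mkMem, leakAllowed, sendNow, encodeAdv]

theorem preMem_send (m' : Fin ψ × Fin τ → Bit) :
    preMem (ℓ := ℓ) c (mkMem l f ch s g d 0 0 S u 0) (encodeAdv (AdvCmd.send m')) =
      mkMem l f ch s g d 0 0 S u 0 := by
  funext w
  rcases w with (_ | _ | _ | _ | _ | _ | _ | _) | _ | _ | _ <;>
    simp [preMem, mkMem, leakAllowed, sendNow, encodeAdv]

end memory

section finish

variable (c : Corr) (A : Fin ψ × Fin τ → Bit) (v : Fin τ → Bit) (l f ch s g d : Bit)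
  (S u q : Fin τ → Bit)

theorem postMem_quiet (e₁ e₂ : Bit) (r : RespWire ψ → Bit) (hr : r RespWire.answer = 0) :
    postMem A v (mkMem l f ch s g d e₁ e₂ S u q) r = mkMem l f ch s g d 0 0 S u 0 := by
  funext w
  rcases w with (_ | _ | _ | _ | _ | _ | _ | _) | _ | _ | _ <;>
    simp [postMem, postOff, mkMem, hr]

/-- An activation in which the ideal box gives no response to the simulator. -/
theorem idealFinish_quiet (b b' : WaState ℓ ψ) (y : Option (BoxCmd (neverLeak ψ) ℓ ψ))
    (oA : Option (AShare ℓ ψ)) (oB : Option (BOut ℓ ψ))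
    (h : callIdeal c b y = PMF.pure (b', { toA := oA, toB := oB })) :
    idealFinish c A v b y (mkMem l f ch s g d 0 0 S u q) =
      PMF.pure (⟨b', Sum.elim A v, mkMem l f ch s g d 0 0 S u 0⟩, { outA := oA, outB := oB }) := by
  rw [idealFinish, h, PMF.pure_map, postMem_quiet _ _ _ _ _ _ _ _ _ _ _ _ _ _ rfl]
  simp [decodeResp, decodeSent, postReply, mkMem, encodeResp]

/-- An activation in which the simulator sends the matrix. -/
theorem idealFinish_send (b : WaState ℓ ψ) :
    idealFinish c A v b none (mkMem l f ch s g d 0 1 S u q) =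
      PMF.pure (⟨b, Sum.elim A v, mkMem l f ch s g d 0 0 S u 0⟩, { sent := some A }) := by
  rw [idealFinish, callIdeal, PMF.pure_map, postMem_quiet _ _ _ _ _ _ _ _ _ _ _ _ _ _ rfl]
  simp [decodeResp, decodeSent, postReply, mkMem, encodeResp]

/-- An activation in which the simulator leaks bits of `v + u`. -/
theorem idealFinish_leak (b : WaState ℓ ψ) (T : Finset (Fin τ)) :
    idealFinish c A v b none (mkMem l f ch s g d 1 0 (indicator T) u q) =
      PMF.pure (⟨b, Sum.elim A v, mkMem l f ch s g d 0 0 (indicator T) u 0⟩,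
        { resp := Resp.leaked (reveal T (v + u)) }) := by
  rw [idealFinish, callIdeal, PMF.pure_map, postMem_quiet _ _ _ _ _ _ _ _ _ _ _ _ _ _ rfl]
  have : (fun j => if indicator T j = 1 then some (v j + u j) else none) = reveal T (v + u) := by
    funext j
    by_cases hj : j ∈ T <;> simp [reveal, indicator, toBit, hj]
  simp [decodeResp, decodeSent, postReply, mkMem, encodeResp, ← this]
  rfl

/-- The test of a vector for `0` by a product. -/
theorem prod_eq_one_iff (w : Fin τ → Bit) :
    (∏ j, (1 + w j)) = 1 ↔ w = 0 := by
  constructor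
  · intro h
    funext j
    by_contra hj
    have hj1 := bit_eq_one_of_ne_zero hj
    rw [Finset.prod_eq_zero (Finset.mem_univ j) (by rw [hj1]; rfl)] at h
    exact absurd h (by decide)
  · rintro rfl
    simp

theorem vec_add_eq_zero_iff {n : Type*} (x y : n → Bit) : x + y = 0 ↔ x = y := by
  constructor
  · intro h
    rw [← add_zero x, ← vec_add_self y, ← add_assoc, h, zero_add]
  · rintro rfl
    exact vec_add_self x

/-- An activation in which the simulator forwards a query. After a hit it moves the offset such
that the key is compressed to the right value. -/
theorem idealFinish_answer (b : WaState ℓ ψ) (y : Option (BoxCmd (neverLeak ψ) ℓ ψ)) (hit : Bool)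
    (T : Finset (Fin τ))
    (h : callIdeal c b y = PMF.pure (b, { resp := Resp.answer hit })) :
    idealFinish c A v b y (mkMem l f ch s g d 0 0 (indicator T) u q) =
      PMF.pure (if hit = true then
        (⟨b, Sum.elim A v, mkMem l f ch s g d 0 0 (indicator T)
          (u + rightInv A T *ᵥ (press A q + press A (v + u))) 0⟩,
          { resp := Resp.answer
              (decide (q = v + (u + rightInv A T *ᵥ (press A q + press A (v + u))))) })
      else (⟨b, Sum.elim A v, mkMem l f ch s g d 0 0 (indicator T) u 0⟩,
        { resp := Resp.answer false })) := by
  rw [idealFinish, h, PMF.pure_map]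
  cases hit with
  | false =>
    rw [postMem_quiet _ _ _ _ _ _ _ _ _ _ _ _ _ _ rfl]
    simp [decodeResp, decodeSent, postReply, mkMem, encodeResp, toBit]
  | true =>
    have hoff : postOff A v (mkMem l f ch s g d 0 0 (indicator T) u q)
        (encodeResp (Resp.answer true : Resp ψ)) =
        u + rightInv A T *ᵥ (press A q + press A (v + u)) := by
      funext j
      rw [← press_add]
      simp [postOff, mkMem, encodeResp, toBit, rightInv]
      rfl
    have hmem : postMem A v (mkMem l f ch s g d 0 0 (indicator T) u q)
        (encodeResp (Resp.answer true : Resp ψ)) = mkMem l f ch s g d 0 0 (indicator T)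
          (u + rightInv A T *ᵥ (press A q + press A (v + u))) 0 := by
      rw [← hoff]
      funext w
      rcases w with (_ | _ | _ | _ | _ | _ | _ | _) | _ | _ | _ <;> simp [postMem, mkMem]
    have hprod := prod_eq_one_iff
      (q + (v + (u + rightInv A T *ᵥ (press A q + press A (v + u)))))
    rw [vec_add_eq_zero_iff] at hprod
    rw [hmem]
    simp only [if_true, decodeResp, decodeSent, postReply, hoff]
    simp only [Pi.add_apply] at hprod
    simp [mkMem, encodeResp, toBit, hprod]

end finish

end simRun

/-! ### The ideal world as a run on top of a key box -/

section embed

open Matrix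

variable {ℓ τ ψ : ℕ}

/-- The state of the ideal world that is represented by a run with corrupted `A`. -/
def AliceState.toIdeal (A : Fin ψ × Fin τ → Bit)
    (s : AliceState ℓ τ ((Fin ψ → Bit) × (Fin τ → Bit) × (Fin τ → Bit))) :
    IdealState (keySim Corr.alice ℓ τ ψ) where
  box :=
    { key := some s.key.1
      shareA := s.phase.share.map (pressA A)
      shareB := s.phase.share.map fun a => toBShare s.key.1 (pressA A a)
      leakUsed := match s.phase with
        | AlicePhase.failed => true
        | _ => false
      failed := match s.phase with
        | AlicePhase.failed => true
        | _ => false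
      releasedB := match s.phase with
        | AlicePhase.chosen _ _ d => d
        | _ => false }
  tape := Sum.elim A s.key.2.1
  mem := mkMem (toBit s.leaked.isSome)
    (match s.phase with
      | AlicePhase.failed => 1
      | _ => 0)
    (match s.phase with
      | AlicePhase.chosen _ _ _ => 1
      | _ => 0)
    (match s.phase with
      | AlicePhase.chosen _ sent _ => toBit sent
      | _ => 0) 0 0 0 0 (indicator s.leakSet) s.key.2.2 0

/-- The ideal world with corrupted `A` is a run on top of `simKey` that never stops. -/
theorem idealStep_alice {𝓛 : Set (Leakage τ)} (A : Fin ψ × Fin τ → Bit)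
    (s : AliceState ℓ τ ((Fin ψ → Bit) × (Fin τ → Bit) × (Fin τ → Bit)))
    (q : AdvCmd 𝓛 (Fin ψ × Fin τ) ℓ τ) :
    (idealStep (keySim Corr.alice ℓ τ ψ) 𝓛 Corr.alice (s.toIdeal A) q).map some =
      (aliceStep 𝓛 A (fun _ => True) (simKey A) s q).map
        (Option.map fun r => (AliceState.toIdeal A r.1, r.2)) := by
  obtain ⟨lk, ph, Δ, g, u⟩ := s
  have hb : aliceBit Corr.alice = 1 := rfl
  have ht : toBit true = 1 := rfl
  have hf : toBit false = 0 := rfl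
  simp only [AliceState.toIdeal]
  rw [idealStep_keySim]
  simp only [aliceStep, if_true]
  cases q with
  | box q =>
    cases q with
    | query G =>
      simp only [sampleLeak, PMF.pure_bind, decode_query, preMem_query, AliceState.leakSet]
      rcases ph with _ | _ | ⟨a, _ | _, d⟩
      case failed =>
        rw [idealFinish_quiet (b' := _) (oA := none) (oB := none) (h := rfl)]
        simp [aliceRun, PMF.pure_map]
      all_goals
        rw [idealFinish_answer (hit := decide (press A G = Δ)) (h := rfl)]
        by_cases hG : press A G = Δ <;>
          simp [hG, aliceRun, PMF.pure_map, AliceState.leakSet, simKey]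
    | leak L =>
      simp only [sampleLeak, PMF.bind_map, decode_leak, preMem_leak, AliceState.leakSet,
        Function.comp_def]
      have fail : callIdeal (ℓ := ℓ) Corr.alice { key := some Δ }
          (some (BoxCmd.leak (noLeak ψ false))) =
          PMF.pure ({ key := some Δ, leakUsed := true, failed := true },
            { toB := some BOut.fail }) := by
        simp [callIdeal, waStep, noLeak, PMF.pure_map]
      rcases ph with _ | _ | ⟨a', s', d⟩ <;> rcases lk with _ | S
      case waiting.none =>
        simp only [aliceRun, PMF.map_bind]
        congr 1
        funext p
        rcases p with ⟨S, _ | _⟩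
        · simp [leakAllowed, mkMem, encodeAdv, encodeBox, hb, hf]
          refine (congrArg (PMF.map some) (idealFinish_quiet (h := fail) ..)).trans ?_
          simp [PMF.pure_map]
          rfl
        · simp [leakAllowed, mkMem, encodeAdv, encodeBox, hb, ht, hf, bit_one_add_one]
          have h0 : (fun j => indicator (∅ : Finset (Fin τ)) j + indicator S j) = indicator S := by
            funext j
            simp [indicator, toBit]
          rw [h0]
          refine (congrArg (PMF.map some) (idealFinish_leak ..)).trans ?_
          simp [PMF.pure_map, simKey]
          rfl
      all_goals
        simp [leakAllowed, mkMem, encodeAdv, encodeBox, hb, ht, hf, bit_one_add_one]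
        rw [idealFinish_quiet (b' := _) (oA := none) (oB := none) (h := rfl)]
        simp [aliceRun, PMF.pure_map]
        try rfl
    | chooseA a =>
      simp only [sampleLeak, PMF.pure_bind, decode_chooseA, preMem_chooseA, AliceState.leakSet, hb]
      rcases ph with _ | _ | ⟨a', _ | _, d⟩
      case waiting =>
        refine (congrArg (PMF.map some) (idealFinish_quiet
          (oA := none) (oB := none) (h := rfl) ..)).trans ?_
        simp [aliceRun, PMF.pure_map]
        rfl
      all_goals
        rw [idealFinish_quiet (b' := _) (oA := none) (oB := none) (h := rfl)]
        simp [aliceRun, PMF.pure_map, bit_one_add_one]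
    | chooseB b =>
      simp only [sampleLeak, PMF.pure_bind, decode_chooseB, preMem_chooseB, AliceState.leakSet]
      rw [idealFinish_quiet (b' := _) (oA := none) (oB := none) (h := rfl)]
      simp [aliceRun, PMF.pure_map]
    | releaseA =>
      simp only [sampleLeak, PMF.pure_bind, decode_releaseA, preMem_releaseA,
        AliceState.leakSet, hb]
      rw [idealFinish_quiet (b' := _) (oA := none) (oB := none) (h := rfl)]
      simp [aliceRun, PMF.pure_map, bit_one_add_one]
    | releaseB =>
      simp only [sampleLeak, PMF.pure_bind, decode_releaseB, preMem_releaseB,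
        AliceState.leakSet, hb]
      rcases ph with _ | _ | ⟨a', _ | _, d⟩
      case chosen.false =>
        simp [hf, bit_one_add_one]
        rw [idealFinish_send]
        simp [aliceRun, PMF.pure_map]
        rfl
      all_goals
        simp [ht, bit_one_add_one]
        rw [idealFinish_quiet (b' := _) (oA := none) (oB := none) (h := rfl)]
        simp [aliceRun, PMF.pure_map]
        try rfl
  | wakeA =>
    simp only [sampleLeak, PMF.pure_bind, decode_wakeA, preMem_wakeA, AliceState.leakSet]
    rw [idealFinish_quiet (b' := _) (oA := none) (oB := none)
      (h := by simp [mkMem, callIdeal]; rfl)]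
    simp [aliceRun, PMF.pure_map]
  | wakeB =>
    simp only [sampleLeak, PMF.pure_bind, decode_wakeB, preMem_wakeB, AliceState.leakSet]
    rcases ph with _ | _ | ⟨a', _ | _, _ | _⟩
    case chosen.true.false =>
      rw [idealFinish_quiet (b' := _) (oA := none)
        (oB := some (BOut.share (toBShare Δ (pressA A a'))))
        (h := by simp [mkMem, callIdeal, waStep, ht, AlicePhase.share]; rfl)]
      simp [aliceRun, PMF.pure_map, simKey]
      rfl
    all_goals
      rw [idealFinish_quiet (b' := _) (oA := none) (oB := none)
        (h := by simp [mkMem, callIdeal, waStep, hf, ht]; rfl)]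
      simp [aliceRun, PMF.pure_map]
  | deliver =>
    simp only [sampleLeak, PMF.pure_bind, decode_deliver, preMem_deliver, AliceState.leakSet, hb]
    rw [idealFinish_quiet (b' := _) (oA := none) (oB := none) (h := rfl)]
    simp [aliceRun, PMF.pure_map, bit_one_add_one]
  | send m =>
    simp only [sampleLeak, PMF.pure_bind, decode_send, preMem_send, AliceState.leakSet]
    rw [idealFinish_quiet (b' := _) (oA := none) (oB := none) (h := rfl)]
    simp [aliceRun, PMF.pure_map]

/-- The state of the ideal world that is represented by a run without corruption in which the ideal
box has chosen the bits `x` and the local keys `k`. -/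
def HonestState.toIdeal (A : Fin ψ × Fin τ → Bit) (x : Fin ℓ → Bit) (k : Fin ℓ → Fin ψ → Bit)
    (s : HonestState ((Fin ψ → Bit) × (Fin τ → Bit) × (Fin τ → Bit))) :
    IdealState (keySim Corr.none ℓ τ ψ) where
  box :=
    { key := some s.key.1
      shareA := some (toAShare x (bShare s.key.1 k))
      shareB := some (bShare s.key.1 k)
      releasedA := s.doneA
      releasedB := s.doneB }
  tape := Sum.elim A s.key.2.1
  mem := mkMem 0 0 0
    (match s.msg with
      | MsgStatus.unsent => 0
      | _ => 1)
    (toBit s.gotA)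
    (match s.msg with
      | MsgStatus.delivered => 1
      | _ => 0) 0 0 (indicator ∅) s.key.2.2 0

/-- The ideal world without corruption is a run on top of `simKey`. -/
theorem idealStep_honest {𝓛 : Set (Leakage τ)} (A : Fin ψ × Fin τ → Bit) (x : Fin ℓ → Bit)
    (k : Fin ℓ → Fin ψ → Bit)
    (s : HonestState ((Fin ψ → Bit) × (Fin τ → Bit) × (Fin τ → Bit)))
    (q : AdvCmd 𝓛 (Fin ψ × Fin τ) ℓ τ) :
    (idealStep (keySim Corr.none ℓ τ ψ) 𝓛 Corr.none (s.toIdeal A x k) q).map some =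
      (honestStep 𝓛 A x k (simKey A) s q).map
        (Option.map fun r => (HonestState.toIdeal A x k r.1, r.2)) := by
  obtain ⟨gA, m, dA, dB, Δ, g, u⟩ := s
  have hb : aliceBit Corr.none = 0 := rfl
  have ht : toBit true = 1 := rfl
  have hf : toBit false = 0 := rfl
  simp only [HonestState.toIdeal]
  rw [idealStep_keySim]
  cases q with
  | box q =>
    cases q with
    | query G =>
      simp only [sampleLeak, PMF.pure_bind, decode_query, preMem_query]
      rw [idealFinish_answer (hit := decide (press A G = Δ)) (h := rfl)]
      by_cases hG : press A G = Δ <;>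
        simp [hG, honestStep, PMF.pure_map, simKey]
    | leak L =>
      simp only [sampleLeak, PMF.bind_map, decode_leak, preMem_leak, Function.comp_def]
      simp [leakAllowed, hb]
      rw [idealFinish_quiet (b' := _) (oA := none) (oB := none) (h := rfl)]
      simp [honestStep, PMF.pure_map]
    | chooseA a =>
      simp only [sampleLeak, PMF.pure_bind, decode_chooseA, preMem_chooseA, hb]
      rw [idealFinish_quiet (b' := _) (oA := none) (oB := none) (h := rfl)]
      simp [honestStep, PMF.pure_map]
    | chooseB b =>
      simp only [sampleLeak, PMF.pure_bind, decode_chooseB, preMem_chooseB]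
      rw [idealFinish_quiet (b' := _) (oA := none) (oB := none) (h := rfl)]
      simp [honestStep, PMF.pure_map]
    | releaseA =>
      simp only [sampleLeak, PMF.pure_bind, decode_releaseA, preMem_releaseA, hb]
      rw [idealFinish_quiet (b' := _) (oA := none) (oB := none) (h := rfl)]
      cases gA <;> simp [honestStep, PMF.pure_map, ht, hf, bit_one_add_one]
    | releaseB =>
      simp only [sampleLeak, PMF.pure_bind, decode_releaseB, preMem_releaseB, hb]
      cases m
      case unsent =>
        simp
        rw [idealFinish_send]
        simp [honestStep, PMF.pure_map]
      all_goals
        simp [bit_one_add_one]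
        rw [idealFinish_quiet (b' := _) (oA := none) (oB := none) (h := rfl)]
        simp [honestStep, PMF.pure_map]
  | wakeA =>
    simp only [sampleLeak, PMF.pure_bind, decode_wakeA, preMem_wakeA]
    cases gA <;> cases m <;> cases dA
    case true.delivered.false =>
      rw [idealFinish_quiet (b' := _) (oA := some (toAShare x (bShare Δ k))) (oB := none)
        (h := by simp [mkMem, callIdeal, waStep, ht]; rfl)]
      simp [honestStep, PMF.pure_map, simKey]
    all_goals
      rw [idealFinish_quiet (b' := _) (oA := none) (oB := none)
        (h := by simp [mkMem, callIdeal, waStep, hf, ht]; rfl)]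
      simp [honestStep, PMF.pure_map]
  | wakeB =>
    simp only [sampleLeak, PMF.pure_bind, decode_wakeB, preMem_wakeB]
    cases m
    case unsent =>
      rw [idealFinish_quiet (b' := _) (oA := none) (oB := none)
        (h := by simp [mkMem, callIdeal]; rfl)]
      simp [honestStep, PMF.pure_map]
    all_goals
      cases dB
      · rw [idealFinish_quiet (b' := _) (oA := none) (oB := some (BOut.share (bShare Δ k)))
          (h := by simp [mkMem, callIdeal, waStep]; rfl)]
        simp [honestStep, PMF.pure_map, simKey]
      · rw [idealFinish_quiet (b' := _) (oA := none) (oB := none)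
          (h := by simp [mkMem, callIdeal, waStep]; rfl)]
        simp [honestStep, PMF.pure_map]
  | deliver =>
    simp only [sampleLeak, PMF.pure_bind, decode_deliver, preMem_deliver, hb]
    rw [idealFinish_quiet (b' := _) (oA := none) (oB := none) (h := rfl)]
    cases m <;> simp [honestStep, PMF.pure_map, bit_one_add_one]
  | send m' =>
    simp only [sampleLeak, PMF.pure_bind, decode_send, preMem_send]
    rw [idealFinish_quiet (b' := _) (oA := none) (oB := none) (h := rfl)]
    simp [honestStep, PMF.pure_map]

end embed

/-! ### Indistinguishability for corrupted `A` -/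

section indist

open Matrix

variable {ℓ τ ψ : ℕ}

theorem bind_uniform_sum {α β γ : Type} [Fintype α] [DecidableEq α] [Fintype β] [DecidableEq β]
    (f : (α ⊕ β → Bit) → PMF γ) :
    (PMF.uniformOfFintype (α ⊕ β → Bit)).bind f =
      (PMF.uniformOfFintype (α → Bit)).bind fun a =>
        (PMF.uniformOfFintype (β → Bit)).bind fun b => f (Sum.elim a b) := by
  ext c
  simp only [PMF.bind_apply, PMF.uniformOfFintype_apply, ENNReal.tsum_mul_left]
  have h := (Equiv.sumArrowEquivProdArrow α β Bit).symm.tsum_eq fun x => f x c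
  rw [← h, ENNReal.tsum_prod', Fintype.card_congr (Equiv.sumArrowEquivProdArrow α β Bit),
    Fintype.card_prod, Nat.cast_mul, ENNReal.mul_inv (by simp) (by simp), mul_assoc]
  rfl

/-- If for all good `a` the distributions `P a` and `Q a` dominate the output of an experiment that
may stop, then their averages differ at most by the probability that `a` is not good or the
experiment stops. -/
theorem abs_bind_sub_le {α : Type} (U : PMF α) (P Q : α → PMF Bool) (M : α → PMF (Option Bool))
    (good : α → Prop) [DecidablePred good]
    (hP : ∀ a, good a → ∀ b, M a (some b) ≤ P a b) (hQ : ∀ a, good a → ∀ b, M a (some b) ≤ Q a b) :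
    |(U.bind P true).toReal - (U.bind Q true).toReal| ≤
      (∑' a, U a * if good a then M a none else 1).toReal := by
  let N : α → PMF (Option Bool) := fun a => if good a then M a else PMF.pure none
  have hN : ∀ R : α → PMF Bool, (∀ a, good a → ∀ b, M a (some b) ≤ R a b) →
      ∀ b, U.bind N (some b) ≤ U.bind R b := by
    intro R hR b
    simp only [PMF.bind_apply]
    refine ENNReal.tsum_le_tsum fun a => mul_le_mul_right ?_ _
    by_cases ha : good a
    · simpa [N, ha] using hR a ha b
    · simp [N, ha]
  refine (abs_sub_le_of_le (hN P hP) (hN Q hQ)).trans (le_of_eq ?_)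
  rw [PMF.bind_apply]
  congr 2
  funext a
  by_cases ha : good a <;> simp [N, ha]

theorem map_some_apply {α : Type*} (p : PMF α) (b : α) : (p.map some) (some b) = p b := by
  rw [PMF.map_apply, tsum_eq_single b fun b' hb' => if_neg fun h => hb' (Option.some.inj h).symm,
    if_pos rfl]

/-- An interaction of the environment with the protocol with corrupted `A` on top of a key box. -/
def aliceGame {𝓛 : Set (Leakage τ)} (E : Env (AdvCmd 𝓛 (Fin ψ × Fin τ) ℓ τ)
    (Obs (Fin ψ × Fin τ) ℓ τ ψ)) (A : Fin ψ × Fin τ → Bit) (good : Finset (Fin τ) → Prop)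
    (K : KeyBox τ ψ) : PMF (Option Bool) :=
  K.init.bind fun k =>
    playStop E (aliceStep 𝓛 A good K) E.rounds [] ⟨none, AlicePhase.waiting, k⟩

variable {𝓛 : Set (Leakage τ)}
  (E : Env (AdvCmd 𝓛 (Fin ψ × Fin τ) ℓ τ) (Obs (Fin ψ × Fin τ) ℓ τ ψ)) (A : Fin ψ × Fin τ → Bit)

theorem aliceGame_hom {good : Finset (Fin τ) → Prop} {K K' : KeyBox τ ψ} (H : K.Hom good K') :
    aliceGame E A good K = aliceGame E A good K' := by
  unfold aliceGame
  rw [← H.init, PMF.bind_bind]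
  congr 1
  funext k
  rw [← bind_playStop E (fun s q => bind_aliceStep (A := A) (𝓛 := 𝓛) H s q), aliceKernel,
    PMF.bind_map]
  rfl

theorem aliceGame_mono (good : Finset (Fin τ) → Prop) (K : KeyBox τ ψ) (b : Bool) :
    aliceGame E A good K (some b) ≤ aliceGame E A (fun _ => True) K (some b) := by
  unfold aliceGame
  simp only [PMF.bind_apply]
  refine ENNReal.tsum_le_tsum fun k => mul_le_mul_right
    (playStop_mono E (fun s q r => ?_) _ _ _ _) _
  unfold aliceStep
  by_cases hg : good s.leakSet
  swap
  · simp [hg]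
  simp only [hg, if_true]
  unfold aliceRun
  split
  case h_2 L =>
    split
    · simp only [PMF.bind_apply]
      refine ENNReal.tsum_le_tsum fun p => mul_le_mul_right ?_ _
      by_cases hp : p.2 = true
      · by_cases hgp : good p.1
        · simp [hp, hgp]
        · simp [hp, hgp]
      · simp [hp]
    · exact le_rfl
  all_goals exact le_rfl

/-- `n` activations of the protocol with corrupted `A` and matrix `A`. -/
def realAlicePlay (n : ℕ) : PMF Bool :=
  (PMF.uniformOfFintype (Fin τ → Bit)).bind fun Γ =>
      E.play (fixedHybrid (compress ℓ τ ψ) 𝓛 Corr.alice A) n []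
        (AliceState.toHybrid A ⟨none, AlicePhase.waiting, Γ⟩)

/-- `n` activations of the ideal world with corrupted `A` and matrix `A` of the simulator. -/
def idealAlicePlay (n : ℕ) : PMF Bool :=
  (PMF.uniformOfFintype (Fin ψ → Bit)).bind fun Δ =>
      (PMF.uniformOfFintype (Fin τ → Bit)).bind fun g =>
        E.play (ideal (keySim Corr.alice ℓ τ ψ) 𝓛 Corr.alice) n []
          (AliceState.toIdeal A ⟨none, AlicePhase.waiting, Δ, g, 0⟩)

/-- The protocol with corrupted `A`, where the matrix is sampled in advance. -/
theorem init_hybrid_alice (n : ℕ) : (hybrid (compress ℓ τ ψ) 𝓛 Corr.alice).init.bind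
      (E.play (hybrid (compress ℓ τ ψ) 𝓛 Corr.alice) n []) =
    (PMF.uniformOfFintype (Fin ψ × Fin τ → Bit)).bind fun A =>
      realAlicePlay E A n := by
  unfold realAlicePlay
  rw [PMF.bind_comm]
  have h : (hybrid (compress ℓ τ ψ) 𝓛 Corr.alice).init =
      (PMF.uniformOfFintype (Fin τ → Bit)).map fun Γ => { box := { key := some Γ } } :=
    PMF.map_comp _ _ _
  rw [h]
  refine (PMF.bind_map _ _ _).trans (congrArg (PMF.bind _) (funext fun Γ => ?_))
  exact play_hybrid (π := compress ℓ τ ψ) E n [] { box := { key := some Γ } }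

theorem play_hybrid_alice : (realAlicePlay E A E.rounds).map some =
    aliceGame E A (fun _ => True) (realKey A) := by
  rw [realAlicePlay, PMF.map_bind]
  refine congrArg (PMF.bind _) (funext fun Γ => ?_)
  exact play_embed E (fixedHybrid (compress ℓ τ ψ) 𝓛 Corr.alice A) (AliceState.toHybrid A)
    (fixedStep_toHybrid A) E.rounds [] ⟨none, AlicePhase.waiting, Γ⟩

/-- The ideal world with corrupted `A`, where the tape of the simulator is split into the matrix and
the vector `g`. -/
theorem init_ideal_alice (n : ℕ) :
    (ideal (keySim Corr.alice ℓ τ ψ) 𝓛 Corr.alice).init.bind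
      (E.play (ideal (keySim Corr.alice ℓ τ ψ) 𝓛 Corr.alice) n []) =
    (PMF.uniformOfFintype (Fin ψ × Fin τ → Bit)).bind fun A =>
      idealAlicePlay E A n := by
  unfold idealAlicePlay
  rw [PMF.bind_comm]
  have h : (ideal (keySim Corr.alice ℓ τ ψ) 𝓛 Corr.alice).init =
      (PMF.uniformOfFintype (Fin ψ → Bit)).bind fun Δ =>
        (PMF.uniformOfFintype (SimTape ψ τ → Bit)).map fun t =>
          { box := { key := some Δ }, tape := t, mem := fun _ => 0 } :=
    PMF.bind_map _ _ _
  rw [h, PMF.bind_bind]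
  refine congrArg (PMF.bind _) (funext fun Δ => ?_)
  refine (PMF.bind_map _ _ _).trans ((bind_uniform_sum _).trans ?_)
  have hm : (fun _ => 0 : SimMem τ → Bit) = mkMem 0 0 0 0 0 0 0 0 (indicator ∅) 0 0 := by
    funext w
    rcases w with (_ | _ | _ | _ | _ | _ | _ | _) | _ | _ | _ <;> simp [mkMem, indicator, toBit]
  refine congrArg (PMF.bind _) (funext fun A => congrArg (PMF.bind _) (funext fun g => ?_))
  show E.play (ideal (keySim Corr.alice ℓ τ ψ) 𝓛 Corr.alice) n []
    (⟨{ key := some Δ }, Sum.elim A g, fun _ => 0⟩ : IdealState (keySim Corr.alice ℓ τ ψ)) = _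
  exact congrArg (fun m => E.play (ideal (keySim Corr.alice ℓ τ ψ) 𝓛 Corr.alice) n []
    (⟨{ key := some Δ }, Sum.elim A g, m⟩ : IdealState (keySim Corr.alice ℓ τ ψ))) hm

theorem play_ideal_alice : (idealAlicePlay E A E.rounds).map some =
    aliceGame E A (fun _ => True) (simKey A) := by
  have h : aliceGame E A (fun _ => True) (simKey A) = (PMF.uniformOfFintype (Fin ψ → Bit)).bind
      fun Δ => (PMF.uniformOfFintype (Fin τ → Bit)).bind fun g =>
        playStop E (aliceStep 𝓛 A (fun _ => True) (simKey A)) E.rounds []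
          ⟨none, AlicePhase.waiting, (Δ, g, 0)⟩ := by
    unfold aliceGame
    simp only [simKey, PMF.bind_bind, PMF.bind_map, Function.comp_def]
  rw [h]
  simp only [idealAlicePlay, PMF.map_bind]
  refine congrArg (PMF.bind _) (funext fun Δ => congrArg (PMF.bind _) (funext fun g => ?_))
  exact play_embed E (ideal (keySim Corr.alice ℓ τ ψ) 𝓛 Corr.alice) (AliceState.toIdeal A)
    (idealStep_alice A) E.rounds [] ⟨none, AlicePhase.waiting, Δ, g, 0⟩

open Classical in
/-- The matrices that are bad without leakage are accounted for separately. -/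
theorem tsum_good_le (M : (Fin ψ × Fin τ → Bit) → ℝ≥0∞) {ε : ℝ≥0∞}
    (h : ∑' A : Fin ψ × Fin τ → Bit, PMF.uniformOfFintype _ A * (if Good A ∅ then M A else 0) ≤ ε) :
    ∑' A : Fin ψ × Fin τ → Bit, PMF.uniformOfFintype _ A * (if Good A ∅ then M A else 1) ≤
      badProb ψ (∅ : Finset (Fin τ)) + ε := by
  refine le_trans (le_of_eq ?_) (add_le_add le_rfl h)
  rw [badProb, ← ENNReal.tsum_add]
  refine tsum_congr fun A => ?_
  by_cases hA : Good A ∅ <;> simp [hA]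

/-- The simulator for corrupted `A`. -/
theorem abs_prob_alice_le {ε : ℝ≥0∞} (hε : ∀ L ∈ 𝓛, leakLoss ψ L ≤ ε)
    (hfin : badProb ψ (∅ : Finset (Fin τ)) + ε ≠ ⊤) :
    |E.prob (hybrid (compress ℓ τ ψ) 𝓛 Corr.alice) -
      E.prob (ideal (keySim Corr.alice ℓ τ ψ) 𝓛 Corr.alice)| ≤
      (badProb ψ (∅ : Finset (Fin τ)) + ε).toReal := by
  classical
  unfold Env.prob
  rw [init_hybrid_alice, init_ideal_alice]
  refine (abs_bind_sub_le _ _ _ (fun A => aliceGame E A (Good A) (lazyKey A)) (fun A => Good A ∅)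
    (fun A hA b => ?_) fun A hA b => ?_).trans (ENNReal.toReal_mono hfin (tsum_good_le _ ?_))
  · refine le_of_le_of_eq ?_ (map_some_apply (realAlicePlay E A E.rounds) b)
    rw [play_hybrid_alice, aliceGame_hom E A (lazyToReal A)]
    exact aliceGame_mono E A (Good A) (realKey A) b
  · refine le_of_le_of_eq ?_ (map_some_apply (idealAlicePlay E A E.rounds) b)
    rw [play_ideal_alice, aliceGame_hom E A (lazyToSim A)]
    exact aliceGame_mono E A (Good A) (simKey A) b
  · calc _ = ∑' A : Fin ψ × Fin τ → Bit, PMF.uniformOfFintype _ A * (if Good A ∅ then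
          ∑' Γ : Fin τ → Bit, PMF.uniformOfFintype _ Γ *
            playStop E (realAlice 𝓛 A (Good A)) E.rounds []
          (⟨none, AlicePhase.waiting, Γ⟩ : AliceState ℓ τ (Fin τ → Bit)) none else 0) := by
          simp only [aliceGame_hom E _ (lazyToReal _)]
          refine tsum_congr fun A => ?_
          congr 2
      _ = ∑' A : Fin ψ × Fin τ → Bit, ∑' Γ : Fin τ → Bit, PMF.uniformOfFintype _ Γ *
          (PMF.uniformOfFintype _ A * if Good A ∅ then
            playStop E (realAlice 𝓛 A (Good A)) E.rounds []
          (⟨none, AlicePhase.waiting, Γ⟩ : AliceState ℓ τ (Fin τ → Bit)) none else 0) := by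
          refine tsum_congr fun A => ?_
          split_ifs
          · rw [← ENNReal.tsum_mul_left]
            exact tsum_congr fun Γ => mul_left_comm _ _ _
          · simp
      _ ≤ ∑' Γ : Fin τ → Bit, PMF.uniformOfFintype _ Γ * ε := by
          rw [ENNReal.tsum_comm]
          refine ENNReal.tsum_le_tsum fun Γ => ?_
          rw [ENNReal.tsum_mul_left]
          exact mul_le_mul_right (tsum_playStop_none_le hε E _ _ Γ) _
      _ = ε := by rw [ENNReal.tsum_mul_right, PMF.tsum_coe, one_mul]

end indist

/-! ### Indistinguishability without corruption -/

section honest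

open Matrix

variable {ℓ τ ψ : ℕ} {𝓛 : Set (Leakage τ)}
  (E : Env (AdvCmd 𝓛 (Fin ψ × Fin τ) ℓ τ) (Obs (Fin ψ × Fin τ) ℓ τ ψ)) (A : Fin ψ × Fin τ → Bit)

/-- The initial state of a run without corruption. -/
def HonestState.start {K : Type} (κ : K) : HonestState K :=
  ⟨false, MsgStatus.unsent, false, false, κ⟩

/-- An interaction of the environment with the protocol without corruption on top of a key box. -/
def honestGame (x : Fin ℓ → Bit) (k : Fin ℓ → Fin ψ → Bit) (K : KeyBox τ ψ) : PMF (Option Bool) :=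
  K.init.bind fun κ => playStop E (honestStep 𝓛 A x k K) E.rounds [] (HonestState.start κ)

theorem honestGame_hom {x : Fin ℓ → Bit} {k : Fin ℓ → Fin ψ → Bit}
    {good : Finset (Fin τ) → Prop} {K K' : KeyBox τ ψ} (H : K.Hom good K') (hg : good ∅) :
    honestGame E A x k K = honestGame E A x k K' := by
  unfold honestGame
  rw [← H.init, PMF.bind_bind]
  congr 1
  funext κ
  rw [← bind_playStop E (fun s q => bind_honestStep (A := A) (𝓛 := 𝓛) (x := x) (k := k) H hg s q),
    honestKernel, PMF.bind_map]
  rfl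

/-- Uniform local keys are compressed to uniform local keys. -/
theorem bind_press {β : Type*} {A : Fin ψ × Fin τ → Bit} (hA : Good A ∅)
    (f : (Fin ℓ → Fin ψ → Bit) → PMF β) :
    ((PMF.uniformOfFintype (Fin ℓ → Fin τ → Bit)).bind fun K => f fun i => press A (K i)) =
      (PMF.uniformOfFintype (Fin ℓ → Fin ψ → Bit)).bind f := by
  -- Both sides are obtained by shifting one of two independent uniform families by the other.
  have h1 : ∀ k : Fin ℓ → Fin ψ → Bit,
      ((PMF.uniformOfFintype (Fin ℓ → Fin τ → Bit)).bind fun K => f fun i => press A (K i) + k i) =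
        (PMF.uniformOfFintype (Fin ℓ → Fin τ → Bit)).bind fun K => f fun i => press A (K i) := by
    intro k
    rw [← bind_uniform_comp (σ := fun K : Fin ℓ → Fin τ → Bit => fun i =>
      K i + rightInv A ∅ *ᵥ k i) (bijective_of_involutive fun K => by
        funext i
        rw [add_assoc, vec_add_self, add_zero])]
    simp only [press_add, press_rightInv hA, add_assoc, vec_add_self, add_zero]
  have h2 : ∀ K : Fin ℓ → Fin τ → Bit,
      ((PMF.uniformOfFintype (Fin ℓ → Fin ψ → Bit)).bind fun k => f fun i => press A (K i) + k i) =
        (PMF.uniformOfFintype (Fin ℓ → Fin ψ → Bit)).bind f := fun K =>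
    bind_uniform_comp (σ := fun k : Fin ℓ → Fin ψ → Bit => fun i => press A (K i) + k i)
      (bijective_of_involutive fun k => by
        funext i
        rw [← add_assoc, vec_add_self, zero_add]) f
  calc _ = (PMF.uniformOfFintype (Fin ℓ → Fin ψ → Bit)).bind fun k =>
        (PMF.uniformOfFintype (Fin ℓ → Fin τ → Bit)).bind fun K =>
          f fun i => press A (K i) + k i := by simp only [h1, PMF.bind_const]
    _ = _ := by rw [PMF.bind_comm]; simp only [h2, PMF.bind_const]

/-- `n` activations of the protocol without corruption and with matrix `A`. -/
def realHonestPlay (n : ℕ) : PMF Bool :=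
  (PMF.uniformOfFintype (Fin τ → Bit)).bind fun Γ =>
  (PMF.uniformOfFintype (Fin ℓ → Bit)).bind fun x =>
  (PMF.uniformOfFintype (Fin ℓ → Fin τ → Bit)).bind fun K =>
    E.play (fixedHybrid (compress ℓ τ ψ) 𝓛 Corr.none A) n []
      (HonestState.toHybrid A x K (HonestState.start Γ))

/-- `n` activations of the ideal world without corruption and with matrix `A` of the simulator. -/
def idealHonestPlay (n : ℕ) : PMF Bool :=
  (PMF.uniformOfFintype (Fin ψ → Bit)).bind fun Δ =>
  (PMF.uniformOfFintype (Fin ℓ → Bit)).bind fun x =>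
  (PMF.uniformOfFintype (Fin ℓ → Fin ψ → Bit)).bind fun k =>
  (PMF.uniformOfFintype (Fin τ → Bit)).bind fun g =>
    E.play (ideal (keySim Corr.none ℓ τ ψ) 𝓛 Corr.none) n []
      (HonestState.toIdeal A x k (HonestState.start (Δ, g, 0)))

/-- The output of the box if nobody is corrupted. -/
theorem waInit_none (n : ℕ) : waInit ℓ n Corr.none =
    (PMF.uniformOfFintype (Fin n → Bit)).bind fun Γ =>
    (PMF.uniformOfFintype (Fin ℓ → Bit)).bind fun x =>
    (PMF.uniformOfFintype (Fin ℓ → Fin n → Bit)).map fun K =>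
      { key := some Γ
        shareA := some (toAShare x (bShare Γ K))
        shareB := some (bShare Γ K) } := by
  have h : ∀ (Γ : Fin n → Bit) (K : Fin ℓ → Fin n → Bit), bShare Γ K = fun w =>
        match w with
        | BWire.glob j => Γ j
        | BWire.loc i j => K i j := by
    intro Γ K
    funext w
    cases w <;> rfl
  simp only [h]
  rfl

theorem init_hybrid_none (n : ℕ) : (hybrid (compress ℓ τ ψ) 𝓛 Corr.none).init.bind
      (E.play (hybrid (compress ℓ τ ψ) 𝓛 Corr.none) n []) =
    (PMF.uniformOfFintype (Fin ψ × Fin τ → Bit)).bind fun A => realHonestPlay E A n := by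
  have h : (hybrid (compress ℓ τ ψ) 𝓛 Corr.none).init.bind
        (E.play (hybrid (compress ℓ τ ψ) 𝓛 Corr.none) n []) =
      (waInit ℓ τ Corr.none).bind fun b => E.play (hybrid (compress ℓ τ ψ) 𝓛 Corr.none) n []
        ({ box := b } : HybridState (compress ℓ τ ψ)) := PMF.bind_map _ _ _
  rw [h, waInit_none]
  unfold realHonestPlay
  simp only [PMF.bind_bind, PMF.bind_map, Function.comp_def]
  rw [PMF.bind_comm (PMF.uniformOfFintype (Fin ψ × Fin τ → Bit))]
  refine congrArg (PMF.bind _) (funext fun Γ => ?_)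
  rw [PMF.bind_comm (PMF.uniformOfFintype (Fin ψ × Fin τ → Bit))]
  refine congrArg (PMF.bind _) (funext fun x => ?_)
  rw [PMF.bind_comm (PMF.uniformOfFintype (Fin ψ × Fin τ → Bit))]
  refine congrArg (PMF.bind _) (funext fun K => ?_)
  exact play_hybrid (π := compress ℓ τ ψ) E n []
    { box :=
        { key := some Γ, shareA := some (toAShare x (bShare Γ K)), shareB := some (bShare Γ K) } }

theorem init_ideal_none (n : ℕ) : (ideal (keySim Corr.none ℓ τ ψ) 𝓛 Corr.none).init.bind
      (E.play (ideal (keySim Corr.none ℓ τ ψ) 𝓛 Corr.none) n []) =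
    (PMF.uniformOfFintype (Fin ψ × Fin τ → Bit)).bind fun A => idealHonestPlay E A n := by
  have h : (ideal (keySim Corr.none ℓ τ ψ) 𝓛 Corr.none).init.bind
        (E.play (ideal (keySim Corr.none ℓ τ ψ) 𝓛 Corr.none) n []) =
      (waInit ℓ ψ Corr.none).bind fun b => (PMF.uniformOfFintype (SimTape ψ τ → Bit)).bind fun t =>
        E.play (ideal (keySim Corr.none ℓ τ ψ) 𝓛 Corr.none) n []
        (⟨b, t, fun _ => 0⟩ : IdealState (keySim Corr.none ℓ τ ψ)) :=
    (PMF.bind_bind _ _ _).trans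
      (congrArg (PMF.bind _) (funext fun b => PMF.bind_map _ _ _))
  rw [h, waInit_none]
  unfold idealHonestPlay
  simp only [PMF.bind_bind, PMF.bind_map, Function.comp_def]
  rw [PMF.bind_comm (PMF.uniformOfFintype (Fin ψ × Fin τ → Bit))]
  refine congrArg (PMF.bind _) (funext fun Δ => ?_)
  rw [PMF.bind_comm (PMF.uniformOfFintype (Fin ψ × Fin τ → Bit))]
  refine congrArg (PMF.bind _) (funext fun x => ?_)
  rw [PMF.bind_comm (PMF.uniformOfFintype (Fin ψ × Fin τ → Bit))]
  refine congrArg (PMF.bind _) (funext fun k => ?_)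
  refine (bind_uniform_sum _).trans ?_
  have hm : (fun _ => 0 : SimMem τ → Bit) = mkMem 0 0 0 0 0 0 0 0 (indicator ∅) 0 0 := by
    funext w
    rcases w with (_ | _ | _ | _ | _ | _ | _ | _) | _ | _ | _ <;> simp [mkMem, indicator, toBit]
  refine congrArg (PMF.bind _) (funext fun A => congrArg (PMF.bind _) (funext fun g => ?_))
  exact congrArg (fun m => E.play (ideal (keySim Corr.none ℓ τ ψ) 𝓛 Corr.none) n []
    (⟨{ key := some Δ, shareA := some (toAShare x (bShare Δ k)), shareB := some (bShare Δ k) },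
      Sum.elim A g, m⟩ : IdealState (keySim Corr.none ℓ τ ψ))) hm

theorem play_hybrid_none : (realHonestPlay E A E.rounds).map some =
    (PMF.uniformOfFintype (Fin ℓ → Bit)).bind fun x =>
    (PMF.uniformOfFintype (Fin ℓ → Fin τ → Bit)).bind fun K =>
      honestGame E A x (fun i => press A (K i)) (realKey A) := by
  simp only [realHonestPlay, PMF.map_bind]
  rw [PMF.bind_comm]
  refine congrArg (PMF.bind _) (funext fun x => ?_)
  rw [PMF.bind_comm]
  refine congrArg (PMF.bind _) (funext fun K => congrArg (PMF.bind _) (funext fun Γ => ?_))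
  exact play_embed E (fixedHybrid (compress ℓ τ ψ) 𝓛 Corr.none A) (HonestState.toHybrid A x K)
    (fixedStep_honest A x K) E.rounds [] (HonestState.start Γ)

theorem play_ideal_none : (idealHonestPlay E A E.rounds).map some =
    (PMF.uniformOfFintype (Fin ℓ → Bit)).bind fun x =>
    (PMF.uniformOfFintype (Fin ℓ → Fin ψ → Bit)).bind fun k =>
      honestGame E A x k (simKey A) := by
  have h : ∀ x k, honestGame E A x k (simKey A) = (PMF.uniformOfFintype (Fin ψ → Bit)).bind
      fun Δ => (PMF.uniformOfFintype (Fin τ → Bit)).bind fun g =>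
        playStop E (honestStep 𝓛 A x k (simKey A)) E.rounds [] (HonestState.start (Δ, g, 0)) := by
    intro x k
    unfold honestGame
    simp only [simKey, PMF.bind_bind, PMF.bind_map, Function.comp_def]
  simp only [idealHonestPlay, PMF.map_bind, h]
  rw [PMF.bind_comm]
  refine congrArg (PMF.bind _) (funext fun x => ?_)
  rw [PMF.bind_comm]
  refine congrArg (PMF.bind _) (funext fun k => congrArg (PMF.bind _) (funext fun Δ =>
    congrArg (PMF.bind _) (funext fun g => ?_)))
  exact play_embed E (ideal (keySim Corr.none ℓ τ ψ) 𝓛 Corr.none) (HonestState.toIdeal A x k)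
    (idealStep_honest A x k) E.rounds [] (HonestState.start (Δ, g, 0))

/-- The simulator without corruption. It is perfect if the matrix has independent rows. -/
theorem abs_prob_none_le (hfin : badProb ψ (∅ : Finset (Fin τ)) ≠ ⊤) :
    |E.prob (hybrid (compress ℓ τ ψ) 𝓛 Corr.none) -
      E.prob (ideal (keySim Corr.none ℓ τ ψ) 𝓛 Corr.none)| ≤
      (badProb ψ (∅ : Finset (Fin τ))).toReal := by
  classical
  have heq : ∀ A, Good A ∅ → (realHonestPlay E A E.rounds).map some =
      (idealHonestPlay E A E.rounds).map some := by
    intro A hA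
    rw [play_hybrid_none, play_ideal_none]
    refine congrArg (PMF.bind _) (funext fun x => ?_)
    rw [bind_press hA fun k => honestGame E A x k (realKey A)]
    refine congrArg (PMF.bind _) (funext fun k => ?_)
    rw [← honestGame_hom E A (lazyToReal A) hA, honestGame_hom E A (lazyToSim A) hA]
  unfold Env.prob
  rw [init_hybrid_none, init_ideal_none]
  refine (abs_bind_sub_le _ _ _ (fun A => (realHonestPlay E A E.rounds).map some)
    (fun A => Good A ∅) (fun A hA b => (map_some_apply _ b).le) fun A hA b => ?_).trans
    (ENNReal.toReal_mono hfin (le_of_eq (tsum_congr fun A => ?_)))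
  · rw [heq A hA]
    exact (map_some_apply _ b).le
  · congr 2
    rw [PMF.map_apply]
    simp

end honest

/-! ### The simulator for corrupted `B` -/

/-- The one-bit memory cells of the simulator: whether the keys of `B` and the message have arrived,
whether `A` has obtained its output of the box, and the answer to a query of the current activation.
-/
inductive BobFlag : Type
  | keyed | received | released | isAnswer | answer

/-- The memory of the simulator: flags, the keys chosen by `B`, and the message. -/
inductive BobMem (ℓ τ ψ : ℕ) : Type
  | flag (f : BobFlag) : BobMem ℓ τ ψ
  | key (w : BWire ℓ τ) : BobMem ℓ τ ψ
  | msg (w : Fin ψ × Fin τ) : BobMem ℓ τ ψ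

section bobSim

open Matrix

variable {ℓ τ ψ : ℕ}

/-- The memory cells of the simulator as a sum type, which makes them a finite type. -/
def bobMemEquiv : BobFlag ⊕ BWire ℓ τ ⊕ Fin ψ × Fin τ ≃ BobMem ℓ τ ψ where
  toFun := Sum.elim BobMem.flag (Sum.elim BobMem.key BobMem.msg)
  invFun
    | BobMem.flag f => Sum.inl f
    | BobMem.key w => Sum.inr (Sum.inl w)
    | BobMem.msg w => Sum.inr (Sum.inr w)
  left_inv := by rintro (_ | _ | _) <;> rfl
  right_inv := by rintro (_ | _ | _) <;> rfl

instance : Fintype BobFlag :=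
  ⟨⟨[BobFlag.keyed, BobFlag.received, BobFlag.released, BobFlag.isAnswer, BobFlag.answer],
    by simp⟩, fun k => by cases k <;> simp⟩

instance : Fintype (BobMem ℓ τ ψ) := Fintype.ofEquiv _ bobMemEquiv

theorem card_bobMem_le {n : ℕ} (hn : ψ + τ + ℓ + 1 ≤ n) :
    Fintype.card (BobMem ℓ τ ψ) ≤ 8 * n ^ 2 := by
  rw [← Fintype.card_congr bobMemEquiv]
  simp only [Fintype.card_sum, Fintype.card_fin, Fintype.card_prod, card_bWire]
  rw [show Fintype.card BobFlag = 5 from rfl]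
  have h1 : ℓ * τ ≤ n * n := Nat.mul_le_mul (by omega) (by omega)
  have h2 : ψ * τ ≤ n * n := Nat.mul_le_mul (by omega) (by omega)
  have h3 : n ≤ n ^ 2 := Nat.le_self_pow (by norm_num) n
  nlinarith

/-- Whether a command makes the simulator store keys. -/
def bobKeyNow (m : BobMem ℓ τ ψ → Bit) (a : AdvWire (Fin ψ × Fin τ) ℓ τ → Bit) : Bit :=
  a (AdvWire.box (BoxWire.is BoxKind.chooseB)) * (1 + m (BobMem.flag BobFlag.keyed))

/-- Whether a command makes the simulator store a message. -/
def bobMsgNow (m : BobMem ℓ τ ψ → Bit) (a : AdvWire (Fin ψ × Fin τ) ℓ τ → Bit) : Bit :=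
  a AdvWire.isSend * (1 + m (BobMem.flag BobFlag.received))

/-- The memory after a command has been received. -/
def bobPreMem (m : BobMem ℓ τ ψ → Bit) (a : AdvWire (Fin ψ × Fin τ) ℓ τ → Bit) :
    BobMem ℓ τ ψ → Bit
  | BobMem.flag BobFlag.keyed => m (BobMem.flag BobFlag.keyed) + bobKeyNow m a
  | BobMem.flag BobFlag.received => m (BobMem.flag BobFlag.received) + bobMsgNow m a
  | BobMem.flag BobFlag.released => m (BobMem.flag BobFlag.released) +
      a (AdvWire.box (BoxWire.is BoxKind.releaseA)) * m (BobMem.flag BobFlag.keyed) *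
        (1 + m (BobMem.flag BobFlag.released))
  | BobMem.flag BobFlag.isAnswer =>
      a (AdvWire.box (BoxWire.is BoxKind.query)) * m (BobMem.flag BobFlag.keyed)
  | BobMem.flag BobFlag.answer =>
      a (AdvWire.box (BoxWire.is BoxKind.query)) * m (BobMem.flag BobFlag.keyed) *
        ∏ j, (1 + (a (AdvWire.box (BoxWire.key j)) + m (BobMem.key (BWire.glob j))))
  | BobMem.key w => m (BobMem.key w) + bobKeyNow m a * a (AdvWire.box (BoxWire.shareB w))
  | BobMem.msg w => m (BobMem.msg w) + bobMsgNow m a * a (AdvWire.msg w)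

/-- The call of the ideal box by the simulator. It chooses the keys when both the keys and the
message are there. -/
def bobPreBox (m : BobMem ℓ τ ψ → Bit) (a : AdvWire (Fin ψ × Fin τ) ℓ τ → Bit) : BoxWire ℓ ψ → Bit
  | BoxWire.is BoxKind.chooseB => bobKeyNow m a * m (BobMem.flag BobFlag.received) +
      bobMsgNow m a * m (BobMem.flag BobFlag.keyed)
  | BoxWire.is BoxKind.releaseA => a AdvWire.isWakeA * m (BobMem.flag BobFlag.released)
  | BoxWire.shareB (BWire.glob i) =>
      press (fun w => bobPreMem m a (BobMem.msg w))
        (fun k => bobPreMem m a (BobMem.key (BWire.glob k))) i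
  | BoxWire.shareB (BWire.loc i j) =>
      press (fun w => bobPreMem m a (BobMem.msg w))
        (fun k => bobPreMem m a (BobMem.key (BWire.loc i k))) j
  | _ => 0

/-- The memory at the end of an activation. -/
def bobPostMem (m : BobMem ℓ τ ψ → Bit) : BobMem ℓ τ ψ → Bit
  | BobMem.flag BobFlag.isAnswer => 0
  | BobMem.flag BobFlag.answer => 0
  | w => m w

/-- The reply of the simulator to the environment. -/
def bobReply (m : BobMem ℓ τ ψ → Bit) : ReplyWire (Fin ψ × Fin τ) τ → Bit
  | ReplyWire.resp RespWire.isAnswer => m (BobMem.flag BobFlag.isAnswer)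
  | ReplyWire.resp RespWire.answer => m (BobMem.flag BobFlag.answer)
  | _ => 0

/-- The circuit of the simulator for the command of the environment. -/
theorem computes_bobPre {n : ℕ} (hn : ψ + τ + ℓ + 1 ≤ n) :
    Computes (fun x : Empty ⊕ BobMem ℓ τ ψ ⊕ AdvWire (Fin ψ × Fin τ) ℓ τ → Bit =>
      Sum.elim
        (bobPreMem (fun w => x (Sum.inr (Sum.inl w))) fun w => x (Sum.inr (Sum.inr w)))
        (bobPreBox (fun w => x (Sum.inr (Sum.inl w))) fun w => x (Sum.inr (Sum.inr w))))
      (500 * n ^ 3) := by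
  let ρ := Empty ⊕ BobMem ℓ τ ψ ⊕ AdvWire (Fin ψ × Fin τ) ℓ τ
  have i (w : ρ) := ComputesBit.input w
  have k (b : Bit) := ComputesBit.const (ι := ρ) b
  have hkey : ComputesBit (fun x : ρ → Bit =>
      bobKeyNow (fun w => x (Sum.inr (Sum.inl w))) fun w => x (Sum.inr (Sum.inr w))) 3 :=
    ((i _).mul ((k 1).add (i _))).mono (by norm_num)
  have hmsg : ComputesBit (fun x : ρ → Bit =>
      bobMsgNow (fun w => x (Sum.inr (Sum.inl w))) fun w => x (Sum.inr (Sum.inr w))) 3 :=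
    ((i _).mul ((k 1).add (i _))).mono (by norm_num)
  have hnewKey : ∀ w, ComputesBit (fun x : ρ → Bit =>
      bobPreMem (fun w => x (Sum.inr (Sum.inl w))) (fun w => x (Sum.inr (Sum.inr w)))
        (BobMem.key w)) 5 := fun w => ((i _).add (hkey.mul (i _))).mono (by norm_num)
  have hnewMsg : ∀ w, ComputesBit (fun x : ρ → Bit =>
      bobPreMem (fun w => x (Sum.inr (Sum.inl w))) (fun w => x (Sum.inr (Sum.inr w)))
        (BobMem.msg w)) 5 := fun w => ((i _).add (hmsg.mul (i _))).mono (by norm_num)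
  have hm : Computes (fun x : ρ → Bit =>
      bobPreMem (fun w => x (Sum.inr (Sum.inl w))) fun w => x (Sum.inr (Sum.inr w)))
      (Fintype.card (BobMem ℓ τ ψ) * (20 * n)) := by
    refine Computes.of_bits_const ?_
    rintro (f | w | w)
    · cases f
      · exact ((i _).add hkey).mono (by omega)
      · exact ((i _).add hmsg).mono (by omega)
      · exact ((i _).add (((i _).mul (i _)).mul ((k 1).add (i _)))).mono (by omega)
      · exact ((i _).mul (i _)).mono (by omega)
      · refine (((i _).mul (i _)).mul (ComputesBit.prod fun j =>
          (k 1).add ((i _).add (i _)))).mono ?_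
        rw [Fintype.card_fin]
        omega
    · exact (hnewKey w).mono (by omega)
    · exact (hnewMsg w).mono (by omega)
  have hb : Computes (fun x : ρ → Bit =>
      bobPreBox (fun w => x (Sum.inr (Sum.inl w))) fun w => x (Sum.inr (Sum.inr w)))
      (Fintype.card (BoxWire ℓ ψ) * (20 * n)) := by
    have hp : τ * (5 + 5 + 2) + 1 ≤ 20 * n := by omega
    refine Computes.of_bits_const ?_
    rintro (_ | _ | _ | _ | _ | (_ | _))
    · next b =>
      cases b
      case chooseB => exact ((hkey.mul (i _)).add (hmsg.mul (i _))).mono (by omega)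
      case releaseA => exact ((i _).mul (i _)).mono (by omega)
      all_goals exact (k 0).mono (by omega)
    · exact (k 0).mono (by omega)
    · exact (k 0).mono (by omega)
    · exact (k 0).mono (by omega)
    · exact (k 0).mono (by omega)
    · exact (ComputesBit.dotProduct (fun _ => hnewMsg _) (fun _ => hnewKey _)).mono hp
    · exact (ComputesBit.dotProduct (fun _ => hnewMsg _) (fun _ => hnewKey _)).mono hp
  refine (hm.elim hb).mono ?_
  have h1 := Nat.mul_le_mul_right (20 * n) (card_boxWire_le (ψ := ψ) (ℓ := ℓ) (n := n) (by omega))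
  have h2 := Nat.mul_le_mul_right (20 * n) (card_bobMem_le hn)
  have h3 : 11 * n ^ 2 * (20 * n) = 220 * n ^ 3 := by ring
  have h4 : 8 * n ^ 2 * (20 * n) = 160 * n ^ 3 := by ring
  omega

/-- The circuit of the simulator for the response of the ideal box, which it ignores. -/
theorem computes_bobPost {n : ℕ} (hn : ψ + τ + ℓ + 1 ≤ n) :
    Computes (fun x : Empty ⊕ BobMem ℓ τ ψ ⊕ RespWire ψ → Bit =>
      Sum.elim (bobPostMem fun w => x (Sum.inr (Sum.inl w)))
        (bobReply fun w => x (Sum.inr (Sum.inl w)))) (15 * n ^ 2) := by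
  let ρ := Empty ⊕ BobMem ℓ τ ψ ⊕ RespWire ψ
  have i (w : ρ) := ComputesBit.input w
  have k (b : Bit) := ComputesBit.const (ι := ρ) b
  have hm : Computes (fun x : ρ → Bit => bobPostMem fun w => x (Sum.inr (Sum.inl w)))
      (Fintype.card (BobMem ℓ τ ψ) * 1) := by
    refine Computes.of_bits_const ?_
    rintro (f | w | w)
    · cases f
      case isAnswer => exact k 0
      case answer => exact k 0
      all_goals exact (i _).mono (by norm_num)
    · exact (i _).mono (by norm_num)
    · exact (i _).mono (by norm_num)
  have hr : Computes (fun x : ρ → Bit => bobReply fun w => x (Sum.inr (Sum.inl w)))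
      (Fintype.card (ReplyWire (Fin ψ × Fin τ) τ) * 1) := by
    refine Computes.of_bits_const ?_
    rintro ((_ | _ | _ | _ | _) | _ | _)
    · exact (i _).mono (by norm_num)
    · exact (i _).mono (by norm_num)
    all_goals exact k 0
  refine (hm.elim hr).mono ?_
  have h1 := card_replyWire_le (ψ := ψ) (τ := τ) (n := n) (by omega)
  have h2 := card_bobMem_le hn
  omega

/-- The simulator for corrupted `B`. -/
def bobSim (ℓ τ ψ : ℕ) : Simulator (Fin ψ × Fin τ) ℓ τ ψ where
  Tape := Empty
  Mem := BobMem ℓ τ ψ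
  pre := (computes_bobPre (le_refl (ψ + τ + ℓ + 1))).exists_circuit.choose
  post := (computes_bobPost (le_refl (ψ + τ + ℓ + 1))).exists_circuit.choose

theorem bobSim_cost_le (ℓ τ ψ : ℕ) : (bobSim ℓ τ ψ).cost ≤ 1500 * (ψ + τ + ℓ + 1) ^ 6 := by
  set n := ψ + τ + ℓ + 1 with hn
  have h1 : (bobSim ℓ τ ψ).pre.size ≤ 500 * n ^ 3 :=
    (computes_bobPre (ψ := ψ) (τ := τ) (ℓ := ℓ) le_rfl).exists_circuit.choose_spec.1
  have h2 : (bobSim ℓ τ ψ).post.size ≤ 15 * n ^ 2 :=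
    (computes_bobPost (ψ := ψ) (τ := τ) (ℓ := ℓ) le_rfl).exists_circuit.choose_spec.1
  have h3 : Fintype.card (bobSim ℓ τ ψ).Tape = 0 := Fintype.card_empty
  have h4 : Fintype.card (bobSim ℓ τ ψ).Mem ≤ 8 * n ^ 2 := card_bobMem_le le_rfl
  rw [Simulator.cost, h3]
  have hn1 : 1 ≤ n := by omega
  have h5 : n ^ 3 ≤ n ^ 6 := Nat.pow_le_pow_right hn1 (by norm_num)
  have h6 : n ^ 2 ≤ n ^ 6 := Nat.pow_le_pow_right hn1 (by norm_num)
  omega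

/-- The memory with given contents. -/
def mkBobMem (keyed received released isAnswer answer : Bit) (b : BShare ℓ τ)
    (A : Fin ψ × Fin τ → Bit) : BobMem ℓ τ ψ → Bit
  | BobMem.flag BobFlag.keyed => keyed
  | BobMem.flag BobFlag.received => received
  | BobMem.flag BobFlag.released => released
  | BobMem.flag BobFlag.isAnswer => isAnswer
  | BobMem.flag BobFlag.answer => answer
  | BobMem.key w => b w
  | BobMem.msg w => A w

/-- An activation in the ideal world after the command of the environment has been turned into the
call `y` of the ideal box and the memory `m`. -/
def bobFinish (s : WaState ℓ ψ) (y : Option (BoxCmd (neverLeak ψ) ℓ ψ)) (m : BobMem ℓ τ ψ → Bit) :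
    PMF (IdealState (bobSim ℓ τ ψ) × Obs (Fin ψ × Fin τ) ℓ τ ψ) :=
  (callIdeal Corr.bob s y).map fun r =>
    ({ box := r.1, tape := Empty.elim, mem := bobPostMem m },
      { resp := decodeResp fun w => bobReply m (ReplyWire.resp w)
        outA := r.2.toA
        outB := r.2.toB })

/-- The circuits of the simulator compute `bobPreMem`, `bobPreBox`, `bobPostMem` and `bobReply`. -/
theorem idealStep_bobSim {𝓛 : Set (Leakage τ)} (s : WaState ℓ ψ) (m : BobMem ℓ τ ψ → Bit)
    (q : AdvCmd 𝓛 (Fin ψ × Fin τ) ℓ τ) :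
    idealStep (bobSim ℓ τ ψ) 𝓛 Corr.bob ⟨s, Empty.elim, m⟩ q =
      (sampleLeak q).bind fun q' => bobFinish s
        (decodeBox (bobPreBox m (encodeAdv q'))) (bobPreMem m (encodeAdv q')) := by
  have h1 : ∀ x, (bobSim ℓ τ ψ).pre.run x = _ :=
    (computes_bobPre (ψ := ψ) (τ := τ) (ℓ := ℓ) le_rfl).exists_circuit.choose_spec.2
  have h2 : ∀ x, (bobSim ℓ τ ψ).post.run x = _ :=
    (computes_bobPost (ψ := ψ) (τ := τ) (ℓ := ℓ) le_rfl).exists_circuit.choose_spec.2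
  unfold idealStep
  simp only [h1, h2]
  rfl

end bobSim

/-! ### Indistinguishability for corrupted `B` -/

section bobRun

open Matrix

variable {ℓ τ ψ : ℕ}

section decode

variable (k r l : Bit) (b : BShare ℓ τ) (A : Fin ψ × Fin τ → Bit)

/-- The ideal box is called only to choose keys or to release the output of `A`. -/
theorem decode_bobPreBox (m : BobMem ℓ τ ψ → Bit) (a : AdvWire (Fin ψ × Fin τ) ℓ τ → Bit) :
    decodeBox (bobPreBox m a) =
      if bobKeyNow m a * m (BobMem.flag BobFlag.received) +
          bobMsgNow m a * m (BobMem.flag BobFlag.keyed) = 1 then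
        some (BoxCmd.chooseB (pressB (fun w => bobPreMem m a (BobMem.msg w))
          fun w => bobPreMem m a (BobMem.key w)))
      else if a AdvWire.isWakeA * m (BobMem.flag BobFlag.released) = 1 then some BoxCmd.releaseA
      else none := by
  have : (fun w => bobPreBox m a (BoxWire.shareB w)) =
      pressB (fun w => bobPreMem m a (BobMem.msg w)) fun w => bobPreMem m a (BobMem.key w) := by
    funext w; cases w <;> rfl
  simp only [decodeBox, this]
  simp [bobPreBox]

theorem bobPreMem_query (G : Fin τ → Bit) :
    bobPreMem (mkBobMem k r l 0 0 b A) (encodeAdv (AdvCmd.box (BoxCmd.query G))) =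
      mkBobMem k r l k (k * ∏ j, (1 + (G j + b (BWire.glob j)))) b A := by
  funext w
  rcases w with (_ | _ | _ | _ | _) | _ | _ <;>
    simp [bobPreMem, bobKeyNow, bobMsgNow, mkBobMem, encodeAdv, encodeBox]

theorem bobPreMem_leak (p : Finset (Fin τ) × Bool) :
    bobPreMem (mkBobMem k r l 0 0 b A) (encodeAdv (AdvCmd.box (BoxCmd.leak p))) =
      mkBobMem k r l 0 0 b A := by
  funext w
  rcases w with (_ | _ | _ | _ | _) | _ | _ <;>
    simp [bobPreMem, bobKeyNow, bobMsgNow, mkBobMem, encodeAdv, encodeBox]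

theorem bobPreMem_chooseA (a : AShare ℓ τ) :
    bobPreMem (mkBobMem k r l 0 0 b A) (encodeAdv (AdvCmd.box (BoxCmd.chooseA a))) =
      mkBobMem k r l 0 0 b A := by
  funext w
  rcases w with (_ | _ | _ | _ | _) | _ | _ <;>
    simp [bobPreMem, bobKeyNow, bobMsgNow, mkBobMem, encodeAdv, encodeBox]

theorem bobPreMem_chooseB (b' : BShare ℓ τ) :
    bobPreMem (mkBobMem k r l 0 0 b A) (encodeAdv (AdvCmd.box (BoxCmd.chooseB b'))) =
      mkBobMem (k + (1 + k)) r l 0 0 (fun w => b w + (1 + k) * b' w) A := by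
  funext w
  rcases w with (_ | _ | _ | _ | _) | _ | _ <;>
    simp [bobPreMem, bobKeyNow, bobMsgNow, mkBobMem, encodeAdv, encodeBox]

theorem bobPreMem_releaseA :
    bobPreMem (mkBobMem k r l 0 0 b A) (encodeAdv (AdvCmd.box BoxCmd.releaseA)) =
      mkBobMem k r (l + k * (1 + l)) 0 0 b A := by
  funext w
  rcases w with (_ | _ | _ | _ | _) | _ | _ <;>
    simp [bobPreMem, bobKeyNow, bobMsgNow, mkBobMem, encodeAdv, encodeBox]

theorem bobPreMem_releaseB :
    bobPreMem (mkBobMem k r l 0 0 b A) (encodeAdv (AdvCmd.box BoxCmd.releaseB)) =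
      mkBobMem k r l 0 0 b A := by
  funext w
  rcases w with (_ | _ | _ | _ | _) | _ | _ <;>
    simp [bobPreMem, bobKeyNow, bobMsgNow, mkBobMem, encodeAdv, encodeBox]

theorem bobPreMem_wakeA :
    bobPreMem (mkBobMem k r l 0 0 b A) (encodeAdv AdvCmd.wakeA) = mkBobMem k r l 0 0 b A := by
  funext w
  rcases w with (_ | _ | _ | _ | _) | _ | _ <;>
    simp [bobPreMem, bobKeyNow, bobMsgNow, mkBobMem, encodeAdv]

theorem bobPreMem_wakeB :
    bobPreMem (mkBobMem k r l 0 0 b A) (encodeAdv AdvCmd.wakeB) = mkBobMem k r l 0 0 b A := by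
  funext w
  rcases w with (_ | _ | _ | _ | _) | _ | _ <;>
    simp [bobPreMem, bobKeyNow, bobMsgNow, mkBobMem, encodeAdv]

theorem bobPreMem_deliver :
    bobPreMem (mkBobMem k r l 0 0 b A) (encodeAdv AdvCmd.deliver) = mkBobMem k r l 0 0 b A := by
  funext w
  rcases w with (_ | _ | _ | _ | _) | _ | _ <;>
    simp [bobPreMem, bobKeyNow, bobMsgNow, mkBobMem, encodeAdv]

theorem bobPreMem_send (A' : Fin ψ × Fin τ → Bit) :
    bobPreMem (mkBobMem k r l 0 0 b A) (encodeAdv (AdvCmd.send A')) =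
      mkBobMem k (r + (1 + r)) l 0 0 b (fun w => A w + (1 + r) * A' w) := by
  funext w
  rcases w with (_ | _ | _ | _ | _) | _ | _ <;>
    simp [bobPreMem, bobKeyNow, bobMsgNow, mkBobMem, encodeAdv]

theorem bobFinish_mkBobMem (s : WaState ℓ ψ) (y : Option (BoxCmd (neverLeak ψ) ℓ ψ))
    (u v : Bit) : bobFinish s y (mkBobMem k r l u v b A) =
      (callIdeal Corr.bob s y).map fun o =>
        ({ box := o.1, tape := Empty.elim, mem := mkBobMem k r l 0 0 b A },
          { resp := if u = 1 then Resp.answer (decide (v = 1)) else Resp.none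
            outA := o.2.toA
            outB := o.2.toB }) := by
  have h : bobPostMem (mkBobMem k r l u v b A) = mkBobMem k r l 0 0 b A := by
    funext w
    rcases w with (_ | _ | _ | _ | _) | _ | _ <;> rfl
  rw [bobFinish, h]
  simp [decodeResp, bobReply, mkBobMem]
  rfl

end decode

/-- The state of a run with corrupted `B`: the keys of `B` have not been chosen, they have been
chosen but `A` has not received a message, or both have happened. The Booleans record whether `A`
has obtained its output of the box and has produced its output. The bits `x` of `A` are sampled
last. -/
inductive BobState (ℓ τ ψ : ℕ) : Type
  | idle (m : Option (Fin ψ × Fin τ → Bit)) : BobState ℓ τ ψ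
  | keyed (b : BShare ℓ τ) (released : Bool) : BobState ℓ τ ψ
  | ready (b : BShare ℓ τ) (A : Fin ψ × Fin τ → Bit) (x : Fin ℓ → Bit) (released done : Bool) :
    BobState ℓ τ ψ

/-- An activation of the protocol with corrupted `B`. -/
def bobStep (𝓛 : Set (Leakage τ)) (s : BobState ℓ τ ψ) (q : AdvCmd 𝓛 (Fin ψ × Fin τ) ℓ τ) :
    PMF (Option (BobState ℓ τ ψ × Obs (Fin ψ × Fin τ) ℓ τ ψ)) :=
  match q with
  | AdvCmd.box (BoxCmd.query G) =>
    match s with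
    | BobState.idle _ => PMF.pure (some (s, {}))
    | BobState.keyed b _ => PMF.pure (some (s,
        { resp := Resp.answer (decide (G = fun j => b (BWire.glob j))) }))
    | BobState.ready b _ _ _ _ => PMF.pure (some (s,
        { resp := Resp.answer (decide (G = fun j => b (BWire.glob j))) }))
  | AdvCmd.box (BoxCmd.chooseB b) =>
    match s with
    | BobState.idle none => PMF.pure (some (BobState.keyed b false, {}))
    | BobState.idle (some A) => (PMF.uniformOfFintype (Fin ℓ → Bit)).map fun x =>
        some (BobState.ready b A x false false, {})
    | _ => PMF.pure (some (s, {}))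
  | AdvCmd.box BoxCmd.releaseA =>
    match s with
    | BobState.idle _ => PMF.pure (some (s, {}))
    | BobState.keyed b _ => PMF.pure (some (BobState.keyed b true, {}))
    | BobState.ready b A x _ d => PMF.pure (some (BobState.ready b A x true d, {}))
  | AdvCmd.wakeA =>
    match s with
    | BobState.ready b A x true false => PMF.pure (some (BobState.ready b A x true true,
        { outA := some (toAShare x (pressB A b)) }))
    | _ => PMF.pure (some (s, {}))
  | AdvCmd.send A =>
    match s with
    | BobState.idle none => PMF.pure (some (BobState.idle (some A), {}))
    | BobState.keyed b l => (PMF.uniformOfFintype (Fin ℓ → Bit)).map fun x =>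
        some (BobState.ready b A x l false, {})
    | _ => PMF.pure (some (s, {}))
  | _ => PMF.pure (some (s, {}))

/-- The state of the box when `B` has chosen `b` and `A` has the bits `x`. -/
def bobBox {n : ℕ} (b : BShare ℓ n) (x : Fin ℓ → Bit) (released : Bool) : WaState ℓ n where
  key := some fun j => b (BWire.glob j)
  shareA := some (toAShare x b)
  shareB := some b
  releasedA := released

/-- The states of the hybrid model that are represented by a run with corrupted `B`. -/
def BobState.toHybrid : BobState ℓ τ ψ → PMF (HybridState (compress ℓ τ ψ))
  | BobState.idle m => PMF.pure { box := {}, received := m }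
  | BobState.keyed b l => (PMF.uniformOfFintype (Fin ℓ → Bit)).map fun x =>
      { box := bobBox b x l, alice := if l = true then some (toAShare x b) else none }
  | BobState.ready b A x l d => PMF.pure
      { box := bobBox b x l, alice := if l = true then some (toAShare x b) else none,
        received := some A, doneA := d }

/-- The state of the ideal world that is represented by a run with corrupted `B`. -/
def BobState.toIdeal : BobState ℓ τ ψ → IdealState (bobSim ℓ τ ψ)
  | BobState.idle none => ⟨{}, Empty.elim, mkBobMem 0 0 0 0 0 0 0⟩
  | BobState.idle (some A) => ⟨{}, Empty.elim, mkBobMem 0 1 0 0 0 0 A⟩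
  | BobState.keyed b l => ⟨{}, Empty.elim, mkBobMem 1 0 (toBit l) 0 0 b 0⟩
  | BobState.ready b A x l d => ⟨bobBox (pressB A b) x d, Empty.elim,
      mkBobMem 1 1 (toBit l) 0 0 b A⟩

/-- An activation of the protocol with corrupted `B` amounts to one of `bobStep`. In the protocol
the bits of `A` are sampled together with the keys, in `bobStep` only after the message has arrived.
-/
theorem hybridStep_bob {𝓛 : Set (Leakage τ)} (s : BobState ℓ τ ψ)
    (q : AdvCmd 𝓛 (Fin ψ × Fin τ) ℓ τ) :
    (s.toHybrid.bind fun s' => (hybridStep (compress ℓ τ ψ) 𝓛 Corr.bob s' q).map some) =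
      (bobStep 𝓛 s q).bind (liftKernel BobState.toHybrid) := by
  have hout : ∀ (x : Fin ℓ → Bit) (b : BShare ℓ τ) (A : Fin ψ × Fin τ → Bit),
      (compress ℓ τ ψ).outA (toAShare x b) A = toAShare x (pressB A b) :=
    fun x b A => pressA_toAShare A x b
  -- Each combination of a state and a command is a computation.
  rcases s with (_ | _) | ⟨b, _ | _⟩ | ⟨b, A, x, _ | _, _ | _⟩ <;>
    rcases q with (_ | _ | _ | _ | _ | _) | _ | _ | _ | _
  all_goals
    simp [BobState.toHybrid, bobStep, liftKernel, hybridStep, waStep, bobBox, hout,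
      ← PMF.bind_pure_comp, Function.comp_def]
    try rfl

/-- An activation of the ideal world with corrupted `B` is one of `bobStep`. -/
theorem idealStep_bob {𝓛 : Set (Leakage τ)} (s : BobState ℓ τ ψ)
    (q : AdvCmd 𝓛 (Fin ψ × Fin τ) ℓ τ) :
    (idealStep (bobSim ℓ τ ψ) 𝓛 Corr.bob s.toIdeal q).map some =
      (bobStep 𝓛 s q).map (Option.map fun r => (BobState.toIdeal r.1, r.2)) := by
  have ht : toBit true = 1 := rfl
  have hf : toBit false = 0 := rfl
  have hq : ∀ (G : Fin τ → Bit) (b : BShare ℓ τ),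
      (∏ j, (1 + (G j + b (BWire.glob j))) = 1) = (G = fun j => b (BWire.glob j)) := by
    intro G b
    rw [← vec_add_eq_zero_iff, ← prod_eq_one_iff]
    rfl
  rcases s with (_ | A) | ⟨b, _ | _⟩ | ⟨b, A, x, _ | _, _ | _⟩ <;>
    simp only [BobState.toIdeal] <;> rw [idealStep_bobSim] <;>
    rcases q with (G | L | a | b' | _ | _) | _ | _ | _ | A'
  all_goals
    simp only [sampleLeak, PMF.pure_bind, PMF.bind_map, Function.comp_def, bobPreMem_query,
      bobPreMem_leak, bobPreMem_chooseA, bobPreMem_chooseB, bobPreMem_releaseA,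
      bobPreMem_releaseB, bobPreMem_wakeA, bobPreMem_wakeB, bobPreMem_deliver, bobPreMem_send,
      decode_bobPreBox, bobFinish_mkBobMem, hf, ht]
    simp [bobStep, callIdeal, waStep, bobBox, bobKeyNow, bobMsgNow, mkBobMem, encodeAdv, encodeBox,
      bit_one_add_one, PMF.pure_map, PMF.map_comp, Function.comp_def, hq]
    try rfl

/-- The simulator for corrupted `B` is perfect. -/
theorem prob_bob {𝓛 : Set (Leakage τ)}
    (E : Env (AdvCmd 𝓛 (Fin ψ × Fin τ) ℓ τ) (Obs (Fin ψ × Fin τ) ℓ τ ψ)) :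
    E.prob (hybrid (compress ℓ τ ψ) 𝓛 Corr.bob) = E.prob (ideal (bobSim ℓ τ ψ) 𝓛 Corr.bob) := by
  have h1 : (hybrid (compress ℓ τ ψ) 𝓛 Corr.bob).init =
      BobState.toHybrid (ℓ := ℓ) (τ := τ) (ψ := ψ) (BobState.idle none) := PMF.pure_map _ _
  have h2 : (ideal (bobSim ℓ τ ψ) 𝓛 Corr.bob).init =
      PMF.pure (BobState.toIdeal (ℓ := ℓ) (τ := τ) (ψ := ψ) (BobState.idle none)) := by
    refine (PMF.pure_bind _ _).trans ?_
    have ht : ∀ t : Empty → Bit, t = Empty.elim := fun t => funext fun e => e.elim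
    have hm : (fun _ => 0 : BobMem ℓ τ ψ → Bit) = mkBobMem 0 0 0 0 0 0 0 := by
      funext w
      rcases w with (_ | _ | _ | _ | _) | _ | _ <;> rfl
    refine Eq.trans ?_ (PMF.map_const (PMF.uniformOfFintype (Empty → Bit)) _)
    refine congrArg (fun f => PMF.map f (PMF.uniformOfFintype (Empty → Bit))) (funext fun t => ?_)
    rw [ht t]
    exact congrArg (fun m => (⟨{}, Empty.elim, m⟩ : IdealState (bobSim ℓ τ ψ))) hm
  have h3 : ∀ c : BobState ℓ τ ψ, c.toHybrid.bind
      (playStop E (hybrid (compress ℓ τ ψ) 𝓛 Corr.bob).stepStop E.rounds []) =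
      playStop E (bobStep 𝓛) E.rounds [] c :=
    bind_playStop E hybridStep_bob E.rounds []
  have h4 := play_embed E (ideal (bobSim ℓ τ ψ) 𝓛 Corr.bob) BobState.toIdeal idealStep_bob
    E.rounds [] (BobState.idle none)
  have h5 : (ideal (bobSim ℓ τ ψ) 𝓛 Corr.bob).init.bind
      (E.play (ideal (bobSim ℓ τ ψ) 𝓛 Corr.bob) E.rounds []) =
      E.play (ideal (bobSim ℓ τ ψ) 𝓛 Corr.bob) E.rounds [] (BobState.idle none).toIdeal := by
    rw [h2]
    exact PMF.pure_bind _ _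
  have h6 : ((hybrid (compress ℓ τ ψ) 𝓛 Corr.bob).init.bind
      (E.play (hybrid (compress ℓ τ ψ) 𝓛 Corr.bob) E.rounds [])).map some =
      playStop E (bobStep 𝓛) E.rounds [] (BobState.idle none : BobState ℓ τ ψ) := by
    rw [h1, ← h3]
    refine (PMF.map_bind _ _ _).trans (congrArg (PMF.bind _) (funext fun s => ?_))
    exact (playStop_stepStop E (hybrid (compress ℓ τ ψ) 𝓛 Corr.bob) _ _ s).symm
  rw [← h4, ← h5] at h6
  have h7 := congrFun (congrArg DFunLike.coe h6) (some true)
  rw [map_some_apply, map_some_apply] at h7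
  exact congrArg ENNReal.toReal h7

end bobRun

/-! ### Security of the leakage class -/

section security

variable {τ : ℕ}

theorem success_le {𝓛 : Set (Leakage τ)} {κ : ℝ} (h : IsSecure 𝓛 κ) :
    success 𝓛 ≤ ENNReal.ofReal (2 ^ (-κ)) := by
  by_cases h0 : success 𝓛 = 0
  · rw [h0]; exact zero_le
  have h1 : success 𝓛 ≤ 1 := iSup₂_le fun L _ => iSup_le fun g => PMF.coe_le_one _ _
  have htop : success 𝓛 ≠ ⊤ := ne_top_of_le_ne_top ENNReal.one_ne_top h1
  have hpos : 0 < (success 𝓛).toReal := ENNReal.toReal_pos h0 htop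
  have hlog2 : 0 < Real.log 2 := Real.log_pos (by norm_num)
  rw [IsSecure, leak, ENNReal.log_pos_real h0 htop] at h
  have h2 : κ ≤ (τ : ℝ) - (Real.log (success 𝓛).toReal / Real.log 2 + τ) := by
    rwa [← EReal.coe_div, ← EReal.coe_add, ← EReal.coe_sub, EReal.coe_le_coe_iff] at h
  have h3 : κ * Real.log 2 ≤ -Real.log (success 𝓛).toReal := by
    have : Real.log (success 𝓛).toReal / Real.log 2 * Real.log 2 =
      Real.log (success 𝓛).toReal := by field_simp
    nlinarith
  rw [← ENNReal.ofReal_toReal htop]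
  refine ENNReal.ofReal_le_ofReal ?_
  rw [Real.rpow_def_of_pos (by norm_num), ← Real.log_le_iff_le_exp hpos]
  linarith

/-- The number of keys that the guess `0` outside `S` hits. -/
theorem card_agree (S : Finset (Fin τ)) :
    (Finset.univ.filter fun Γ : Fin τ → Bit => ∀ i, i ∉ S → Γ i = 0).card = 2 ^ S.card := by
  have : (Finset.univ.filter fun Γ : Fin τ → Bit => ∀ i, i ∉ S → Γ i = 0) =
      Fintype.piFinset fun i => if i ∈ S then Finset.univ else {0} := by
    ext Γ
    simp only [Finset.mem_filter, Finset.mem_univ, true_and, Fintype.mem_piFinset]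
    refine forall_congr' fun i => ?_
    by_cases hi : i ∈ S <;> simp [hi]
  rw [this, Fintype.card_piFinset]
  simp only [apply_ite Finset.card, Finset.card_univ, Finset.card_singleton, ZMod.card]
  rw [Finset.prod_ite, Finset.prod_const, Finset.prod_const_one, mul_one,
    Finset.filter_mem_eq_inter, Finset.univ_inter]

/-- An adversary that guesses `0` for each bit that is not leaked. -/
theorem tsum_le_success {𝓛 : Set (Leakage τ)} {L : Leakage τ} (hL : L ∈ 𝓛) :
    ∑' p, L p * (if p.2 = true then 2 ^ p.1.card * (2 ^ τ)⁻¹ else 0) ≤ success 𝓛 := by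
  classical
  refine le_trans (le_of_eq ?_)
    (le_iSup₂_of_le L hL (le_iSup (fun g => guessGame L g True) fun _ => PMF.pure 0))
  rw [guessGame, PMF.bind_comm, PMF.bind_apply]
  refine tsum_congr fun p => congrArg _ ?_
  simp only [PMF.pure_map, PMF.bind_apply, PMF.uniformOfFintype_apply, PMF.pure_apply,
    tsum_fintype, ← Finset.mul_sum]
  by_cases hp : p.2 = true
  · simp only [hp, true_and, if_true]
    have hc : (2 : ℝ≥0∞) ^ p.1.card =
        (Finset.univ.filter fun Γ : Fin τ → Bit => ∀ i, i ∉ p.1 → Γ i = 0).card := by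
      exact_mod_cast (card_agree p.1).symm
    rw [hc, mul_comm]
    congr 1
    · simp
    · rw [Finset.card_eq_sum_ones, Finset.sum_filter]
      simp [eq_comm]
  · simp [hp]

theorem badProb_le (ψ : ℕ) (S : Finset (Fin τ)) :
    badProb ψ S ≤ 2 ^ ψ * (2 ^ S.card * (2 ^ τ)⁻¹) := by
  classical
  have h := card_not_good_mul_le (ψ := ψ) S
  have hb : badProb ψ S = (Finset.univ.filter fun A : Fin ψ × Fin τ → Bit => ¬ Good A S).card *
      (Fintype.card (Fin ψ × Fin τ → Bit) : ℝ≥0∞)⁻¹ := by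
    unfold badProb
    simp only [PMF.uniformOfFintype_apply, tsum_fintype, ← Finset.mul_sum]
    rw [mul_comm, Finset.card_eq_sum_ones, Finset.sum_filter]
    congr 1
    push_cast
    refine Finset.sum_congr rfl fun A _ => ?_
    by_cases hA : Good A S <;> simp [hA]
  have hS : S.card ≤ τ := by simpa using Finset.card_le_univ S
  have hN0 : (Fintype.card (Fin ψ × Fin τ → Bit) : ℝ≥0∞) ≠ 0 := by simp
  have hNt : (Fintype.card (Fin ψ × Fin τ → Bit) : ℝ≥0∞) ≠ ⊤ := ENNReal.natCast_ne_top _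
  rw [hb, ← div_eq_mul_inv, ← div_eq_mul_inv, ← mul_div_assoc]
  refine ENNReal.div_le_of_le_mul ?_
  rw [div_eq_mul_inv, mul_right_comm, ← div_eq_mul_inv]
  rw [ENNReal.le_div_iff_mul_le (by simp) (by simp)]
  have h' : (Finset.univ.filter fun A : Fin ψ × Fin τ → Bit => ¬ Good A S).card * 2 ^ τ ≤
      2 ^ ψ * 2 ^ S.card * Fintype.card (Fin ψ × Fin τ → Bit) := by
    calc _ = (Finset.univ.filter fun A : Fin ψ × Fin τ → Bit => ¬ Good A S).card *
          2 ^ (τ - S.card) * 2 ^ S.card := by rw [mul_assoc, ← pow_add, Nat.sub_add_cancel hS]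
      _ ≤ 2 ^ ψ * Fintype.card (Fin ψ × Fin τ → Bit) * 2 ^ S.card := Nat.mul_le_mul_right _ h
      _ = _ := by ring
  exact_mod_cast h'

/-- The union bound for the matrix and the success of the guess of zeros have the same dependence on
the leaked set. -/
theorem leakLoss_le (ψ : ℕ) {𝓛 : Set (Leakage τ)} {L : Leakage τ} (hL : L ∈ 𝓛) :
    leakLoss ψ L ≤ 2 ^ ψ * success 𝓛 := by
  refine le_trans ?_ (mul_le_mul_right (tsum_le_success hL) _)
  rw [leakLoss, ← ENNReal.tsum_mul_left]
  refine ENNReal.tsum_le_tsum fun p => ?_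
  rw [mul_left_comm]
  refine mul_le_mul_right ?_ _
  by_cases hp : p.2 = true
  · simp only [hp, if_true]
    exact badProb_le ψ p.1
  · simp [hp]

theorem pow_mul_le_inv {ψ n : ℕ} (h : 2 * ψ ≤ n) : (2 : ℝ≥0∞) ^ ψ * (2 ^ n)⁻¹ ≤ (2 ^ ψ)⁻¹ := by
  have h1 : ((2 : ℝ≥0∞) ^ n)⁻¹ ≤ (2 ^ ψ)⁻¹ * (2 ^ ψ)⁻¹ := by
    rw [← ENNReal.mul_inv (by simp) (by simp), ← pow_add]
    exact ENNReal.inv_le_inv.2 (pow_le_pow_right₀ (by norm_num) (by omega))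
  refine (mul_le_mul_right h1 _).trans ?_
  rw [← mul_assoc, ENNReal.mul_inv_cancel (by simp) (by simp), one_mul]

theorem badProb_empty_le {ψ : ℕ} (h : 3 * τ = 22 * ψ) :
    badProb ψ (∅ : Finset (Fin τ)) ≤ (2 ^ ψ)⁻¹ := by
  refine (badProb_le ψ ∅).trans ?_
  rw [Finset.card_empty, pow_zero, one_mul]
  exact pow_mul_le_inv (by omega)

theorem leakLoss_le_of_isSecure {ψ : ℕ} (h : 3 * τ = 22 * ψ) {𝓛 : Set (Leakage τ)}
    (hs : IsSecure 𝓛 (3 / 4 * (τ : ℝ))) {L : Leakage τ} (hL : L ∈ 𝓛) :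
    leakLoss ψ L ≤ (2 ^ ψ)⁻¹ := by
  refine (leakLoss_le ψ hL).trans ((mul_le_mul_right ?_ _).trans (pow_mul_le_inv (le_refl (2 * ψ))))
  refine (success_le hs).trans ?_
  -- `3 / 4 * τ = 11 / 2 * ψ ≥ 2 * ψ`
  have h1 : (3 : ℝ) * τ = 22 * ψ := by exact_mod_cast h
  have h2 : (2 : ℝ) ^ (-(3 / 4 * (τ : ℝ))) ≤ ((2 : ℝ) ^ (2 * ψ))⁻¹ := by
    rw [← Real.rpow_natCast, ← Real.rpow_neg (by norm_num)]
    refine Real.rpow_le_rpow_of_exponent_le (by norm_num) ?_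
    push_cast
    have : (0 : ℝ) ≤ ψ := Nat.cast_nonneg ψ
    linarith
  refine (ENNReal.ofReal_le_ofReal h2).trans (le_of_eq ?_)
  rw [ENNReal.ofReal_inv_of_pos (by positivity), ENNReal.ofReal_pow (by norm_num)]
  simp

end security

/-! ### The compressed key in the view of corrupted `A` -/

section uniformKey

open Matrix

variable {τ ψ : ℕ}

/-- Probabilities in the experiment, with the global key sampled last. -/
theorem toOuterMeasure_keyGame (L : Leakage τ) (X : Set (KeyRun τ ψ)) :
    (keyGame ψ L).toOuterMeasure X =
      ∑' p, L p * ∑' m : Fin ψ × Fin τ → Bit, PMF.uniformOfFintype _ m *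
        (PMF.uniformOfFintype (Fin τ → Bit)).toOuterMeasure
          {Γ | (⟨Γ, p.1, p.2, asMatrix m⟩ : KeyRun τ ψ) ∈ X} := by
  have h : keyGame ψ L = L.bind fun p => (PMF.uniformOfFintype (Fin ψ × Fin τ → Bit)).bind fun m =>
      (PMF.uniformOfFintype (Fin τ → Bit)).map fun Γ => ⟨Γ, p.1, p.2, asMatrix m⟩ := by
    unfold keyGame
    rw [PMF.bind_comm]
    congr 1
    funext p
    simp only [← PMF.bind_pure_comp, Function.comp_def]
    rw [PMF.bind_comm]
  rw [h]
  simp only [PMF.toOuterMeasure_bind_apply, PMF.toOuterMeasure_map_apply]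
  rfl

/-- Given the bits that are leaked, the compression of a uniform key by a good matrix is uniform. -/
theorem toOuterMeasure_press {A : Fin ψ × Fin τ → Bit} {S : Finset (Fin τ)} (hA : Good A S)
    (w : Fin τ → Option Bit) (δ : Fin ψ → Bit) :
    (PMF.uniformOfFintype (Fin τ → Bit)).toOuterMeasure {Γ | reveal S Γ = w ∧ press A Γ = δ} =
      (2 ^ ψ)⁻¹ * (PMF.uniformOfFintype (Fin τ → Bit)).toOuterMeasure {Γ | reveal S Γ = w} := by
  classical
  set U := PMF.uniformOfFintype (Fin τ → Bit)
  -- The translation by a vector that is `0` on `S` and compressed to `δ + δ'`.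
  have hshift : ∀ δ' : Fin ψ → Bit, U.toOuterMeasure {Γ | reveal S Γ = w ∧ press A Γ = δ'} =
      U.toOuterMeasure {Γ | reveal S Γ = w ∧ press A Γ = δ} := by
    intro δ'
    have hσ : U.map (fun Γ => Γ + rightInv A S *ᵥ (δ + δ')) = U := by
      rw [← PMF.bind_pure_comp]
      refine (bind_uniform_comp (bijective_of_involutive fun Γ => ?_) PMF.pure).trans
        (PMF.bind_pure _)
      rw [add_assoc, vec_add_self, add_zero]
    conv_lhs => rw [← hσ]
    rw [PMF.toOuterMeasure_map_apply]
    congr 1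
    ext Γ
    have h1 : reveal S (Γ + rightInv A S *ᵥ (δ + δ')) = reveal S Γ :=
      reveal_congr fun j hj => by simp [rightInv_mulVec_apply hj]
    have h2 : press A Γ + (δ + δ') = δ' ↔ press A Γ = δ := by
      rw [← vec_add_eq_zero_iff (press A Γ), ← vec_add_eq_zero_iff _ δ', add_assoc, add_assoc,
        vec_add_self, add_zero]
    simp only [Set.mem_preimage, Set.mem_ofPred_eq, h1, press_add, press_rightInv hA, h2]
  have hsum : ∑ δ' : Fin ψ → Bit, U.toOuterMeasure {Γ | reveal S Γ = w ∧ press A Γ = δ'} =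
      U.toOuterMeasure {Γ | reveal S Γ = w} := by
    simp only [PMF.toOuterMeasure_apply_fintype]
    rw [Finset.sum_comm]
    refine Finset.sum_congr rfl fun Γ _ => ?_
    by_cases hw : reveal S Γ = w <;> simp [Set.indicator_apply, hw]
  simp only [hshift] at hsum
  rw [← hsum, Finset.sum_const, Finset.card_univ, nsmul_eq_mul, ← mul_assoc]
  simp [ENNReal.inv_mul_cancel]

theorem asMatrix_entries (m : Fin ψ × Fin τ → Bit) : (fun p => asMatrix m p.1 p.2) = m := rfl

/-- The compressed key is uniform unless an undetected sample has spoiled the matrix. -/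
theorem uniformExcept_leakLoss (ψ : ℕ) (L : Leakage τ) : UniformExcept ψ L (leakLoss ψ L) := by
  classical
  refine ⟨{r | r.undetected = true ∧ ¬ Good (fun p => r.matrix p.1 p.2) r.leakSet}, ?_, ?_⟩
  · rw [toOuterMeasure_keyGame, leakLoss]
    refine ENNReal.tsum_le_tsum fun p => mul_le_mul_right ?_ _
    by_cases hp : p.2 = true
    · simp only [hp, if_true, badProb]
      refine ENNReal.tsum_le_tsum fun A => mul_le_mul_right ?_ _
      by_cases hA : Good A p.1
      · simp [asMatrix_entries, hA]
      · rw [if_neg hA, ← (PMF.toOuterMeasure_apply_eq_one_iff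
          (PMF.uniformOfFintype (Fin τ → Bit)) Set.univ).2 (Set.subset_univ _)]
        exact MeasureTheory.measure_mono (Set.subset_univ _)
    · simp [hp]
  · rintro ⟨w, M⟩ δ
    rw [toOuterMeasure_keyGame, toOuterMeasure_keyGame, ← ENNReal.tsum_mul_left]
    refine tsum_congr fun p => ?_
    rw [mul_left_comm]
    refine congrArg (L p * ·) ?_
    rw [← ENNReal.tsum_mul_left]
    refine tsum_congr fun m => ?_
    rw [mul_left_comm]
    refine congrArg (PMF.uniformOfFintype (Fin ψ × Fin τ → Bit) m * ·) ?_
    by_cases h : p.2 = true ∧ Good m p.1 ∧ asMatrix m = M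
    · obtain ⟨hp, hm, rfl⟩ := h
      convert toOuterMeasure_press hm w δ using 3
      · ext Γ
        simp [asMatrix_entries, hp, hm, KeyRun.view, KeyRun.Δ]
      · ext Γ
        simp [asMatrix_entries, hp, hm, KeyRun.view]
    · have h0 : ∀ Γ : Fin τ → Bit, ¬ ((⟨Γ, p.1, p.2, asMatrix m⟩ : KeyRun τ ψ) ∉
          {r : KeyRun τ ψ | r.undetected = true ∧ ¬ Good (fun p => r.matrix p.1 p.2) r.leakSet} ∧
          KeyRun.view ⟨Γ, p.1, p.2, asMatrix m⟩ = some (w, M)) := by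
        rintro Γ ⟨h1, h2⟩
        refine h ?_
        by_cases hp : p.2 = true
        · simp [hp, KeyRun.view] at h2
          simp [hp, asMatrix_entries] at h1
          exact ⟨hp, h1, h2.2⟩
        · simp [hp, KeyRun.view] at h2
      have e1 : {Γ : Fin τ → Bit | (⟨Γ, p.1, p.2, asMatrix m⟩ : KeyRun τ ψ) ∈ {r : KeyRun τ ψ | r ∉
          {r : KeyRun τ ψ | r.undetected = true ∧ ¬ Good (fun p => r.matrix p.1 p.2) r.leakSet} ∧
          r.view = some (w, M)}} = ∅ := Set.eq_empty_of_forall_notMem h0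
      have e2 : {Γ : Fin τ → Bit | (⟨Γ, p.1, p.2, asMatrix m⟩ : KeyRun τ ψ) ∈ {r : KeyRun τ ψ | r ∉
          {r : KeyRun τ ψ | r.undetected = true ∧ ¬ Good (fun p => r.matrix p.1 p.2) r.leakSet} ∧
          r.view = some (w, M) ∧ r.Δ = δ}} = ∅ :=
        Set.eq_empty_of_forall_notMem fun Γ h => h0 Γ ⟨h.1, h.2.1⟩
      rw [e1, e2]
      simp

end uniformKey

/-! ### The work of the parties -/

section work

variable {ℓ τ ψ : ℕ}

theorem computes_outA : Computes
    (fun x : AWire ℓ τ ⊕ (Fin ψ × Fin τ) → Bit =>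
      pressA (fun w => x (Sum.inr w)) fun w => x (Sum.inl w)) (ℓ * ψ * (τ * 2 + 1)) := by
  refine (Computes.of_bits (n := fun w => match w with
    | AWire.bit _ => 0
    | AWire.mac _ _ => τ * 2 + 1) ?_).mono (le_of_eq ?_)
  · rintro (i | ⟨i, j⟩)
    · exact ComputesBit.input _
    · exact ComputesBit.dotProduct (fun _ => ComputesBit.input _) fun _ => ComputesBit.input _
  · rw [← (aWireEquiv ℓ ψ).sum_comp, Fintype.sum_sum_type]
    simp [aWireEquiv]

theorem computes_outB : Computes
    (fun x : (Fin ψ × Fin τ) ⊕ BWire ℓ τ → Bit =>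
      pressB (fun w => x (Sum.inl w)) fun w => x (Sum.inr w)) ((ψ + ℓ * ψ) * (τ * 2 + 1)) := by
  refine (Computes.of_bits_const (n := τ * 2 + 1) ?_).mono (le_of_eq ?_)
  · rintro (j | ⟨i, j⟩)
    · exact ComputesBit.dotProduct (fun _ => ComputesBit.input _) fun _ => ComputesBit.input _
    · exact ComputesBit.dotProduct (fun _ => ComputesBit.input _) fun _ => ComputesBit.input _
  · rw [card_bWire]

theorem workAtMost_compress (ℓ τ ψ : ℕ) : (compress ℓ τ ψ).WorkAtMost
    (ℓ * ψ * (τ * 2 + 1) + (ψ + ℓ * ψ) * (τ * 2 + 1) + ψ * τ + 2 * (ψ * τ)) := by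
  obtain ⟨CA, hA, hA'⟩ := (computes_outA (ℓ := ℓ) (τ := τ) (ψ := ψ)).exists_circuit
  obtain ⟨CB, hB, hB'⟩ := ((Computes.wires (Sum.inl : Fin ψ × Fin τ → _ ⊕ BWire ℓ τ)).elim
    (computes_outB (ℓ := ℓ) (τ := τ) (ψ := ψ))).exists_circuit
  have hc : Fintype.card (compress ℓ τ ψ).Coins = ψ * τ :=
    (Fintype.card_prod _ _).trans (by simp)
  have hm : Fintype.card (compress ℓ τ ψ).Msg = ψ * τ :=
    (Fintype.card_prod _ _).trans (by simp)
  refine ⟨CA, CB, fun a m => hA' _, fun r b => hB' _, ?_⟩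
  rw [hc, hm]
  refine add_le_add (add_le_add (add_le_add hA (hB.trans (le_of_eq ?_))) le_rfl) le_rfl
  rw [zero_add]

theorem communication_compress (ℓ τ ψ : ℕ) : (compress ℓ τ ψ).communication = ψ * τ :=
  (Fintype.card_prod _ _).trans (by simp)

end work

/-! ### The protocol is secure and cheap -/

section final

variable {ℓ τ ψ : ℕ}

theorem two_zpow_sub (ψ : ℕ) : (2 : ℝ≥0∞) ^ ((2 : ℤ) - (ψ : ℤ)) = 4 * (2 ^ ψ)⁻¹ := by
  rw [ENNReal.zpow_sub (by simp) (by simp), zpow_natCast]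
  norm_num

theorem toReal_two_mul_inv_le (ψ : ℕ) :
    ((2 ^ ψ : ℝ≥0∞)⁻¹ + (2 ^ ψ)⁻¹).toReal ≤ (2 : ℝ) ^ ((2 : ℤ) - (ψ : ℤ)) := by
  rw [ENNReal.toReal_add (by simp) (by simp), zpow_sub₀ (by norm_num), zpow_natCast]
  simp only [ENNReal.toReal_inv, ENNReal.toReal_pow, ENNReal.toReal_ofNat]
  have : (0 : ℝ) < (2 ^ ψ)⁻¹ := by positivity
  rw [div_eq_mul_inv]
  norm_num
  linarith

theorem securelyImplements_compress (ℓ : ℕ) {𝓛 : Set (Leakage τ)} (h : 3 * τ = 22 * ψ)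
    (hs : IsSecure 𝓛 (3 / 4 * (τ : ℝ))) :
    SecurelyImplements (compress ℓ τ ψ) 𝓛 ((2 : ℝ) ^ ((2 : ℤ) - (ψ : ℤ)))
      (1500 * (ψ + τ + ℓ + 1) ^ 6) := by
  have hε : badProb ψ (∅ : Finset (Fin τ)) + (2 ^ ψ)⁻¹ ≤ (2 ^ ψ)⁻¹ + (2 ^ ψ)⁻¹ :=
    add_le_add (badProb_empty_le h) le_rfl
  have htop : ((2 ^ ψ : ℝ≥0∞)⁻¹ + (2 ^ ψ)⁻¹) ≠ ⊤ := by simp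
  rintro (_ | _ | _)
  · refine ⟨keySim Corr.none ℓ τ ψ, keySim_cost_le _ _ _ _, fun E => ?_⟩
    have hb : badProb ψ (∅ : Finset (Fin τ)) ≤ (2 ^ ψ)⁻¹ + (2 ^ ψ)⁻¹ := le_self_add.trans hε
    exact (abs_prob_none_le E (ne_top_of_le_ne_top htop hb)).trans
      ((ENNReal.toReal_mono htop hb).trans (toReal_two_mul_inv_le ψ))
  · refine ⟨keySim Corr.alice ℓ τ ψ, keySim_cost_le _ _ _ _, fun E => ?_⟩
    exact (abs_prob_alice_le E (fun L hL => leakLoss_le_of_isSecure h hs hL)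
      (ne_top_of_le_ne_top htop hε)).trans
      ((ENNReal.toReal_mono htop hε).trans (toReal_two_mul_inv_le ψ))
  · refine ⟨bobSim ℓ τ ψ, bobSim_cost_le _ _ _, fun E => ?_⟩
    exact (abs_eq_zero.2 (sub_eq_zero.2 (prob_bob E))).le.trans (by positivity)

end final

end UC

end

theorem mainTheorem3 :
    ∃ C k : ℕ, ∀ (ψ τ ℓ : ℕ) (𝓛 : Set (Leakage τ)),
      3 * τ = 22 * ψ → IsSecure 𝓛 (3 / 4 * (τ : ℝ)) →
        SecurelyImplements (compress ℓ τ ψ) 𝓛 ((2 : ℝ) ^ ((2 : ℤ) - (ψ : ℤ)))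
          (C * (ψ + ℓ + 1) ^ k) ∧
        (compress ℓ τ ψ).communication ≤ C * ψ ^ 2 ∧
        (1 ≤ ℓ → (compress ℓ τ ψ).WorkAtMost (C * (ψ ^ 2 * ℓ))) ∧
        ∀ L ∈ 𝓛, UniformExcept ψ L ((2 : ℝ≥0∞) ^ ((2 : ℤ) - (ψ : ℤ))) := by
  refine ⟨1500 * 9 ^ 6, 6, fun ψ τ ℓ 𝓛 h hs => ⟨fun c => ?_, ?_, fun hℓ => ?_, fun L hL => ?_⟩⟩
  · obtain ⟨S, hS, hE⟩ := securelyImplements_compress ℓ h hs c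
    refine ⟨S, hS.trans ?_, hE⟩
    rw [mul_assoc, ← mul_pow]
    -- The key length is `22 / 3 ≤ 8` times the security parameter.
    exact Nat.mul_le_mul_left _ (Nat.pow_le_pow_left (by omega) 6)
  · rw [communication_compress]
    have h1 : ψ * τ ≤ ψ * (8 * ψ) := Nat.mul_le_mul_left _ (by omega)
    nlinarith
  · obtain ⟨CA, CB, hA, hB, hw⟩ := workAtMost_compress ℓ τ ψ
    refine ⟨CA, CB, hA, hB, hw.trans ?_⟩
    have h1 : ψ * τ ≤ 8 * ψ ^ 2 := by
      have : ψ * τ ≤ ψ * (8 * ψ) := Nat.mul_le_mul_left _ (by omega)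
      linarith
    have h2 : ψ ≤ ψ ^ 2 := Nat.le_self_pow (by norm_num) ψ
    have h3 : ψ * (τ * 2 + 1) ≤ 17 * ψ ^ 2 := by linarith
    have h4 : ℓ * (ψ * (τ * 2 + 1)) ≤ ℓ * (17 * ψ ^ 2) := Nat.mul_le_mul_left _ h3
    have h5 : 1 * ψ ^ 2 ≤ ℓ * ψ ^ 2 := Nat.mul_le_mul_right _ hℓ
    linarith
  · obtain ⟨F, hF, hu⟩ := uniformExcept_leakLoss ψ L
    refine ⟨F, (hF.trans (leakLoss_le_of_isSecure h hs hL)).trans ?_, hu⟩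
    rw [two_zpow_sub]
    exact le_mul_of_one_le_left zero_le (by norm_num)
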